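/- **Setting.** Let $T>0$. Write $k=(k_0,k_+,k_-)$, $x=(x_0,x_+,x_-)$, $k\cdot x=k_0x_0+k_+x_++k_-x_-$. The frequency $k_0$ runs over $\{(2n+1)\pi T : n\in\mathbb Z\}$ and $x_0$ over $[-\frac1T,\frac1T)$. The pair $(x_+,x_-)=\big(\frac{\pi}{2}(x_1+x_2),\frac{\pi}{2}(x_1-x_2)\big)$ is the image of a lattice site $(x_1,x_2)\in\mathbb Z^2$, so it runs over the pairs $(\frac{\pi}{2}m,\frac{\pi}{2}n)$ with $m\equiv n \pmod 2$. Write $\int d^3x=\int_{-1/T}^{1/T}dx_0\sum_{(x_1,x_2)\in\mathbb Z^2}$. Let $\eta:\mathbb R\to\mathbb R$ be a bounded function equal to $1$ in a neighbourhood of $0$. (Both $\eta\equiv1$, i.e. no cutoff at all, and any smooth compactly supported ultraviolet cutoff equal to $1$ near $0$ are allowed.) For $s\in\{1,-1\}$ let $\ell_s(k_+)=-s\,\frac{\pi}{2}(k_+-s)$, the first order Taylor polynomial of $\cos\frac{\pi}{2}k_+$ at $k_+=s$. For $x_+\neq0$ define the linearized propagators $$\tilde C_s(x)=\int d^3k\,\frac{e^{ik\cdot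 x}}{ik_0-2\ell_s(k_+)\cos\frac{\pi}{2}k_-},\qquad \bar{\tilde C}_s(x)=\int d^3k\,\frac{e^{ik\cdot x}}{-ik_0-2\ell_s(k_+)\cos\frac{\pi}{2}k_-},$$ $$\int d^3k=\frac1{32\pi}\,2\pi T\sum_{k_0}\eta(k_0)\int_{-2}^{2}dk_-\int_{-\infty}^{\infty}dk_+,$$ where the $k_+$ integral is an improper integral with no cutoff. The approximate second derivative of the amplitude of the graph with three propagators joining two vertices, at external momentum $(\pi T,1,0)$, is $$\partial_+^2\tilde A_G(\pi T,1,0)=\int d^3x\,x_+^2\,\tilde C_{1}(x)\,\bar{\tilde C}_{-1}(x)\,\bar{\tilde C}_{-1}(x)\,e^{-i(\pi Tx_0+x_+)}+2\int d^3x\,x_+^2\,\tilde C_{-1}(x)\,\bar{\tilde C}_{1}(x)\,\bar{\tilde C}_{-1}(x)\,e^{-i(\pi Tx_0+x_+)},$$ where the terms with $x_+=0$ are zero because of the factor $x_+^2$. **Theorem.** There are constants $K_5>0$ and $T_0>0$, depending only on $\eta$, such that for every $T\in(0,T_0)$ the following holds. All the expressions above are well defined: for all $x$ with $x_+\ne0$,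 the $k_+$ integrals converge whenever $\cos\frac{\pi}{2}k_-\neq0$, their values are integrable over $k_-\in[-2,2]$, and the sums over $k_0$ converge absolutely; and the two integrands in $x$ are absolutely integrable with respect to $d^3x$. Moreover $$\left|\partial_+^2\tilde A_G(\pi T,1,0)\right|\ \ge\ \frac{K_5}{T}.$$ -/

import Mathlib

open Filter Topology MeasureTheory

noncomputable section

namespace HubbardSunset

/-- The Matsubara frequency `k₀ = (2n+1)πT`. -/
def matsubara (T : ℝ) (n : ℤ) : ℝ := (2 * (n : ℝ) + 1) * Real.pi * T

/-- The first order Taylor polynomial of `k₊ ↦ cos (π k₊ / 2)` at the side `k₊ = s` of the Fermi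
surface, `s = 1` (right) or `s = -1` (left): it is `-(π/2)(k₊ - 1)` at `1` and `(π/2)(k₊ + 1)`
at `-1`. -/
def linCos (s k : ℝ) : ℝ := -s * (Real.pi / 2) * (k - s)

/-- The Fourier integrand `e^{i k·x} / (i σ k₀ - 2 ℓ_s(k₊) cos (π k₋ / 2))` of the linearized
propagator with `k₀ = (2n+1)πT`. The sign is `σ = 1` for the propagator `C` and `σ = -1` for the
propagator `C̄`, which has the conjugated denominator and the same exponential. -/
def fourierIntegrand (T s σ : ℝ) (n : ℤ) (x₀ xp xm km kp : ℝ) : ℂ :=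
  Complex.exp (Complex.I * ((matsubara T n * x₀ + kp * xp + km * xm : ℝ) : ℂ)) /
    (Complex.I * ((σ * matsubara T n : ℝ) : ℂ)
      - ((2 * linCos s kp * Real.cos (Real.pi / 2 * km) : ℝ) : ℂ))

/-- Convergence of the improper integral `∫_{-∞}^{∞} f`, both bounds going to infinity
independently. -/
def ImproperlyIntegrable (f : ℝ → ℂ) : Prop :=
  ∃ I : ℂ, Tendsto (fun p : ℝ × ℝ => ∫ k in p.1..p.2, f k) (atBot ×ˢ atTop) (𝓝 I)

/-- The value of the improper integral `∫_{-∞}^{∞} f`. -/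
def improperIntegral (f : ℝ → ℂ) : ℂ :=
  limUnder (atBot ×ˢ atTop) (fun p : ℝ × ℝ => ∫ k in p.1..p.2, f k)

/-- The integral over `k₊ ∈ ℝ`, then over `k₋ ∈ [-2,2]`, at the `n`-th Matsubara frequency. -/
def frequencyTerm (T s σ : ℝ) (n : ℤ) (x₀ xp xm : ℝ) : ℂ :=
  ∫ km in (-2 : ℝ)..2, improperIntegral (fourierIntegrand T s σ n x₀ xp xm km)

/-- The linearized propagator `∫ d³k e^{i k·x} / (i σ k₀ - 2 ℓ_s(k₊) cos (π k₋ / 2))`, where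
`∫ d³k = (1/(32π)) · 2πT ∑_{k₀} η(k₀) ∫_{-2}^{2} dk₋ ∫_{-∞}^{∞} dk₊`. -/
def linPropagator (η : ℝ → ℝ) (T s σ x₀ xp xm : ℝ) : ℂ :=
  (1 / (32 * Real.pi) : ℝ) *
    ((2 * Real.pi * T : ℝ) * ∑' n : ℤ, (η (matsubara T n) : ℂ) * frequencyTerm T s σ n x₀ xp xm)

/-- All the limits that enter `linPropagator` exist: the `k₊` integral converges whenever
`cos (π k₋ / 2) ≠ 0` (for almost every `k₋`), the result is integrable in `k₋`, and the series over
the Matsubara frequencies converges. -/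
def PropagatorConverges (η : ℝ → ℝ) (T s σ x₀ xp xm : ℝ) : Prop :=
  (∀ (n : ℤ) (km : ℝ), Real.cos (Real.pi / 2 * km) ≠ 0 →
      ImproperlyIntegrable (fourierIntegrand T s σ n x₀ xp xm km)) ∧
  (∀ n : ℤ, IntervalIntegrable
      (fun km => improperIntegral (fourierIntegrand T s σ n x₀ xp xm km)) volume (-2) 2) ∧
  Summable (fun n : ℤ => (η (matsubara T n) : ℂ) * frequencyTerm T s σ n x₀ xp xm)

/-- `x₊ = (π/2)(x₁ + x₂)` for a lattice site `(x₁, x₂)`. -/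
def xPlus (r : ℤ × ℤ) : ℝ := Real.pi / 2 * ((r.1 : ℝ) + r.2)

/-- `x₋ = (π/2)(x₁ - x₂)` for a lattice site `(x₁, x₂)`. -/
def xMinus (r : ℤ × ℤ) : ℝ := Real.pi / 2 * ((r.1 : ℝ) - r.2)

/-- The measure `d³x`: Lebesgue measure in imaginary time `x₀ ∈ [-1/T, 1/T[` times the counting
measure on the lattice `ℤ²`. In the coordinates `(x₊, x₋)` the lattice is the set of pairs
`(π m / 2, π n / 2)` with `m`, `n` of the same parity. -/
def spaceMeasure (T : ℝ) : Measure (ℝ × (ℤ × ℤ)) :=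
  (volume.restrict (Set.Ico (-(1 / T)) (1 / T))).prod Measure.count

/-- The integrand of the second derivative of the sunset graph at external momentum `(πT, 1, 0)`,
the three propagators being linearized at the sides `s₁`, `s₂`, `s₃`. At `x₊ = 0` it vanishes
because of the factor `x₊²`. -/
def sunsetIntegrand (η : ℝ → ℝ) (T s₁ s₂ s₃ : ℝ) (x : ℝ × (ℤ × ℤ)) : ℂ :=
  ((xPlus x.2 ^ 2 : ℝ) : ℂ) *
    linPropagator η T s₁ 1 x.1 (xPlus x.2) (xMinus x.2) *
    linPropagator η T s₂ (-1) x.1 (xPlus x.2) (xMinus x.2) *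
    linPropagator η T s₃ (-1) x.1 (xPlus x.2) (xMinus x.2) *
    Complex.exp (-Complex.I * ((Real.pi * T * x.1 + xPlus x.2 : ℝ) : ℂ))

/-- The approximate second derivative `∂₊² Ã_G (πT, 1, 0)`: one momentum is near the right side
and the two others near the left side; it is the first momentum, or one of the two others (two
equal contributions). -/
def approxSecondDeriv (η : ℝ → ℝ) (T : ℝ) : ℂ :=
  (∫ x, sunsetIntegrand η T 1 (-1) (-1) x ∂(spaceMeasure T)) +
    2 * ∫ x, sunsetIntegrand η T (-1) 1 (-1) x ∂(spaceMeasure T)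

end HubbardSunset

end

open Filter Topology MeasureTheory

noncomputable section

/-! Linearization makes everything computable. In `u = k₊ - s` the propagator denominator is affine,
so the `k₊` integral is a single-pole integral. It vanishes on one half of the `k₋` circle (`cos` of
one sign); on the other it produces `e^{-u/|cos θ|}/|cos θ|` with `θ = πk₋/2` and now `u =
|k₀x₊|/π`. The `k₋` integral is therefore a Fourier coefficient of this profile (`expSec`,
`frequencyTerm_eq`). The profile is flat where `cos θ = 0`, so its coefficients decay quadratically
in the index and exponentially in `u`. Hence every series and integral converges absolutely and may
be reordered.

The `x₀` integral enforces frequency conservation. The sites with `x₋` an odd multiple of `π/2`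
cancel under `x₊ ↦ -x₊`. On the remaining sites the sum over `x₋` turns the product of three Fourier
coefficients into a convolution `V(u,v,w) ≥ 0` of three profiles (`hasSum_expSecCoeff_mul_mul`). By
`approxSecondDeriv_eq` the amplitude is `i · 3T²/32` times the real sum, over `l` and the conserved
frequencies, of `l²` times the three frequency signs, the three cutoffs and `V`.

The sign comes from a pairing. In units of `πT` three odd integers summing to `1` have one or two
negative members, so their absolute values are `2a+1, 2b+1, 2(a+b)+1` with sign product `-1`, or
`2a+1, 2b+1, 2(a+b)+3` with sign product `+1`. As `V` decreases in each argument, every such pair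
contributes a nonpositive amount while the cutoffs equal `1`. For `a = b = 0` and `l` between about
`1/T` and `2/T`, the arguments of `V` are of order one and the pair contributes at most `-c/T²`.
There are at least `1/T` such `l`, giving `-c/T³` in total. Frequencies that feel the cutoff are
exponentially damped in `l` and contribute at most `C T^{-5/2}` (`exists_tsum_highMajorant_le`),
which is of lower order. Multiplication by `T²` gives the growth `1/T`. -/

namespace HubbardSunset

/-! ### The improper Fourier integral of a simple pole -/

/-- The function `u ↦ e^{iux} / (u + iκ)`. -/
def poleKernel (κ x u : ℝ) : ℂ :=
  Complex.exp (Complex.I * ((u * x : ℝ) : ℂ)) / ((u : ℂ) + Complex.I * (κ : ℂ))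

lemma ofReal_add_I_mul_ne_zero {κ : ℝ} (hκ : κ ≠ 0) (u : ℝ) :
    (u : ℂ) + Complex.I * (κ : ℂ) ≠ 0 := by
  intro h
  have := congrArg Complex.im h
  simp at this
  exact hκ this

lemma continuous_poleKernel {κ : ℝ} (hκ : κ ≠ 0) (x : ℝ) : Continuous (poleKernel κ x) := by
  unfold poleKernel
  refine Continuous.div (by fun_prop) (by fun_prop) fun u => ofReal_add_I_mul_ne_zero hκ u

/-- For `κ > 0`, `1/(u + iκ) = -i ∫₀^∞ e^{-κt} e^{iut} dt`. This replaces contour integration by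
Fubini. -/
lemma poleKernel_eq_laplace {κ : ℝ} (hκ : 0 < κ) (x u : ℝ) :
    poleKernel κ x u = ∫ t in Set.Ioi (0 : ℝ),
      -Complex.I * Complex.exp (-(κ * t : ℝ)) * Complex.exp (Complex.I * ((u * (t + x) : ℝ) : ℂ)) := by
  have h1 : ∀ t : ℝ, -Complex.I * Complex.exp (-(κ * t : ℝ)) *
      Complex.exp (Complex.I * ((u * (t + x) : ℝ) : ℂ)) =
      (-Complex.I * Complex.exp (Complex.I * ((u * x : ℝ) : ℂ))) *
        Complex.exp ((-(κ : ℂ) + Complex.I * u) * t) := by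
    intro t
    rw [mul_assoc, mul_assoc, ← Complex.exp_add, ← Complex.exp_add]
    congr 2
    push_cast
    ring
  simp_rw [h1]
  have h2 := ofReal_add_I_mul_ne_zero hκ.ne' u
  have h3 : (-(κ : ℂ) + Complex.I * u) = Complex.I * ((u : ℂ) + Complex.I * κ) := by
    linear_combination (-(κ : ℂ)) * Complex.I_sq
  rw [integral_const_mul, integral_exp_mul_complex_Ioi (by simpa using hκ)]
  rw [h3, poleKernel]
  have := Complex.I_ne_zero
  simp only [Complex.ofReal_zero, mul_zero, Complex.exp_zero]
  field_simp

/-- The Laplace-type tail that controls the partial integrals of `poleKernel`. -/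
def laplaceTail (κ x B : ℝ) : ℂ :=
  ∫ t in Set.Ioi (0 : ℝ), Complex.exp (-(κ * t : ℝ)) *
    (Complex.exp (Complex.I * ((B * (t + x) : ℝ) : ℂ)) / ((t + x : ℝ) : ℂ))

lemma integrableOn_laplaceTail {κ x : ℝ} (hκ : 0 < κ) (hx : 0 < x) (B : ℝ) :
    IntegrableOn (fun t : ℝ => Complex.exp (-(κ * t : ℝ)) *
      (Complex.exp (Complex.I * ((B * (t + x) : ℝ) : ℂ)) / ((t + x : ℝ) : ℂ))) (Set.Ioi 0) := by
  have h0 : IntegrableOn (fun t : ℝ => x⁻¹ * Real.exp (-κ * t)) (Set.Ioi 0) :=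
    (integrableOn_exp_mul_Ioi (by linarith) 0).const_mul _
  refine Integrable.mono' h0 ?_ ?_
  · refine ContinuousOn.aestronglyMeasurable ?_ measurableSet_Ioi
    refine ContinuousOn.mul (by fun_prop) (ContinuousOn.div (by fun_prop) (by fun_prop) ?_)
    intro t ht
    have : (0 : ℝ) < t := ht
    exact_mod_cast (by linarith : t + x ≠ 0)
  · refine (ae_restrict_iff' measurableSet_Ioi).mpr (Eventually.of_forall fun t ht => ?_)
    have ht' : (0 : ℝ) < t := ht
    have e1 : ‖Complex.exp (Complex.I * ((B * (t + x) : ℝ) : ℂ))‖ = 1 :=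
      Complex.norm_exp_I_mul_ofReal _
    rw [norm_mul, norm_div, e1, Complex.norm_real, Real.norm_of_nonneg (by linarith),
      ← Complex.ofReal_neg, ← Complex.ofReal_exp, Complex.norm_real,
      Real.norm_of_nonneg (Real.exp_pos _).le, mul_comm, one_div, neg_mul]
    gcongr
    linarith

/-- Integrate in `u` first in the Laplace representation. For `x > 0` the resulting denominator `t +
x` stays away from zero, so each endpoint gives a separately convergent integral. -/
lemma intervalIntegral_poleKernel {κ x : ℝ} (hκ : 0 < κ) (hx : 0 < x) (A B : ℝ) :
    ∫ u in A..B, poleKernel κ x u = laplaceTail κ x A - laplaceTail κ x B := by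
  simp_rw [poleKernel_eq_laplace hκ]
  rw [intervalIntegral_integral_swap]
  · rw [laplaceTail, laplaceTail, ← integral_sub (integrableOn_laplaceTail hκ hx A)
      (integrableOn_laplaceTail hκ hx B)]
    refine setIntegral_congr_fun measurableSet_Ioi fun t ht => ?_
    have ht' : (0 : ℝ) < t := ht
    have hne : ((t + x : ℝ) : ℂ) ≠ 0 := by exact_mod_cast (by linarith : t + x ≠ 0)
    have hne' : Complex.I * ((t + x : ℝ) : ℂ) ≠ 0 := mul_ne_zero Complex.I_ne_zero hne
    have e : ∀ u : ℝ, Complex.I * ((u * (t + x) : ℝ) : ℂ) = Complex.I * ((t + x : ℝ) : ℂ) * u := by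
      intro u; push_cast; ring
    simp only [e]
    rw [intervalIntegral.integral_const_mul, integral_exp_mul_complex hne']
    have := Complex.I_ne_zero
    field_simp
    ring
  · have h0 : Integrable (fun z : ℝ × ℝ => (1 : ℝ) * Real.exp (-κ * z.2))
        ((volume.restrict (Set.uIoc A B)).prod (volume.restrict (Set.Ioi 0))) := by
      refine Integrable.mul_prod (f := fun _ : ℝ => (1 : ℝ)) (g := fun t => Real.exp (-κ * t)) ?_
        (integrableOn_exp_mul_Ioi (by linarith) 0)
      exact integrableOn_const (by simp)
    refine Integrable.mono' h0 ?_ (Eventually.of_forall fun z => ?_)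
    · refine Continuous.aestronglyMeasurable ?_
      simp only [Function.uncurry_def]
      fun_prop
    · simp only [Function.uncurry_def]
      rw [norm_mul, norm_mul, Complex.norm_exp_I_mul_ofReal,
        ← Complex.ofReal_neg, ← Complex.ofReal_exp, Complex.norm_real,
        Real.norm_of_nonneg (Real.exp_pos _).le]
      simp

/-- Riemann–Lebesgue applied to `e^{-κt}/(t+x)` on the half line. The factor `-1/(2π)` converts the
frequency to the convention of `Real.fourierChar`, and the remaining phase `e^{iBx}` has modulus
one. -/
lemma tendsto_laplaceTail (κ x : ℝ) : Tendsto (laplaceTail κ x) (cocompact ℝ) (𝓝 0) := by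
  have h := Real.tendsto_integral_exp_smul_cocompact
    ((Set.Ioi (0 : ℝ)).indicator fun t : ℝ => Complex.exp (-(κ * t : ℝ)) / ((t + x : ℝ) : ℂ))
  have hπ := Real.pi_pos
  have hm : Tendsto (fun B : ℝ => (-1 / (2 * Real.pi)) * B) (cocompact ℝ) (cocompact ℝ) :=
    (Homeomorph.mulLeft₀ (-1 / (2 * Real.pi))
      (div_ne_zero (by norm_num) (by positivity))).isClosedEmbedding.tendsto_cocompact
  have h2 := (h.comp hm).norm
  rw [norm_zero] at h2
  rw [tendsto_zero_iff_norm_tendsto_zero]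
  refine h2.congr fun B => ?_
  have e : laplaceTail κ x B = Complex.exp (Complex.I * ((B * x : ℝ) : ℂ)) *
      ∫ t : ℝ, Real.fourierChar (-(t * ((-1 / (2 * Real.pi)) * B))) •
        (Set.Ioi (0 : ℝ)).indicator
          (fun t : ℝ => Complex.exp (-(κ * t : ℝ)) / ((t + x : ℝ) : ℂ)) t := by
    rw [laplaceTail, ← integral_const_mul, ← integral_indicator measurableSet_Ioi]
    congr 1
    funext t
    by_cases ht : t ∈ Set.Ioi (0 : ℝ)
    · rw [Set.indicator_of_mem ht, Set.indicator_of_mem ht, Circle.smul_def,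
        Real.fourierChar_apply, smul_eq_mul]
      have e1 : Complex.exp (Complex.I * ((B * (t + x) : ℝ) : ℂ)) =
          Complex.exp (Complex.I * ((B * x : ℝ) : ℂ)) *
          Complex.exp (((2 * Real.pi * -(t * (-1 / (2 * Real.pi) * B)) : ℝ) : ℂ) * Complex.I) := by
        rw [← Complex.exp_add]
        congr 1
        have : 2 * Real.pi * -(t * (-1 / (2 * Real.pi) * B)) = t * B := by field_simp
        rw [this]
        push_cast
        ring
      rw [e1]
      ring
    · rw [Set.indicator_of_notMem ht, Set.indicator_of_notMem ht]
      simp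
  rw [e, norm_mul, Complex.norm_exp_I_mul_ofReal, one_mul]
  rfl

lemma tendsto_integral_poleKernel_of_pos {κ x : ℝ} (hκ : 0 < κ) (hx : 0 < x) :
    Tendsto (fun p : ℝ × ℝ => ∫ u in p.1..p.2, poleKernel κ x u) (atBot ×ˢ atTop) (𝓝 0) := by
  simp_rw [intervalIntegral_poleKernel hκ hx]
  have h := tendsto_laplaceTail κ x
  have h1 := (h.mono_left atBot_le_cocompact).comp (tendsto_fst (f := atBot) (g := (atTop : Filter ℝ)))
  have h2 := (h.mono_left atTop_le_cocompact).comp (tendsto_snd (f := (atBot : Filter ℝ)) (g := atTop))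
  simpa using h1.sub h2

lemma poleKernel_neg_neg (κ x u : ℝ) :
    poleKernel (-κ) (-x) u = (starRingEnd ℂ) (poleKernel κ x u) := by
  simp only [poleKernel, map_div₀, ← Complex.exp_conj, map_mul, map_add, Complex.conj_I,
    Complex.conj_ofReal]
  congr 2 <;> push_cast <;> ring

lemma tendsto_integral_poleKernel_neg_neg {κ x : ℝ} {L : ℂ}
    (h : Tendsto (fun p : ℝ × ℝ => ∫ u in p.1..p.2, poleKernel κ x u) (atBot ×ˢ atTop) (𝓝 L)) :
    Tendsto (fun p : ℝ × ℝ => ∫ u in p.1..p.2, poleKernel (-κ) (-x) u) (atBot ×ˢ atTop)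
      (𝓝 ((starRingEnd ℂ) L)) := by
  have h2 := (Complex.continuous_conj.tendsto L).comp h
  refine h2.congr fun p => ?_
  simp only [Function.comp_apply]
  simp_rw [poleKernel_neg_neg]
  rw [intervalIntegral, intervalIntegral, integral_conj, integral_conj, map_sub]

lemma integrable_inv_sq_add_sq {κ : ℝ} (hκ : 0 < κ) :
    Integrable (fun u : ℝ => (u ^ 2 + κ ^ 2)⁻¹) := by
  have h := (integrable_inv_one_add_sq.comp_mul_left' (inv_ne_zero hκ.ne')).const_mul ((κ ^ 2)⁻¹)
  refine h.congr (Eventually.of_forall fun u => ?_)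
  simp only
  rw [← mul_inv]
  congr 1
  field_simp
  ring

/-- The Fourier transform of the two-sided exponential. -/
lemma fourier_exp_neg_abs {κ : ℝ} (hκ : 0 < κ) (w : ℝ) :
    FourierTransform.fourier (fun t : ℝ => ((Real.exp (-(κ * |t|)) : ℝ) : ℂ)) w =
      ((2 * κ * ((2 * Real.pi * w) ^ 2 + κ ^ 2)⁻¹ : ℝ) : ℂ) := by
  rw [Real.fourier_real_eq_integral_exp_smul]
  have e1 : Set.EqOn (fun t : ℝ => Complex.exp (((-2 * Real.pi * t * w : ℝ) : ℂ) * Complex.I) •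
      ((Real.exp (-(κ * |t|)) : ℝ) : ℂ)) (fun t : ℝ => Complex.exp
      (((κ : ℂ) - 2 * Real.pi * w * Complex.I) * t)) (Set.Iic 0) := by
    intro t ht
    have ht' : t ≤ 0 := ht
    simp only [abs_of_nonpos ht', smul_eq_mul]
    rw [Complex.ofReal_exp, ← Complex.exp_add]
    congr 1
    push_cast
    ring
  have e2 : Set.EqOn (fun t : ℝ => Complex.exp (((-2 * Real.pi * t * w : ℝ) : ℂ) * Complex.I) •
      ((Real.exp (-(κ * |t|)) : ℝ) : ℂ)) (fun t : ℝ => Complex.exp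
      ((-(κ : ℂ) - 2 * Real.pi * w * Complex.I) * t)) (Set.Ioi 0) := by
    intro t ht
    have ht' : 0 < t := ht
    simp only [abs_of_pos ht', smul_eq_mul]
    rw [Complex.ofReal_exp, ← Complex.exp_add]
    congr 1
    push_cast
    ring
  have r1 : 0 < ((κ : ℂ) - 2 * Real.pi * w * Complex.I).re := by simpa using hκ
  have r2 : (-(κ : ℂ) - 2 * Real.pi * w * Complex.I).re < 0 := by simpa using hκ
  have i1 := (integrableOn_exp_mul_complex_Iic r1 0).congr_fun e1.symm measurableSet_Iic
  have i2 := (integrableOn_exp_mul_complex_Ioi r2 0).congr_fun e2.symm measurableSet_Ioi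
  rw [← intervalIntegral.integral_Iic_add_Ioi i1 i2, setIntegral_congr_fun measurableSet_Iic e1,
    setIntegral_congr_fun measurableSet_Ioi e2, integral_exp_mul_complex_Iic r1,
    integral_exp_mul_complex_Ioi r2]
  have n1 : (κ : ℂ) - 2 * Real.pi * w * Complex.I ≠ 0 := fun h => by simp [h] at r1
  have n2 : -(κ : ℂ) - 2 * Real.pi * w * Complex.I ≠ 0 := fun h => by simp [h] at r2
  have n3 : (2 * Real.pi * w : ℂ) ^ 2 + (κ : ℂ) ^ 2 ≠ 0 := by
    have : (2 * Real.pi * w) ^ 2 + κ ^ 2 ≠ 0 := by positivity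
    exact_mod_cast this
  push_cast
  simp only [mul_zero, Complex.exp_zero]
  have n4 : (2 * Real.pi * w : ℂ) ^ 2 + (κ : ℂ) ^ 2 =
      -(((κ : ℂ) - 2 * Real.pi * w * Complex.I) * (-(κ : ℂ) - 2 * Real.pi * w * Complex.I)) := by
    linear_combination (2 * Real.pi * w : ℂ) ^ 2 * Complex.I_sq
  rw [n4]
  field_simp
  ring

/-- The characteristic function of the Cauchy distribution. -/
lemma integral_cexp_mul_inv_sq_add_sq {κ : ℝ} (hκ : 0 < κ) (x : ℝ) :
    ∫ u : ℝ, Complex.exp (Complex.I * ((u * x : ℝ) : ℂ)) * (((u ^ 2 + κ ^ 2)⁻¹ : ℝ) : ℂ) =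
      ((Real.pi / κ * Real.exp (-(κ * |x|)) : ℝ) : ℂ) := by
  have hπ := Real.pi_pos
  set F : ℝ → ℂ := fun t : ℝ => ((Real.exp (-(κ * |t|)) : ℝ) : ℂ) with hF
  have hFc : Continuous F := by fun_prop
  have hFi : Integrable F := by
    have j1 : IntegrableOn F (Set.Iic 0) := by
      refine (integrableOn_exp_mul_complex_Iic (a := (κ : ℂ)) (by simpa using hκ) 0).congr_fun
        (fun t ht => ?_) measurableSet_Iic
      have ht' : t ≤ 0 := ht
      simp [hF, abs_of_nonpos ht']
    have j2 : IntegrableOn F (Set.Ioi 0) := by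
      refine (integrableOn_exp_mul_complex_Ioi (a := (-κ : ℂ)) (by simpa using hκ) 0).congr_fun
        (fun t ht => ?_) measurableSet_Ioi
      have ht' : 0 < t := ht
      simp [hF, abs_of_pos ht']
    have := j1.union j2
    rwa [Set.Iic_union_Ioi, integrableOn_univ] at this
  have hFt : FourierTransform.fourier F =
      fun w : ℝ => ((2 * κ * ((2 * Real.pi * w) ^ 2 + κ ^ 2)⁻¹ : ℝ) : ℂ) :=
    funext fun w => fourier_exp_neg_abs hκ w
  have hFti : Integrable (FourierTransform.fourier F) := by
    rw [hFt]
    have := (integrable_inv_sq_add_sq hκ).comp_mul_left' (R := 2 * Real.pi) (by positivity)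
    exact (this.const_mul (2 * κ)).ofReal
  have h := congrFun (hFc.fourierInv_fourier_eq hFi hFti) x
  rw [Real.fourierInv_eq', hFt] at h
  have h2 := Measure.integral_comp_mul_left (fun u : ℝ =>
    Complex.exp (Complex.I * ((u * x : ℝ) : ℂ)) * (((u ^ 2 + κ ^ 2)⁻¹ : ℝ) : ℂ)) (2 * Real.pi)
  have h3 : (∫ w : ℝ, Complex.exp (((2 * Real.pi * inner ℝ w x : ℝ) : ℂ) * Complex.I) •
      ((2 * κ * ((2 * Real.pi * w) ^ 2 + κ ^ 2)⁻¹ : ℝ) : ℂ)) = (2 * κ : ℂ) *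
      ∫ w : ℝ, Complex.exp (Complex.I * ((2 * Real.pi * w * x : ℝ) : ℂ)) *
        ((((2 * Real.pi * w) ^ 2 + κ ^ 2)⁻¹ : ℝ) : ℂ) := by
    rw [← integral_const_mul]
    congr 1
    funext w
    have : (2 * Real.pi * inner ℝ w x : ℝ) = 2 * Real.pi * w * x := by
      simp only [RCLike.inner_apply, conj_trivial]
      ring
    rw [this, smul_eq_mul, mul_comm (((2 * Real.pi * w * x : ℝ) : ℂ))]
    push_cast
    ring
  rw [h3, h2, abs_of_pos (by positivity), Complex.real_smul] at h
  have hκ' : (κ : ℂ) ≠ 0 := by exact_mod_cast hκ.ne'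
  have hπ' : (Real.pi : ℂ) ≠ 0 := by exact_mod_cast hπ.ne'
  have hfin : ((Real.pi / κ * Real.exp (-(κ * |x|)) : ℝ) : ℂ) = (Real.pi / κ : ℂ) * F x := by
    simp [hF]
  rw [hfin, ← h, Complex.ofReal_inv, Complex.ofReal_mul]
  generalize ∫ u : ℝ, Complex.exp (Complex.I * ((u * x : ℝ) : ℂ)) *
    (((u ^ 2 + κ ^ 2)⁻¹ : ℝ) : ℂ) = J
  push_cast
  field_simp

/-- The improper integral of `poleKernel κ x`. -/
def poleValue (κ x : ℝ) : ℂ :=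
  if κ * x < 0 then -(2 * Real.pi * Complex.I) * (SignType.sign κ : ℝ) * (Real.exp (-|κ * x|) : ℝ)
  else 0

/-- Write `1/(u+iκ) = 1/(u-iκ) - 2iκ/(u²+κ²)`. The first term integrates to zero, as the conjugate
of the case of positive `κ` and `x`; the second is absolutely integrable, with the Cauchy
characteristic function as its value. -/
lemma tendsto_integral_poleKernel_of_pos_of_neg {κ x : ℝ} (hκ : 0 < κ) (hx : x < 0) :
    Tendsto (fun p : ℝ × ℝ => ∫ u in p.1..p.2, poleKernel κ x u) (atBot ×ˢ atTop)
      (𝓝 (poleValue κ x)) := by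
  have h1 := tendsto_integral_poleKernel_neg_neg
    (tendsto_integral_poleKernel_of_pos hκ (neg_pos.mpr hx))
  rw [neg_neg, map_zero] at h1
  set g : ℝ → ℂ := fun u =>
    Complex.exp (Complex.I * ((u * x : ℝ) : ℂ)) * (((u ^ 2 + κ ^ 2)⁻¹ : ℝ) : ℂ) with hg
  have hgi : Integrable g := by
    refine (integrable_inv_sq_add_sq hκ).mono' ?_ (Eventually.of_forall fun u => ?_)
    · refine Continuous.aestronglyMeasurable ?_
      have : Continuous fun u : ℝ => (u ^ 2 + κ ^ 2)⁻¹ :=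
        Continuous.inv₀ (by fun_prop) fun u => by positivity
      fun_prop
    · rw [hg]
      simp only
      rw [norm_mul, Complex.norm_exp_I_mul_ofReal, one_mul, Complex.norm_real,
        Real.norm_of_nonneg (by positivity)]
  have h2 : Tendsto (fun p : ℝ × ℝ => ∫ u in p.1..p.2, g u) (atBot ×ˢ atTop) (𝓝 (∫ u, g u)) :=
    intervalIntegral_tendsto_integral hgi tendsto_fst tendsto_snd
  have h3 := h1.add (h2.const_mul (-2 * Complex.I * κ))
  have e : ∀ u, poleKernel κ x u = poleKernel (-κ) x u + (-2 * Complex.I * κ) * g u := by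
    intro u
    have n1 := ofReal_add_I_mul_ne_zero hκ.ne' u
    have n2 := ofReal_add_I_mul_ne_zero (neg_ne_zero.mpr hκ.ne') u
    have n3 : (u : ℂ) ^ 2 + (κ : ℂ) ^ 2 ≠ 0 := by
      have : u ^ 2 + κ ^ 2 ≠ 0 := by positivity
      exact_mod_cast this
    simp only [poleKernel, hg]
    push_cast at n2 ⊢
    rw [div_add' _ _ _ n2, div_eq_div_iff n1 n2]
    field_simp
    linear_combination (-2 * Complex.I * (κ : ℂ) ^ 3) * Complex.I_sq
  have hL : poleValue κ x = 0 + (-2 * Complex.I * κ) * ∫ u, g u := by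
    have hκ' : (κ : ℂ) ≠ 0 := by exact_mod_cast hκ.ne'
    rw [hg, integral_cexp_mul_inv_sq_add_sq hκ, poleValue, if_pos (mul_neg_of_pos_of_neg hκ hx),
      sign_pos hκ, abs_mul, abs_of_pos hκ]
    push_cast
    simp
    field_simp
  rw [hL]
  refine h3.congr fun p => ?_
  simp_rw [e]
  rw [intervalIntegral.integral_add
      ((continuous_poleKernel (neg_ne_zero.mpr hκ.ne') x).intervalIntegrable _ _)
      ((hgi.const_mul _).intervalIntegrable), intervalIntegral.integral_const_mul]

theorem tendsto_integral_poleKernel {κ x : ℝ} (hκ : κ ≠ 0) (hx : x ≠ 0) :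
    Tendsto (fun p : ℝ × ℝ => ∫ u in p.1..p.2, poleKernel κ x u) (atBot ×ˢ atTop)
      (𝓝 (poleValue κ x)) := by
  rcases lt_or_gt_of_ne hκ with h1 | h1 <;> rcases lt_or_gt_of_ne hx with h2 | h2
  · have := tendsto_integral_poleKernel_neg_neg
      (tendsto_integral_poleKernel_of_pos (neg_pos.mpr h1) (neg_pos.mpr h2))
    rw [neg_neg, neg_neg, map_zero] at this
    rwa [poleValue, if_neg (by nlinarith)]
  · have := tendsto_integral_poleKernel_neg_neg
      (tendsto_integral_poleKernel_of_pos_of_neg (neg_pos.mpr h1) (neg_neg_of_pos h2))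
    rw [neg_neg, neg_neg, poleValue, if_pos (by nlinarith), sign_pos (by linarith)] at this
    rw [poleValue, if_pos (mul_neg_of_neg_of_pos h1 h2), sign_neg h1]
    simp only [map_mul, map_neg, map_ofNat, Complex.conj_ofReal, Complex.conj_I] at this
    simpa using this
  · exact tendsto_integral_poleKernel_of_pos_of_neg h1 h2
  · rw [poleValue, if_neg (by nlinarith)]
    exact tendsto_integral_poleKernel_of_pos h1 h2

/-! ### The profile `e^{-u/|cos θ|}/|cos θ|` and its Fourier coefficients -/

/-- The function `c ↦ e^{-u/|c|} c^{-k}`, which is flat at `c = 0` for `u > 0` and `k ≠ 0`. -/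
def expInvPow (k : ℕ) (u c : ℝ) : ℝ := Real.exp (-(u / |c|)) * c⁻¹ ^ k

lemma exp_neg_le_factorial_div_pow (k : ℕ) {t : ℝ} (ht : 0 < t) :
    Real.exp (-t) ≤ k.factorial / t ^ k := by
  have h := Real.pow_div_factorial_le_exp t ht.le k
  rw [Real.exp_neg, ← inv_div]
  gcongr

/-- The convention `0⁻¹ = 0` gives the value that makes the function continuous at `0`. -/
lemma expInvPow_zero_right {k : ℕ} (hk : k ≠ 0) (u : ℝ) : expInvPow k u 0 = 0 := by
  simp [expInvPow, hk]

lemma abs_expInvPow_le_mul_abs {k : ℕ} (hk : k ≠ 0) {u : ℝ} (hu : 0 < u) (c : ℝ) :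
    |expInvPow k u c| ≤ (k + 1).factorial / u ^ (k + 1) * |c| := by
  rcases eq_or_ne c 0 with rfl | hc
  · simp [expInvPow_zero_right hk]
  · have hc' : 0 < |c| := abs_pos.mpr hc
    have h := exp_neg_le_factorial_div_pow (k + 1) (div_pos hu hc')
    rw [expInvPow, abs_mul, abs_of_pos (Real.exp_pos _), abs_pow, abs_inv]
    calc _ ≤ _ := mul_le_mul_of_nonneg_right h (by positivity)
      _ = _ := by
        rw [inv_pow, div_pow, pow_succ |c|]
        field_simp

/-- Half of the exponent `u/|c|` is at least `u/2` because `|c| ≤ 1`; the other half absorbs the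
negative power of `c`. -/
lemma abs_expInvPow_le {k : ℕ} (hk : k ≠ 0) {u : ℝ} (hu : 0 < u) {c : ℝ} (hc : |c| ≤ 1) :
    |expInvPow k u c| ≤ Real.exp (-(u / 2)) * (k.factorial * (2 / u) ^ k) := by
  rcases eq_or_ne c 0 with rfl | hc0
  · rw [expInvPow_zero_right hk, abs_zero]
    positivity
  · have hc' : 0 < |c| := abs_pos.mpr hc0
    have h := exp_neg_le_factorial_div_pow k (t := u / 2 * |c|⁻¹) (by positivity)
    have h1 : u / 2 ≤ u / 2 * |c|⁻¹ := le_mul_of_one_le_right (by positivity) ((one_le_inv₀ hc').mpr hc)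
    rw [expInvPow, abs_mul, abs_of_pos (Real.exp_pos _), abs_pow, abs_inv]
    have h2 : Real.exp (-(u / |c|)) ≤ Real.exp (-(u / 2)) * Real.exp (-(u / 2 * |c|⁻¹)) := by
      rw [← Real.exp_add, Real.exp_le_exp, div_eq_mul_inv]
      linarith
    calc _ ≤ (Real.exp (-(u / 2)) * (k.factorial / (u / 2 * |c|⁻¹) ^ k)) * |c|⁻¹ ^ k := by
          gcongr
          exact h2.trans (by gcongr)
      _ = _ := by
        rw [mul_pow, div_pow, div_pow, inv_pow]
        field_simp

lemma continuous_expInvPow {k : ℕ} (hk : k ≠ 0) {u : ℝ} (hu : 0 < u) :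
    Continuous (expInvPow k u) := by
  rw [continuous_iff_continuousAt]
  intro c
  rcases eq_or_ne c 0 with rfl | hc
  · rw [ContinuousAt, expInvPow_zero_right hk]
    refine squeeze_zero_norm (a := fun c => (k + 1).factorial / u ^ (k + 1) * |c|)
      (fun c => abs_expInvPow_le_mul_abs hk hu c) ?_
    have : Continuous fun c : ℝ => ((k + 1).factorial : ℝ) / u ^ (k + 1) * |c| := by fun_prop
    simpa using this.tendsto 0
  · unfold expInvPow
    have : |c| ≠ 0 := abs_ne_zero.mpr hc
    fun_prop (disch := assumption)

/-- The profile `θ ↦ e^{-u/|cos θ|} / |cos θ|` of the linearized propagator. -/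
def expSec (u θ : ℝ) : ℝ := expInvPow 1 u |Real.cos θ|

lemma expSec_eq (u θ : ℝ) : expSec u θ = Real.exp (-(u / |Real.cos θ|)) * |Real.cos θ|⁻¹ := by
  simp [expSec, expInvPow]

lemma continuous_expSec {u : ℝ} (hu : 0 < u) : Continuous (expSec u) :=
  (continuous_expInvPow one_ne_zero hu).comp (by fun_prop)

lemma expSec_nonneg (u θ : ℝ) : 0 ≤ expSec u θ := by
  rw [expSec_eq]
  positivity

lemma expSec_add_pi (u θ : ℝ) : expSec u (θ + Real.pi) = expSec u θ := by
  rw [expSec, expSec, Real.cos_add_pi, abs_neg]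

lemma expSec_neg (u θ : ℝ) : expSec u (-θ) = expSec u θ := by
  rw [expSec, expSec, Real.cos_neg]

lemma expSec_eq_zero {u θ : ℝ} (h : Real.cos θ = 0) : expSec u θ = 0 := by
  rw [expSec_eq, h]
  simp

lemma expSec_le_of_le {u v : ℝ} (h : u ≤ v) (θ : ℝ) : expSec v θ ≤ expSec u θ := by
  rw [expSec_eq, expSec_eq]
  gcongr

lemma expSec_le {u : ℝ} (hu : 0 < u) (θ : ℝ) : expSec u θ ≤ Real.exp (-(u / 2)) * (2 / u) := by
  have := abs_expInvPow_le (k := 1) (by norm_num) hu (c := |Real.cos θ|) (by simpa using Real.abs_cos_le_one θ)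
  rw [Nat.factorial_one, Nat.cast_one, one_mul, pow_one] at this
  exact (le_abs_self _).trans this

/-- The Fourier coefficients of `expSec u` on the half circle `cos θ > 0`. -/
def expSecCoeff (n : ℤ) (u : ℝ) : ℂ :=
  ∫ θ in (-(Real.pi / 2))..(Real.pi / 2), Complex.exp (Complex.I * ((n * θ : ℝ) : ℂ)) * expSec u θ

lemma norm_expSecCoeff_le (n : ℤ) {u : ℝ} (hu : 0 < u) :
    ‖expSecCoeff n u‖ ≤ Real.exp (-(u / 2)) * (2 / u) * Real.pi := by
  have h := intervalIntegral.norm_integral_le_of_norm_le_const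
    (a := -(Real.pi / 2)) (b := Real.pi / 2) (C := Real.exp (-(u / 2)) * (2 / u))
    (f := fun θ : ℝ => Complex.exp (Complex.I * ((n * θ : ℝ) : ℂ)) * expSec u θ) (fun θ _ => by
      rw [norm_mul, Complex.norm_exp_I_mul_ofReal, one_mul, Complex.norm_real,
        Real.norm_of_nonneg (expSec_nonneg u θ)]
      exact expSec_le hu θ)
  have e : Real.pi / 2 - -(Real.pi / 2) = Real.pi := by ring
  rw [e, abs_of_pos Real.pi_pos] at h
  exact h

lemma expSecCoeff_neg (n : ℤ) (u : ℝ) : expSecCoeff (-n) u = expSecCoeff n u := by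
  have h := intervalIntegral.integral_comp_neg (a := -(Real.pi / 2)) (b := Real.pi / 2)
    (fun θ : ℝ => Complex.exp (Complex.I * ((n * θ : ℝ) : ℂ)) * expSec u θ)
  rw [neg_neg] at h
  rw [expSecCoeff, expSecCoeff, ← h]
  congr 1
  funext θ
  rw [expSec_neg]
  push_cast
  ring_nf

/-- The derivative of `expSec u` where `cos θ > 0`. -/
def expSecDeriv (u θ : ℝ) : ℝ :=
  Real.sin θ * (expInvPow 2 u (Real.cos θ) - u * expInvPow 3 u (Real.cos θ))

/-- The second derivative of `expSec u` where `cos θ > 0`. -/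
def expSecDeriv₂ (u θ : ℝ) : ℝ :=
  Real.cos θ * (expInvPow 2 u (Real.cos θ) - u * expInvPow 3 u (Real.cos θ)) +
    Real.sin θ ^ 2 * (2 * expInvPow 3 u (Real.cos θ) - 4 * u * expInvPow 4 u (Real.cos θ) +
      u ^ 2 * expInvPow 5 u (Real.cos θ))

lemma hasDerivAt_expInvPow_cos (k : ℕ) (u : ℝ) {θ : ℝ} (hθ : 0 < Real.cos θ) :
    HasDerivAt (fun θ => expInvPow k u (Real.cos θ))
      (Real.sin θ * (k * expInvPow (k + 1) u (Real.cos θ) - u * expInvPow (k + 2) u (Real.cos θ)))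
      θ := by
  have hc := Real.hasDerivAt_cos θ
  have h1 : HasDerivAt (fun θ => Real.exp (-(u * (Real.cos θ)⁻¹)) * (Real.cos θ)⁻¹ ^ k)
      (Real.sin θ * (k * expInvPow (k + 1) u (Real.cos θ) - u * expInvPow (k + 2) u (Real.cos θ)))
      θ := by
    have hi := hc.inv hθ.ne'
    have := ((hi.const_mul u).neg.exp).mul (hi.pow k)
    convert! this using 1
    rw [expInvPow, expInvPow, abs_of_pos hθ, div_eq_mul_inv]
    rcases k with _ | k
    · simp
      field_simp
    · simp
      field_simp
      ring
  refine h1.congr_of_eventuallyEq ?_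
  filter_upwards [Real.continuous_cos.continuousAt.eventually (lt_mem_nhds hθ)] with y hy
  rw [expInvPow, abs_of_pos hy, div_eq_mul_inv]

lemma hasDerivAt_expSec (u : ℝ) {θ : ℝ} (hθ : 0 < Real.cos θ) :
    HasDerivAt (expSec u) (expSecDeriv u θ) θ := by
  have h := hasDerivAt_expInvPow_cos 1 u hθ
  rw [Nat.cast_one, one_mul] at h
  refine h.congr_of_eventuallyEq ?_
  filter_upwards [Real.continuous_cos.continuousAt.eventually (lt_mem_nhds hθ)] with y hy
  rw [expSec, abs_of_pos hy]

lemma hasDerivAt_expSecDeriv (u : ℝ) {θ : ℝ} (hθ : 0 < Real.cos θ) :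
    HasDerivAt (expSecDeriv u) (expSecDeriv₂ u θ) θ := by
  have h := (Real.hasDerivAt_sin θ).mul ((hasDerivAt_expInvPow_cos 2 u hθ).sub
    ((hasDerivAt_expInvPow_cos 3 u hθ).const_mul u))
  convert! h using 1
  simp only [expSecDeriv₂, Nat.cast_ofNat, Pi.sub_apply]
  ring

lemma continuous_expSecDeriv {u : ℝ} (hu : 0 < u) : Continuous (expSecDeriv u) := by
  have h2 := (continuous_expInvPow (k := 2) (by norm_num) hu).comp Real.continuous_cos
  have h3 := (continuous_expInvPow (k := 3) (by norm_num) hu).comp Real.continuous_cos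
  exact Real.continuous_sin.mul (h2.sub (h3.const_mul u))

lemma continuous_expSecDeriv₂ {u : ℝ} (hu : 0 < u) : Continuous (expSecDeriv₂ u) := by
  have h2 := (continuous_expInvPow (k := 2) (by norm_num) hu).comp Real.continuous_cos
  have h3 := (continuous_expInvPow (k := 3) (by norm_num) hu).comp Real.continuous_cos
  have h4 := (continuous_expInvPow (k := 4) (by norm_num) hu).comp Real.continuous_cos
  have h5 := (continuous_expInvPow (k := 5) (by norm_num) hu).comp Real.continuous_cos
  exact (Real.continuous_cos.mul (h2.sub (h3.const_mul u))).add
    ((Real.continuous_sin.pow 2).mul (((h3.const_mul 2).sub (h4.const_mul (4 * u))).add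
      (h5.const_mul (u ^ 2))))

/-- The five constants are `2!·2²`, `3!·2³`, `2·3!·2³`, `4·4!·2⁴` and `5!·2⁵`: one for each term of
`expSecDeriv₂`, with the leftover powers of `1/u` bounded by those of `1/u₀`. -/
lemma abs_expSecDeriv₂_le {u₀ u : ℝ} (hu₀ : 0 < u₀) (hu : u₀ ≤ u) (θ : ℝ) :
    |expSecDeriv₂ u θ| ≤ Real.exp (-(u / 2)) * (8 / u₀ ^ 2 + 48 / u₀ ^ 2 + 96 / u₀ ^ 3
      + 1536 / u₀ ^ 3 + 3840 / u₀ ^ 3) := by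
  have hu' : 0 < u := hu₀.trans_le hu
  have hc := Real.abs_cos_le_one θ
  have hs : |Real.sin θ ^ 2| ≤ 1 := by
    rw [abs_pow]
    exact pow_le_one₀ (abs_nonneg _) (Real.abs_sin_le_one θ)
  have b2 := abs_expInvPow_le (k := 2) (by norm_num) hu' hc
  have b3 := abs_expInvPow_le (k := 3) (by norm_num) hu' hc
  have b4 := abs_expInvPow_le (k := 4) (by norm_num) hu' hc
  have b5 := abs_expInvPow_le (k := 5) (by norm_num) hu' hc
  set E := Real.exp (-(u / 2)) with hE
  have hEp : 0 < E := Real.exp_pos _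
  set p2 := expInvPow 2 u (Real.cos θ)
  set p3 := expInvPow 3 u (Real.cos θ)
  set p4 := expInvPow 4 u (Real.cos θ)
  set p5 := expInvPow 5 u (Real.cos θ)
  have d2 : 1 / u ^ 2 ≤ 1 / u₀ ^ 2 := by gcongr
  have d3 : 1 / u ^ 3 ≤ 1 / u₀ ^ 3 := by gcongr
  have c2 : |p2| ≤ E * (8 / u₀ ^ 2) := by
    refine b2.trans ?_
    have : ((2 : ℕ).factorial : ℝ) * (2 / u) ^ 2 = 8 * (1 / u ^ 2) := by
      simp [Nat.factorial]; ring
    rw [this]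
    gcongr
    linarith [d2, (by ring : 8 / u₀ ^ 2 = 8 * (1 / u₀ ^ 2))]
  have c3 : |u * p3| ≤ E * (48 / u₀ ^ 2) := by
    rw [abs_mul, abs_of_pos hu']
    refine (mul_le_mul_of_nonneg_left b3 hu'.le).trans ?_
    have : u * (E * (((3 : ℕ).factorial : ℝ) * (2 / u) ^ 3)) = E * (48 * (1 / u ^ 2)) := by
      simp [Nat.factorial]; field_simp; ring
    rw [this]
    gcongr
    linarith [d2, (by ring : 48 / u₀ ^ 2 = 48 * (1 / u₀ ^ 2))]
  have c3' : |2 * p3| ≤ E * (96 / u₀ ^ 3) := by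
    rw [abs_mul, abs_two]
    refine (mul_le_mul_of_nonneg_left b3 two_pos.le).trans ?_
    have : 2 * (E * (((3 : ℕ).factorial : ℝ) * (2 / u) ^ 3)) = E * (96 * (1 / u ^ 3)) := by
      simp [Nat.factorial]; field_simp; ring
    rw [this]
    gcongr
    linarith [d3, (by ring : 96 / u₀ ^ 3 = 96 * (1 / u₀ ^ 3))]
  have c4 : |4 * u * p4| ≤ E * (1536 / u₀ ^ 3) := by
    rw [abs_mul, abs_of_pos (by positivity)]
    refine (mul_le_mul_of_nonneg_left b4 (by positivity)).trans ?_
    have : 4 * u * (E * (((4 : ℕ).factorial : ℝ) * (2 / u) ^ 4)) = E * (1536 * (1 / u ^ 3)) := by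
      simp [Nat.factorial]; field_simp; ring
    rw [this]
    gcongr
    linarith [d3, (by ring : 1536 / u₀ ^ 3 = 1536 * (1 / u₀ ^ 3))]
  have c5 : |u ^ 2 * p5| ≤ E * (3840 / u₀ ^ 3) := by
    rw [abs_mul, abs_of_pos (by positivity)]
    refine (mul_le_mul_of_nonneg_left b5 (by positivity)).trans ?_
    have : u ^ 2 * (E * (((5 : ℕ).factorial : ℝ) * (2 / u) ^ 5)) = E * (3840 * (1 / u ^ 3)) := by
      simp [Nat.factorial]; field_simp; ring
    rw [this]
    gcongr
    linarith [d3, (by ring : 3840 / u₀ ^ 3 = 3840 * (1 / u₀ ^ 3))]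
  have t1 : |Real.cos θ * (p2 - u * p3)| ≤ |p2| + |u * p3| := by
    rw [abs_mul]
    exact (mul_le_of_le_one_left (abs_nonneg _) hc).trans (abs_sub _ _)
  have t2 : |Real.sin θ ^ 2 * (2 * p3 - 4 * u * p4 + u ^ 2 * p5)| ≤
      |2 * p3| + |4 * u * p4| + |u ^ 2 * p5| := by
    rw [abs_mul]
    exact (mul_le_of_le_one_left (abs_nonneg _) hs).trans
      ((abs_add_le _ _).trans (add_le_add_left (abs_sub _ _) _))
  refine (abs_add_le _ _).trans ((add_le_add t1 t2).trans ?_)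
  linarith

/-- Two integrations by parts done at once: `e^{inθ}(f' - inf)` is a primitive of `e^{inθ}(f'' +
n²f)`. The boundary terms vanish because the profile and its derivative vanish at `±π/2`. -/
lemma sq_mul_expSecCoeff (n : ℤ) {u : ℝ} (hu : 0 < u) :
    (n : ℂ) ^ 2 * expSecCoeff n u = -∫ θ in (-(Real.pi / 2))..(Real.pi / 2),
      Complex.exp (Complex.I * ((n * θ : ℝ) : ℂ)) * expSecDeriv₂ u θ := by
  have hπ := Real.pi_pos
  set F : ℝ → ℂ := fun θ => Complex.exp (Complex.I * ((n * θ : ℝ) : ℂ)) *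
    (expSecDeriv u θ - Complex.I * n * expSec u θ) with hF
  have c0 := continuous_expSec hu
  have c1 := continuous_expSecDeriv hu
  have c2 := continuous_expSecDeriv₂ hu
  have hd : ∀ θ ∈ Set.Ioo (-(Real.pi / 2)) (Real.pi / 2), HasDerivAt F
      (Complex.exp (Complex.I * ((n * θ : ℝ) : ℂ)) * expSecDeriv₂ u θ +
        (n : ℂ) ^ 2 * (Complex.exp (Complex.I * ((n * θ : ℝ) : ℂ)) * expSec u θ)) θ := by
    intro θ hθ
    have hc := Real.cos_pos_of_mem_Ioo hθ
    have h1 : HasDerivAt (fun θ : ℝ => Complex.exp (Complex.I * ((n * θ : ℝ) : ℂ)))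
        (Complex.exp (Complex.I * ((n * θ : ℝ) : ℂ)) * (Complex.I * ((n * 1 : ℝ) : ℂ))) θ :=
      ((((hasDerivAt_id θ).const_mul (n : ℝ)).ofReal_comp).const_mul Complex.I).cexp
    have h := h1.mul ((hasDerivAt_expSecDeriv u hc).ofReal_comp.sub
      ((hasDerivAt_expSec u hc).ofReal_comp.const_mul (Complex.I * n)))
    convert! h using 1
    simp only [Pi.sub_apply]
    push_cast
    linear_combination ((n : ℂ) ^ 2 * Complex.exp (Complex.I * (n * θ)) * expSec u θ) *
      Complex.I_sq
  have hI := intervalIntegral.integral_eq_sub_of_hasDerivAt_of_le (by linarith)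
    (f := F) (by rw [hF]; fun_prop) hd (Continuous.intervalIntegrable (by fun_prop) _ _)
  rw [intervalIntegral.integral_add (Continuous.intervalIntegrable (by fun_prop) _ _)
    (Continuous.intervalIntegrable (by fun_prop) _ _), intervalIntegral.integral_const_mul] at hI
  have hb : F (Real.pi / 2) - F (-(Real.pi / 2)) = 0 := by
    have e1 : expSec u (Real.pi / 2) = 0 := expSec_eq_zero (by simp)
    have e2 : expSec u (-(Real.pi / 2)) = 0 := expSec_eq_zero (by simp)
    simp [hF, e1, e2, expSecDeriv, expInvPow_zero_right]
  rw [hb] at hI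
  rw [expSecCoeff]
  linear_combination hI

/-- The Fourier coefficients decay like `e^{-u/2} / (1 + n²)`, uniformly for `u ≥ u₀ > 0`. -/
theorem exists_norm_expSecCoeff_le {u₀ : ℝ} (hu₀ : 0 < u₀) :
    ∃ C : ℝ, 0 < C ∧ ∀ (n : ℤ) (u : ℝ), u₀ ≤ u →
      ‖expSecCoeff n u‖ ≤ C * Real.exp (-(u / 2)) * (1 + (n : ℝ) ^ 2)⁻¹ := by
  have hπ := Real.pi_pos
  set D := 8 / u₀ ^ 2 + 48 / u₀ ^ 2 + 96 / u₀ ^ 3 + 1536 / u₀ ^ 3 + 3840 / u₀ ^ 3 with hD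
  have hDp : 0 < D := by positivity
  -- The sum of the plain bound on the coefficient and the bound on `n²` times the coefficient, so
  -- that `1 + n²` can be divided out.
  refine ⟨(2 / u₀ + D) * Real.pi, by positivity, fun n u hu => ?_⟩
  have hu' := hu₀.trans_le hu
  have h0 := norm_expSecCoeff_le n hu'
  have h2 : (n : ℝ) ^ 2 * ‖expSecCoeff n u‖ ≤ Real.exp (-(u / 2)) * D * Real.pi := by
    have h := congrArg norm (sq_mul_expSecCoeff n hu')
    rw [norm_mul, norm_neg, norm_pow, Complex.norm_intCast, sq_abs] at h
    rw [h]
    have hb := intervalIntegral.norm_integral_le_of_norm_le_const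
      (a := -(Real.pi / 2)) (b := Real.pi / 2) (C := Real.exp (-(u / 2)) * D)
      (f := fun θ : ℝ => Complex.exp (Complex.I * ((n * θ : ℝ) : ℂ)) * expSecDeriv₂ u θ)
      (fun θ _ => by
        rw [norm_mul, Complex.norm_exp_I_mul_ofReal, one_mul, Complex.norm_real, Real.norm_eq_abs]
        exact abs_expSecDeriv₂_le hu₀ hu θ)
    have e : Real.pi / 2 - -(Real.pi / 2) = Real.pi := by ring
    rwa [e, abs_of_pos hπ] at hb
  have h3 : Real.exp (-(u / 2)) * (2 / u) * Real.pi ≤ Real.exp (-(u / 2)) * (2 / u₀) * Real.pi := by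
    gcongr
  rw [← div_eq_mul_inv, le_div_iff₀ (by positivity)]
  nlinarith

/-- The restriction of `expSec u` to the half circle on which `b cos θ < 0`. -/
def expSecHalf (b u θ : ℝ) : ℝ := if 0 ≤ b * Real.cos θ then 0 else expSec u θ

lemma continuous_expSecHalf {b u : ℝ} (hb : b ≠ 0) (hu : 0 < u) : Continuous (expSecHalf b u) := by
  refine Continuous.if_le continuous_const (continuous_expSec hu) continuous_const (by fun_prop) ?_
  intro θ h
  rw [expSec_eq_zero ((mul_eq_zero.mp h.symm).resolve_left hb)]

lemma integral_expSecHalf_of_neg {b u : ℝ} (hb : b < 0) (hu : 0 < u) (n : ℤ) :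
    ∫ θ in (-Real.pi)..Real.pi, Complex.exp (Complex.I * ((n * θ : ℝ) : ℂ)) * expSecHalf b u θ =
      expSecCoeff n u := by
  have hπ := Real.pi_pos
  have hc : Continuous fun θ : ℝ =>
      Complex.exp (Complex.I * ((n * θ : ℝ) : ℂ)) * expSecHalf b u θ := by
    have := continuous_expSecHalf hb.ne hu
    fun_prop
  have hi : ∀ x y : ℝ, IntervalIntegrable (fun θ : ℝ =>
      Complex.exp (Complex.I * ((n * θ : ℝ) : ℂ)) * expSecHalf b u θ) volume x y :=
    fun x y => hc.intervalIntegrable x y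
  rw [← intervalIntegral.integral_add_adjacent_intervals (hi _ (-(Real.pi / 2)))
      (hi _ Real.pi),
    ← intervalIntegral.integral_add_adjacent_intervals (hi (-(Real.pi / 2)) (Real.pi / 2))
      (hi _ Real.pi)]
  have z : ∀ θ : ℝ, Real.cos θ ≤ 0 →
      Complex.exp (Complex.I * ((n * θ : ℝ) : ℂ)) * expSecHalf b u θ = 0 := by
    intro θ h
    rw [expSecHalf, if_pos (mul_nonneg_of_nonpos_of_nonpos hb.le h)]
    simp
  have z1 : ∫ θ in (-Real.pi)..(-(Real.pi / 2)),
      Complex.exp (Complex.I * ((n * θ : ℝ) : ℂ)) * expSecHalf b u θ = 0 := by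
    refine intervalIntegral.integral_zero_ae (Eventually.of_forall fun θ hθ => z θ ?_)
    rw [Set.uIoc_of_le (by linarith)] at hθ
    rw [← Real.cos_neg]
    exact Real.cos_nonpos_of_pi_div_two_le_of_le (by linarith [hθ.2]) (by linarith [hθ.1])
  have z2 : ∫ θ in (Real.pi / 2)..Real.pi,
      Complex.exp (Complex.I * ((n * θ : ℝ) : ℂ)) * expSecHalf b u θ = 0 := by
    refine intervalIntegral.integral_zero_ae (Eventually.of_forall fun θ hθ => z θ ?_)
    rw [Set.uIoc_of_le (by linarith)] at hθ
    exact Real.cos_nonpos_of_pi_div_two_le_of_le (by linarith [hθ.1]) (by linarith [hθ.2])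
  rw [z1, z2, zero_add, add_zero, expSecCoeff]
  refine intervalIntegral.integral_congr fun θ hθ => ?_
  rw [Set.uIcc_of_le (by linarith)] at hθ
  have h0 : 0 ≤ Real.cos θ := Real.cos_nonneg_of_mem_Icc hθ
  congr 2
  rw [expSecHalf]
  split_ifs with h
  · rw [expSec_eq_zero]
    nlinarith
  · rfl

/-- The sign with which the half circle `b cos θ < 0` enters the Fourier coefficients. -/
def sideSign (b : ℝ) (n : ℤ) : ℂ := if b < 0 then 1 else (-1) ^ n

lemma expSecHalf_add_pi (b u θ : ℝ) : expSecHalf b u (θ + Real.pi) = expSecHalf (-b) u θ := by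
  rw [expSecHalf, expSecHalf, Real.cos_add_pi, expSec_add_pi, mul_neg, neg_mul]

lemma expSecHalf_add_two_pi (b u θ : ℝ) : expSecHalf b u (θ + 2 * Real.pi) = expSecHalf b u θ := by
  rw [two_mul, ← add_assoc, expSecHalf_add_pi, expSecHalf_add_pi, neg_neg]

lemma cexp_int_mul_pi (n : ℤ) : Complex.exp (Complex.I * ((n * Real.pi : ℝ) : ℂ)) = (-1) ^ n := by
  rw [← Complex.exp_pi_mul_I, ← Complex.exp_int_mul]
  congr 1
  push_cast
  ring

lemma cexp_int_mul_add_pi (n : ℤ) (θ : ℝ) :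
    Complex.exp (Complex.I * ((n * (θ + Real.pi) : ℝ) : ℂ)) =
      (-1) ^ n * Complex.exp (Complex.I * ((n * θ : ℝ) : ℂ)) := by
  rw [← cexp_int_mul_pi, ← Complex.exp_add]
  congr 1
  push_cast
  ring

/-- Translation by `π` exchanges the two half circles and multiplies `e^{inθ}` by `(-1)^n`. -/
lemma integral_expSecHalf {b u : ℝ} (hb : b ≠ 0) (hu : 0 < u) (n : ℤ) :
    ∫ θ in (-Real.pi)..Real.pi, Complex.exp (Complex.I * ((n * θ : ℝ) : ℂ)) * expSecHalf b u θ =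
      sideSign b n * expSecCoeff n u := by
  rcases lt_or_gt_of_ne hb with h | h
  · rw [integral_expSecHalf_of_neg h hu, sideSign, if_pos h, one_mul]
  · set F : ℝ → ℂ := fun θ => Complex.exp (Complex.I * ((n * θ : ℝ) : ℂ)) * expSecHalf b u θ
      with hF
    have hs : ∀ θ, F (θ + Real.pi) = (-1) ^ n *
        (Complex.exp (Complex.I * ((n * θ : ℝ) : ℂ)) * expSecHalf (-b) u θ) := by
      intro θ
      simp only [hF]
      rw [cexp_int_mul_add_pi, expSecHalf_add_pi, mul_assoc]
    have hp : Function.Periodic F (2 * Real.pi) := by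
      intro θ
      have e : Real.pi + Real.pi = 2 * Real.pi := by ring
      simp only [hF]
      rw [expSecHalf_add_two_pi, ← e, ← add_assoc, cexp_int_mul_add_pi, cexp_int_mul_add_pi,
        ← mul_assoc, ← mul_zpow]
      simp
    have h1 := hp.intervalIntegral_add_eq (-Real.pi) 0
    have e1 : -Real.pi + 2 * Real.pi = Real.pi := by ring
    have h2 := intervalIntegral.integral_comp_add_right F Real.pi (a := -Real.pi) (b := Real.pi)
    have e2 : -Real.pi + Real.pi = 0 := by ring
    have e3 : Real.pi + Real.pi = 0 + 2 * Real.pi := by ring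
    rw [e2, e3, ← h1, e1] at h2
    rw [← h2]
    simp_rw [hs]
    rw [intervalIntegral.integral_const_mul, integral_expSecHalf_of_neg (neg_neg_of_pos h) hu,
      sideSign, if_neg (not_lt.mpr h.le)]

/-! ### Evaluation of the momentum integrals -/

/-- The value of the `k₊` integral of `fourierIntegrand` at frequency `k₀`. -/
def fourierValue (k₀ s σ x₀ xp xm km : ℝ) : ℂ :=
  Complex.exp (Complex.I * ((k₀ * x₀ + s * xp : ℝ) : ℂ)) *
    (-(2 * Complex.I) * σ * (SignType.sign k₀ : ℝ)) *
    (Complex.exp (Complex.I * ((km * xm : ℝ) : ℂ)) *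
      expSecHalf (s * σ * k₀ * xp) (|k₀ * xp| / Real.pi) (Real.pi / 2 * km))

/-- The sign of the pole combines with the Jacobian: `sign(q/a)/a = sign(q)/|a|`. This is why only
`|cos θ|` survives, apart from the choice of half circle. -/
lemma poleValue_div {q a : ℝ} (hq : q ≠ 0) (ha : a ≠ 0) (x : ℝ) :
    poleValue (q / a) x / a = if q * a * x < 0 then
      -(2 * Real.pi * Complex.I) * (SignType.sign q : ℝ) * (Real.exp (-(|q * x| / |a|)) * |a|⁻¹ : ℝ)
      else 0 := by
  have ha' : 0 < a ^ 2 := by positivity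
  have e : q / a * x = (q * a * x) / a ^ 2 := by field_simp
  have hc : q / a * x < 0 ↔ q * a * x < 0 := by
    rw [e, div_lt_iff₀ ha', zero_mul]
  have hm : |q / a * x| = |q * x| / |a| := by rw [← abs_div]; congr 1; ring
  rw [poleValue, hm]
  simp only [hc]
  split_ifs with h
  · have haC : (a : ℂ) ≠ 0 := by exact_mod_cast ha
    rcases lt_or_gt_of_ne hq with h1 | h1 <;> rcases lt_or_gt_of_ne ha with h2 | h2
    · rw [sign_pos (div_pos_of_neg_of_neg h1 h2), sign_neg h1, abs_of_neg h2]
      push_cast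
      simp [div_eq_mul_inv, inv_neg]
      ring
    · rw [sign_neg (div_neg_of_neg_of_pos h1 h2), sign_neg h1, abs_of_pos h2]
      push_cast
      simp [div_eq_mul_inv]
      ring
    · rw [sign_neg (div_neg_of_pos_of_neg h1 h2), sign_pos h1, abs_of_neg h2]
      push_cast
      simp [div_eq_mul_inv, inv_neg]
      ring
    · rw [sign_pos (div_pos h1 h2), sign_pos h1, abs_of_pos h2]
      push_cast
      simp [div_eq_mul_inv]
      ring
  · simp

lemma matsubara_ne_zero {T : ℝ} (hT : 0 < T) (k : ℤ) : matsubara T k ≠ 0 := by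
  have : (2 * (k : ℝ) + 1) ≠ 0 := by
    have : (2 * k + 1 : ℤ) ≠ 0 := by omega
    exact_mod_cast this
  have := Real.pi_pos
  rw [matsubara]
  positivity

/-- With `u = k₊ - s` and `a = sπ cos(πk₋/2)` the denominator is `a(u + iσk₀/a)`. The shift by `s`
produces the phase `e^{isx₊}`. -/
lemma fourierIntegrand_eq {T s σ : ℝ} (hs : s ≠ 0) (k : ℤ) (x₀ xp xm : ℝ) {km : ℝ}
    (hkm : Real.cos (Real.pi / 2 * km) ≠ 0) (kp : ℝ) :
    fourierIntegrand T s σ k x₀ xp xm km kp =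
      (Complex.exp (Complex.I * ((matsubara T k * x₀ + s * xp : ℝ) : ℂ)) *
        Complex.exp (Complex.I * ((km * xm : ℝ) : ℂ)) /
          ((s * Real.pi * Real.cos (Real.pi / 2 * km) : ℝ) : ℂ)) *
      poleKernel (σ * matsubara T k / (s * Real.pi * Real.cos (Real.pi / 2 * km))) xp (kp - s) := by
  set a : ℝ := s * Real.pi * Real.cos (Real.pi / 2 * km) with ha
  have ha0 : a ≠ 0 := mul_ne_zero (mul_ne_zero hs Real.pi_ne_zero) hkm
  have haC : (a : ℂ) ≠ 0 := by exact_mod_cast ha0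
  rw [fourierIntegrand, poleKernel, div_mul_div_comm, ← Complex.exp_add, ← Complex.exp_add]
  congr 1
  · congr 1
    push_cast
    ring
  · have e : 2 * linCos s kp * Real.cos (Real.pi / 2 * km) = -(a * (kp - s)) := by
      rw [linCos, ha]
      ring
    rw [e]
    push_cast
    field_simp
    ring

theorem tendsto_integral_fourierIntegrand {T s σ : ℝ} (hT : 0 < T)
    (hs : s ∈ ({1, -1} : Set ℝ)) (hσ : σ ∈ ({1, -1} : Set ℝ)) (k : ℤ) (x₀ : ℝ) {xp : ℝ}
    (hxp : xp ≠ 0) (xm : ℝ) {km : ℝ} (hkm : Real.cos (Real.pi / 2 * km) ≠ 0) :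
    Tendsto (fun p : ℝ × ℝ => ∫ kp in p.1..p.2, fourierIntegrand T s σ k x₀ xp xm km kp)
      (atBot ×ˢ atTop) (𝓝 (fourierValue (matsubara T k) s σ x₀ xp xm km)) := by
  have hs0 : s ≠ 0 := by rcases hs with rfl | rfl <;> norm_num
  have hσ0 : σ ≠ 0 := by rcases hσ with rfl | rfl <;> norm_num
  have hsa : |s| = 1 := by rcases hs with rfl | rfl <;> norm_num
  have hσa : |σ| = 1 := by rcases hσ with rfl | rfl <;> norm_num
  set k₀ := matsubara T k with hk₀
  have hk : k₀ ≠ 0 := matsubara_ne_zero hT k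
  set c := Real.cos (Real.pi / 2 * km) with hc
  set a : ℝ := s * Real.pi * c with ha
  have ha0 : a ≠ 0 := mul_ne_zero (mul_ne_zero hs0 Real.pi_ne_zero) hkm
  have hq : σ * k₀ ≠ 0 := mul_ne_zero hσ0 hk
  simp_rw [fourierIntegrand_eq hs0 k x₀ xp xm hkm, intervalIntegral.integral_const_mul,
    intervalIntegral.integral_comp_sub_right (fun kp => poleKernel (σ * matsubara T k /
      (s * Real.pi * Real.cos (Real.pi / 2 * km))) xp kp) s]
  have h1 := tendsto_integral_poleKernel (div_ne_zero hq ha0) hxp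
  have h2 : Tendsto (fun p : ℝ × ℝ => (p.1 - s, p.2 - s)) (atBot ×ˢ atTop) (atBot ×ˢ atTop) :=
    Tendsto.prodMap (tendsto_atBot_add_const_right _ (-s) tendsto_id)
      (tendsto_atTop_add_const_right _ (-s) tendsto_id)
  have h3 := (h1.comp h2).const_mul (Complex.exp (Complex.I * ((k₀ * x₀ + s * xp : ℝ) : ℂ)) *
        Complex.exp (Complex.I * ((km * xm : ℝ) : ℂ)) / (a : ℂ))
  have hv : fourierValue k₀ s σ x₀ xp xm km =
      Complex.exp (Complex.I * ((k₀ * x₀ + s * xp : ℝ) : ℂ)) *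
        Complex.exp (Complex.I * ((km * xm : ℝ) : ℂ)) / (a : ℂ) * poleValue (σ * k₀ / a) xp := by
    rw [div_mul_eq_mul_div, mul_div_assoc, poleValue_div hq ha0]
    have hcond : σ * k₀ * a * xp = Real.pi * (s * σ * k₀ * xp * c) := by rw [ha]; ring
    have hcond' : σ * k₀ * a * xp < 0 ↔ ¬ (0 ≤ s * σ * k₀ * xp * c) := by
      rw [hcond, not_le, mul_neg_iff]
      simp [Real.pi_pos, Real.pi_pos.not_gt]
    have hsig : ((SignType.sign (σ * k₀) : SignType) : ℝ) = σ * (SignType.sign k₀ : ℝ) := by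
      rcases hσ with rfl | rfl
      · simp
      · simp [Left.sign_neg]
    have hla : |a| = Real.pi * |c| := by
      rw [ha, abs_mul, abs_mul, hsa, one_mul, abs_of_pos Real.pi_pos]
    have hlq : |σ * k₀ * xp| = |k₀ * xp| := by rw [mul_assoc, abs_mul, hσa, one_mul]
    rw [fourierValue, expSecHalf, expSec_eq, hsig, hla, hlq, ← hc]
    simp only [hcond']
    by_cases h0 : 0 ≤ s * σ * k₀ * xp * c
    · simp [h0]
    · simp only [h0, not_false_eq_true, if_true, if_false]
      rw [div_div, mul_inv]
      have hπ' : (Real.pi : ℂ) ≠ 0 := by exact_mod_cast Real.pi_ne_zero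
      push_cast
      field_simp
  rw [hv]
  exact h3

lemma countable_cos_eq_zero : {km : ℝ | Real.cos (Real.pi / 2 * km) = 0}.Countable := by
  refine (Set.countable_range fun j : ℤ => (2 * (j : ℝ) + 1)).mono fun km h => ?_
  obtain ⟨j, hj⟩ := Real.cos_eq_zero_iff.mp h
  refine ⟨j, ?_⟩
  have := Real.pi_pos
  simp only
  have h2 : Real.pi * km = Real.pi * (2 * j + 1) := by linarith
  exact (mul_left_cancel₀ this.ne' h2).symm

lemma improperIntegral_fourierIntegrand_ae {T s σ : ℝ} (hT : 0 < T)
    (hs : s ∈ ({1, -1} : Set ℝ)) (hσ : σ ∈ ({1, -1} : Set ℝ)) (k : ℤ) (x₀ : ℝ) {xp : ℝ}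
    (hxp : xp ≠ 0) (xm : ℝ) :
    ∀ᵐ km : ℝ, improperIntegral (fourierIntegrand T s σ k x₀ xp xm km) =
      fourierValue (matsubara T k) s σ x₀ xp xm km := by
  have h0 := countable_cos_eq_zero.ae_notMem volume
  filter_upwards [h0] with km hkm
  exact (tendsto_integral_fourierIntegrand hT hs hσ k x₀ hxp xm hkm).limUnder_eq

lemma continuous_fourierValue {T s σ : ℝ} (hT : 0 < T)
    (hs : s ∈ ({1, -1} : Set ℝ)) (hσ : σ ∈ ({1, -1} : Set ℝ)) (k : ℤ) (x₀ : ℝ) {xp : ℝ}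
    (hxp : xp ≠ 0) (xm : ℝ) :
    Continuous (fourierValue (matsubara T k) s σ x₀ xp xm) := by
  have hs0 : s ≠ 0 := by rcases hs with rfl | rfl <;> norm_num
  have hσ0 : σ ≠ 0 := by rcases hσ with rfl | rfl <;> norm_num
  have hk := matsubara_ne_zero hT k
  have hπ := Real.pi_pos
  have h1 := continuous_expSecHalf
    (mul_ne_zero (mul_ne_zero (mul_ne_zero hs0 hσ0) hk) hxp)
    (u := |matsubara T k * xp| / Real.pi) (by positivity)
  unfold fourierValue
  fun_prop

lemma intervalIntegrable_improperIntegral {T s σ : ℝ} (hT : 0 < T)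
    (hs : s ∈ ({1, -1} : Set ℝ)) (hσ : σ ∈ ({1, -1} : Set ℝ)) (k : ℤ) (x₀ : ℝ) {xp : ℝ}
    (hxp : xp ≠ 0) (xm : ℝ) : IntervalIntegrable
    (fun km => improperIntegral (fourierIntegrand T s σ k x₀ xp xm km)) volume (-2) 2 := by
  refine ((continuous_fourierValue hT hs hσ k x₀ hxp xm).intervalIntegrable (-2) 2).congr_ae ?_
  refine ae_restrict_of_ae ?_
  filter_upwards [improperIntegral_fourierIntegrand_ae hT hs hσ k x₀ hxp xm] with km h
  exact h.symm

theorem frequencyTerm_eq {T s σ : ℝ} (hT : 0 < T)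
    (hs : s ∈ ({1, -1} : Set ℝ)) (hσ : σ ∈ ({1, -1} : Set ℝ)) (k : ℤ) (x₀ : ℝ) {xp : ℝ}
    (hxp : xp ≠ 0) (n : ℤ) :
    frequencyTerm T s σ k x₀ xp (Real.pi / 2 * n) =
      Complex.exp (Complex.I * ((matsubara T k * x₀ + s * xp : ℝ) : ℂ)) *
      (-(4 * Complex.I) / Real.pi * σ * (SignType.sign (matsubara T k) : ℝ)) *
      (sideSign (s * σ * matsubara T k * xp) n *
        expSecCoeff n (|matsubara T k * xp| / Real.pi)) := by
  have hs0 : s ≠ 0 := by rcases hs with rfl | rfl <;> norm_num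
  have hσ0 : σ ≠ 0 := by rcases hσ with rfl | rfl <;> norm_num
  have hk := matsubara_ne_zero hT k
  have hπ := Real.pi_pos
  rw [frequencyTerm, intervalIntegral.integral_congr_ae (g :=
    fourierValue (matsubara T k) s σ x₀ xp (Real.pi / 2 * n))
    ((improperIntegral_fourierIntegrand_ae hT hs hσ k x₀ hxp _).mono fun km h _ => h)]
  simp only [fourierValue]
  rw [intervalIntegral.integral_const_mul]
  -- The substitution `θ = πk₋/2` maps `[-2,2]` onto a full circle; its Jacobian `2/π` turns the
  -- factor `2i` into `4i/π`.
  have h := intervalIntegral.integral_comp_mul_left (a := -2) (b := 2) (fun θ : ℝ =>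
    Complex.exp (Complex.I * ((n * θ : ℝ) : ℂ)) *
    expSecHalf (s * σ * matsubara T k * xp) (|matsubara T k * xp| / Real.pi) θ)
    (c := Real.pi / 2) (by positivity)
  have e1 : Real.pi / 2 * -2 = -Real.pi := by ring
  have e2 : Real.pi / 2 * 2 = Real.pi := by ring
  rw [e1, e2, integral_expSecHalf
    (mul_ne_zero (mul_ne_zero (mul_ne_zero hs0 hσ0) hk) hxp) (by positivity)] at h
  have e3 : ∀ km : ℝ, km * (Real.pi / 2 * n) = n * (Real.pi / 2 * km) := fun km => by ring
  simp_rw [e3]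
  rw [h, Complex.real_smul]
  push_cast
  field_simp
  ring

/-! ### Fourier series of the profile and the triple convolution -/

lemma summable_inv_one_add_int_sq : Summable fun n : ℤ => (1 + (n : ℝ) ^ 2)⁻¹ := by
  refine Summable.of_norm_bounded_eventually (g := fun n : ℤ => 1 / (n : ℝ) ^ 2)
    (Real.summable_one_div_int_pow.mpr (by norm_num)) ?_
  filter_upwards [eventually_cofinite_ne (0 : ℤ)] with n hn
  have hn' : (0 : ℝ) < (n : ℝ) ^ 2 := by positivity
  rw [Real.norm_of_nonneg (by positivity), one_div]
  gcongr
  linarith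

lemma summable_norm_expSecCoeff {u : ℝ} (hu : 0 < u) :
    Summable fun n : ℤ => ‖expSecCoeff n u‖ := by
  obtain ⟨C, hC, h⟩ := exists_norm_expSecCoeff_le hu
  exact Summable.of_nonneg_of_le (fun n => norm_nonneg _) (fun n => h n u le_rfl)
    (summable_inv_one_add_int_sq.mul_left _)

lemma summable_norm_expSecCoeff_two_mul {u : ℝ} (hu : 0 < u) :
    Summable fun p : ℤ => ‖expSecCoeff (2 * p) u‖ :=
  (summable_norm_expSecCoeff hu).comp_injective (mul_right_injective₀ (two_ne_zero))

/-- The Fourier series of the `π`-periodic function `expSec u`. -/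
theorem hasSum_expSec {u : ℝ} (hu : 0 < u) (θ : ℝ) :
    HasSum (fun p : ℤ => (Real.pi : ℂ)⁻¹ * expSecCoeff (2 * p) u *
      Complex.exp (Complex.I * (((2 * p : ℤ) * θ : ℝ) : ℂ))) (expSec u θ) := by
  have : Fact (0 < Real.pi) := ⟨Real.pi_pos⟩
  have hπ : (Real.pi : ℂ) ≠ 0 := by exact_mod_cast Real.pi_ne_zero
  have hper : Function.Periodic (fun θ => (expSec u θ : ℂ)) Real.pi := fun θ => by
    simp only [expSec_add_pi]
  have hcont : Continuous fun θ => (expSec u θ : ℂ) :=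
    Complex.continuous_ofReal.comp (continuous_expSec hu)
  set f : C(AddCircle Real.pi, ℂ) := ⟨hper.lift, continuous_coinduced_dom.mpr hcont⟩ with hf
  have hcoe : ∀ x : ℝ, f (x : AddCircle Real.pi) = expSec u x := fun x => hper.lift_coe x
  have hexp : ∀ (p : ℤ) (x : ℝ), fourier p (x : AddCircle Real.pi) =
      Complex.exp (Complex.I * (((2 * p : ℤ) * x : ℝ) : ℂ)) := by
    intro p x
    rw [fourier_coe_apply]
    congr 1
    push_cast
    field_simp
  have hcoeff : ∀ p : ℤ, fourierCoeff f p = (Real.pi : ℂ)⁻¹ * expSecCoeff (2 * p) u := by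
    intro p
    rw [fourierCoeff_eq_intervalIntegral f p (-(Real.pi / 2)), ← expSecCoeff_neg, expSecCoeff]
    have e : -(Real.pi / 2) + Real.pi = Real.pi / 2 := by ring
    rw [e, Complex.real_smul]
    push_cast
    rw [one_div]
    congr 1
    refine intervalIntegral.integral_congr fun x _ => ?_
    rw [hcoe, hexp, smul_eq_mul]
    push_cast
    ring_nf
  have hs : Summable (fourierCoeff f) := by
    refine Summable.of_norm ?_
    simp_rw [hcoeff, norm_mul]
    exact (summable_norm_expSecCoeff_two_mul hu).mul_left _
  have h := has_pointwise_sum_fourier_series_of_summable hs (θ : AddCircle Real.pi)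
  rw [hcoe] at h
  refine h.congr_fun fun p => ?_
  rw [hcoeff, hexp, smul_eq_mul]

/-- Integration against a profile multiplies each Fourier coefficient by that of the profile, term
by term because the series converges absolutely. Applied twice, it yields a product of three
coefficients. -/
lemma hasSum_integral_expSec_mul {c : ℤ → ℂ} (hc : Summable fun p => ‖c p‖) {F : ℝ → ℂ}
    (hF : ∀ θ, HasSum (fun p : ℤ => c p * Complex.exp (Complex.I * (((2 * p : ℤ) * θ : ℝ) : ℂ)))
      (F θ)) {v : ℝ} (hv : 0 < v) (a : ℝ) :
    HasSum (fun p : ℤ => c p * expSecCoeff (2 * p) v *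
        Complex.exp (Complex.I * (((2 * p : ℤ) * a : ℝ) : ℂ)))
      (∫ b in (-(Real.pi / 2))..(Real.pi / 2), expSec v b * F (a + b)) := by
  have hcv := continuous_expSec hv
  have h := intervalIntegral.hasSum_integral_of_dominated_convergence
    (a := -(Real.pi / 2)) (b := Real.pi / 2) (μ := volume)
    (F := fun (p : ℤ) (b : ℝ) => (expSec v b : ℂ) *
      (c p * Complex.exp (Complex.I * (((2 * p : ℤ) * (a + b) : ℝ) : ℂ))))
    (f := fun b => expSec v b * F (a + b))
    (bound := fun p b => expSec v b * ‖c p‖)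
    (fun p => Continuous.aestronglyMeasurable (by fun_prop))
    (fun p => Eventually.of_forall fun b _ => by
      rw [norm_mul, norm_mul, Complex.norm_exp_I_mul_ofReal, Complex.norm_real,
        Real.norm_of_nonneg (expSec_nonneg v b), mul_one])
    (Eventually.of_forall fun b _ => hc.mul_left _)
    (by
      simp_rw [tsum_mul_left]
      exact Continuous.intervalIntegrable (by fun_prop) _ _)
    (Eventually.of_forall fun b _ => (hF (a + b)).mul_left _)
  convert! h using 2 with p
  rw [expSecCoeff, mul_right_comm, ← intervalIntegral.integral_const_mul]
  refine intervalIntegral.integral_congr fun b _ => ?_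
  have : Complex.exp (Complex.I * (((2 * p : ℤ) * (a + b) : ℝ) : ℂ)) =
      Complex.exp (Complex.I * (((2 * p : ℤ) * a : ℝ) : ℂ)) *
      Complex.exp (Complex.I * (((2 * p : ℤ) * b : ℝ) : ℂ)) := by
    rw [← Complex.exp_add]
    congr 1
    push_cast
    ring
  rw [this]
  ring

/-- The convolution of three profiles at momentum `0`. -/
def expSecTriple (u v w : ℝ) : ℝ :=
  ∫ a in (-(Real.pi / 2))..(Real.pi / 2), expSec u a *
    ∫ b in (-(Real.pi / 2))..(Real.pi / 2), expSec v b * expSec w (a + b)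

/-- Expand the profile of parameter `w` in its Fourier series, integrate against the other two, and
evaluate at angle `0`. The factor `π` undoes the normalization `1/π` of the coefficients on a circle
of length `π`. -/
theorem hasSum_expSecCoeff_mul_mul {u v w : ℝ} (hu : 0 < u) (hv : 0 < v) (hw : 0 < w) :
    HasSum (fun p : ℤ => expSecCoeff (2 * p) u * expSecCoeff (2 * p) v * expSecCoeff (2 * p) w)
      ((Real.pi * expSecTriple u v w : ℝ) : ℂ) := by
  have hπ : (Real.pi : ℂ) ≠ 0 := by exact_mod_cast Real.pi_ne_zero
  have s1 : Summable fun p : ℤ => ‖(Real.pi : ℂ)⁻¹ * expSecCoeff (2 * p) w‖ := by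
    simp_rw [norm_mul]
    exact (summable_norm_expSecCoeff_two_mul hw).mul_left _
  have h1 := fun a => hasSum_integral_expSec_mul s1 (hasSum_expSec hw) hv a
  have s2 : Summable fun p : ℤ =>
      ‖(Real.pi : ℂ)⁻¹ * expSecCoeff (2 * p) w * expSecCoeff (2 * p) v‖ := by
    refine Summable.of_nonneg_of_le (fun p => norm_nonneg _) (fun p => ?_)
      (s1.mul_right (Real.exp (-(v / 2)) * (2 / v) * Real.pi))
    rw [norm_mul]
    exact mul_le_mul_of_nonneg_left (norm_expSecCoeff_le _ hv) (norm_nonneg _)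
  have h2 := (hasSum_integral_expSec_mul s2 h1 hu 0).mul_left (Real.pi : ℂ)
  convert! h2 using 1
  · funext p
    simp only [mul_zero, Complex.ofReal_zero, Complex.exp_zero]
    field_simp
  · rw [expSecTriple, Complex.ofReal_mul, ← intervalIntegral.integral_ofReal]
    congr 1
    refine intervalIntegral.integral_congr fun a _ => ?_
    rw [Complex.ofReal_mul, ← intervalIntegral.integral_ofReal, zero_add]
    simp

lemma continuous_expSec_mul_expSec_add {v w : ℝ} (hv : 0 < v) (hw : 0 < w) :
    Continuous fun z : ℝ × ℝ => expSec v z.2 * expSec w (z.1 + z.2) := by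
  have := continuous_expSec hv
  have := continuous_expSec hw
  fun_prop

lemma continuous_expSec_inner {u v w : ℝ} (hu : 0 < u) (hv : 0 < v) (hw : 0 < w) :
    Continuous fun a => expSec u a *
      ∫ b in (-(Real.pi / 2))..(Real.pi / 2), expSec v b * expSec w (a + b) := by
  have h := continuous_expSec hu
  exact h.mul (intervalIntegral.continuous_parametric_intervalIntegral_of_continuous'
    (f := fun a b => expSec v b * expSec w (a + b)) (continuous_expSec_mul_expSec_add hv hw) _ _)

lemma neg_pi_div_two_le : -(Real.pi / 2) ≤ Real.pi / 2 := by linarith [Real.pi_pos]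

lemma expSecTriple_nonneg (u v w : ℝ) : 0 ≤ expSecTriple u v w := by
  refine intervalIntegral.integral_nonneg neg_pi_div_two_le fun a _ =>
    mul_nonneg (expSec_nonneg u a) ?_
  exact intervalIntegral.integral_nonneg neg_pi_div_two_le fun b _ =>
    mul_nonneg (expSec_nonneg v b) (expSec_nonneg w _)

/-- The profiles are nonnegative and decrease pointwise in their parameter. This monotonicity is the
source of the sign of the final sum. -/
lemma expSecTriple_anti {u v w w' : ℝ} (hu : 0 < u) (hv : 0 < v) (hw : 0 < w) (h : w ≤ w') :
    expSecTriple u v w' ≤ expSecTriple u v w := by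
  have hw' := hw.trans_le h
  refine intervalIntegral.integral_mono_on neg_pi_div_two_le
    ((continuous_expSec_inner hu hv hw').intervalIntegrable _ _)
    ((continuous_expSec_inner hu hv hw).intervalIntegrable _ _) fun a _ => ?_
  refine mul_le_mul_of_nonneg_left ?_ (expSec_nonneg u a)
  have c1 := continuous_expSec hv
  have c2 := continuous_expSec hw
  have c3 := continuous_expSec hw'
  refine intervalIntegral.integral_mono_on neg_pi_div_two_le
    (Continuous.intervalIntegrable (by fun_prop) _ _)
    (Continuous.intervalIntegrable (by fun_prop) _ _) fun b _ => ?_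
  exact mul_le_mul_of_nonneg_left (expSec_le_of_le h _) (expSec_nonneg v b)

/-- The exponential decay is kept only for `w`, the parameter later attached to the largest of the
three frequencies `2a+1, 2b+1, 2(a+b)+1`. -/
lemma expSecTriple_le {u v w : ℝ} (hu : 0 < u) (hv : 0 < v) (hw : 0 < w) :
    expSecTriple u v w ≤ Real.pi ^ 2 * ((2 / u) * (2 / v) * (2 / w)) * Real.exp (-(w / 2)) := by
  have hπ := Real.pi_pos
  have e : Real.pi / 2 - -(Real.pi / 2) = Real.pi := by ring
  have hle : ∀ {x : ℝ}, 0 < x → ∀ θ, expSec x θ ≤ 2 / x := fun hx θ =>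
    (expSec_le hx θ).trans (mul_le_of_le_one_left (by positivity) (Real.exp_le_one_iff.mpr
      (by linarith)))
  have c1 := continuous_expSec hv
  have c2 := continuous_expSec hw
  have hin : ∀ a, ∫ b in (-(Real.pi / 2))..(Real.pi / 2), expSec v b * expSec w (a + b) ≤
      Real.pi * ((2 / v) * (Real.exp (-(w / 2)) * (2 / w))) := by
    intro a
    have := intervalIntegral.integral_mono_on (μ := volume) neg_pi_div_two_le
      (f := fun b => expSec v b * expSec w (a + b))
      (g := fun _ => (2 / v) * (Real.exp (-(w / 2)) * (2 / w)))
      (Continuous.intervalIntegrable (by fun_prop) _ _)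
      (Continuous.intervalIntegrable (by fun_prop) _ _) fun b _ =>
        mul_le_mul (hle hv b) (expSec_le hw _) (expSec_nonneg _ _) (by positivity)
    rwa [intervalIntegral.integral_const, e, smul_eq_mul] at this
  have := intervalIntegral.integral_mono_on (μ := volume) neg_pi_div_two_le
      (f := fun a => expSec u a *
        ∫ b in (-(Real.pi / 2))..(Real.pi / 2), expSec v b * expSec w (a + b))
      (g := fun _ => (2 / u) * (Real.pi * ((2 / v) * (Real.exp (-(w / 2)) * (2 / w)))))
      ((continuous_expSec_inner hu hv hw).intervalIntegrable _ _)
      (Continuous.intervalIntegrable (by fun_prop) _ _) fun a _ =>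
        mul_le_mul (hle hu a) (hin a) (intervalIntegral.integral_nonneg neg_pi_div_two_le fun b _ =>
          mul_nonneg (expSec_nonneg v b) (expSec_nonneg w _)) (by positivity)
  rw [intervalIntegral.integral_const, e, smul_eq_mul] at this
  refine this.trans (le_of_eq ?_)
  ring

/-! ### Quantitative decrease of the triple convolution -/

lemma half_le_cos_of_abs_le {θ : ℝ} (h : |θ| ≤ Real.pi / 3) : 1 / 2 ≤ Real.cos θ := by
  rw [← Real.cos_abs, ← Real.cos_pi_div_three]
  exact Real.cos_le_cos_of_nonneg_of_le_pi (abs_nonneg _) (by linarith [Real.pi_pos]) h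

lemma exp_neg_two_mul_le_expSec {u θ : ℝ} (hu : 0 < u) (h : |θ| ≤ Real.pi / 3) :
    Real.exp (-(2 * u)) ≤ expSec u θ := by
  have hc := half_le_cos_of_abs_le h
  have hc1 := Real.cos_le_one θ
  have hc0 : 0 < Real.cos θ := by linarith
  rw [expSec_eq, abs_of_pos hc0]
  have h1 : 1 ≤ (Real.cos θ)⁻¹ := (one_le_inv₀ hc0).mpr hc1
  have h2 : u / Real.cos θ ≤ 2 * u := by
    rw [div_le_iff₀ hc0]
    nlinarith
  calc Real.exp (-(2 * u)) ≤ Real.exp (-(u / Real.cos θ)) := by gcongr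
    _ ≤ _ := le_mul_of_one_le_right (Real.exp_pos _).le h1

/-- Tripling the parameter costs the factor `e^{-2u/cos θ} ≤ e^{-2u}`. -/
lemma le_expSec_sub_expSec {u θ : ℝ} (hu : 0 < u) (h : |θ| ≤ Real.pi / 3) :
    Real.exp (-(2 * u)) * (1 - Real.exp (-(2 * u))) ≤ expSec u θ - expSec (3 * u) θ := by
  have h0 := exp_neg_two_mul_le_expSec hu h
  have hc := half_le_cos_of_abs_le h
  have hc1 := Real.cos_le_one θ
  have hc0 : 0 < Real.cos θ := by linarith
  have h3 : expSec (3 * u) θ ≤ expSec u θ * Real.exp (-(2 * u)) := by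
    rw [expSec_eq, expSec_eq, abs_of_pos hc0, mul_right_comm, ← Real.exp_add]
    gcongr
    have : 2 * u ≤ 2 * u / Real.cos θ := by
      rw [le_div_iff₀ hc0]
      nlinarith
    have e : 3 * u / Real.cos θ = u / Real.cos θ + 2 * u / Real.cos θ := by ring
    rw [e]
    linarith
  have h1 : Real.exp (-(2 * u)) ≤ 1 := Real.exp_le_one_iff.mpr (by linarith)
  nlinarith

/-- Restrict the integrals to `|a|, |b| ≤ π/6`, a square of area `(π/3)²` on which also `|a+b| ≤
π/3`, so all three cosines are at least `1/2`. The parameters `u` and `3u` are those of the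
frequencies `πT` and `3πT`. -/
lemma le_expSecTriple_sub {u : ℝ} (hu : 0 < u) :
    (Real.pi / 3) ^ 2 * (Real.exp (-(2 * u)) ^ 3 * (1 - Real.exp (-(2 * u)))) ≤
      expSecTriple u u u - expSecTriple u u (3 * u) := by
  have hπ := Real.pi_pos
  have hu3 : 0 < 3 * u := by linarith
  have c1 := continuous_expSec hu
  have c3 := continuous_expSec hu3
  set E := Real.exp (-(2 * u)) with hE
  have hE0 : 0 < E := Real.exp_pos _
  have hE1 : E ≤ 1 := Real.exp_le_one_iff.mpr (by linarith)
  have hdiff : ∀ θ, 0 ≤ expSec u θ - expSec (3 * u) θ := fun θ =>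
    sub_nonneg.mpr (expSec_le_of_le (by linarith) θ)
  have low : ∀ {f : ℝ → ℝ} {c : ℝ}, Continuous f → (∀ x, 0 ≤ f x) →
      (∀ x, |x| ≤ Real.pi / 6 → c ≤ f x) →
      Real.pi / 3 * c ≤ ∫ x in (-(Real.pi / 2))..(Real.pi / 2), f x := by
    intro f c hf h0 hc
    have h1 : ∫ x in (-(Real.pi / 6))..(Real.pi / 6), f x ≤
        ∫ x in (-(Real.pi / 2))..(Real.pi / 2), f x :=
      intervalIntegral.integral_mono_interval (by linarith) (by linarith) (by linarith)
        (Eventually.of_forall h0) (hf.intervalIntegrable _ _)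
    have h2 := intervalIntegral.integral_mono_on (μ := volume)
      (by linarith : -(Real.pi / 6) ≤ Real.pi / 6) (f := fun _ => c) (g := f)
      (Continuous.intervalIntegrable (by fun_prop) _ _) (hf.intervalIntegrable _ _)
      fun x hx => hc x (abs_le.mpr hx)
    rw [intervalIntegral.integral_const, smul_eq_mul] at h2
    refine le_trans (le_of_eq ?_) (h2.trans h1)
    ring
  rw [expSecTriple, expSecTriple, ← intervalIntegral.integral_sub
    ((continuous_expSec_inner hu hu hu).intervalIntegrable _ _)
    ((continuous_expSec_inner hu hu hu3).intervalIntegrable _ _)]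
  have hinner : ∀ a, (expSec u a * ∫ b in (-(Real.pi / 2))..(Real.pi / 2),
        expSec u b * expSec u (a + b)) -
      (expSec u a * ∫ b in (-(Real.pi / 2))..(Real.pi / 2), expSec u b * expSec (3 * u) (a + b)) =
      expSec u a * ∫ b in (-(Real.pi / 2))..(Real.pi / 2),
        expSec u b * (expSec u (a + b) - expSec (3 * u) (a + b)) := by
    intro a
    rw [← mul_sub, ← intervalIntegral.integral_sub (Continuous.intervalIntegrable (by fun_prop) _ _)
      (Continuous.intervalIntegrable (by fun_prop) _ _)]
    simp_rw [mul_sub]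
  have hcont := (continuous_expSec_inner hu hu hu).sub (continuous_expSec_inner hu hu hu3)
  have key := low (c := E * (Real.pi / 3 * (E * (E * (1 - E))))) hcont (fun a => ?_) (fun a ha => ?_)
  · refine le_trans (le_of_eq ?_) key
    ring
  · rw [Pi.sub_apply, hinner]
    exact mul_nonneg (expSec_nonneg _ _) (intervalIntegral.integral_nonneg neg_pi_div_two_le
      fun b _ => mul_nonneg (expSec_nonneg _ _) (hdiff _))
  · rw [Pi.sub_apply, hinner]
    have h1E : 0 ≤ 1 - E := by linarith
    refine mul_le_mul (exp_neg_two_mul_le_expSec hu (by linarith)) ?_ (by positivity)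
      (expSec_nonneg _ _)
    refine low (by fun_prop) (fun b => mul_nonneg (expSec_nonneg _ _) (hdiff _)) fun b hb => ?_
    refine mul_le_mul (exp_neg_two_mul_le_expSec hu (by linarith)) (le_expSec_sub_expSec hu ?_)
      (by positivity) (expSec_nonneg _ _)
    exact (abs_add_le a b).trans (by linarith)

/-! ### Propagators as absolutely convergent Matsubara series -/

/-- The coefficient of `e^{i k₀ x₀}` in the linearized propagator at the lattice site `r`. -/
def propAmplitude (η : ℝ → ℝ) (T s σ : ℝ) (k : ℤ) (r : ℤ × ℤ) : ℂ :=
  -(Complex.I * T * σ / (4 * Real.pi)) * Complex.exp (Complex.I * ((s * xPlus r : ℝ) : ℂ)) *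
    ((η (matsubara T k) * (SignType.sign (matsubara T k) : ℝ) : ℝ) *
      sideSign (s * σ * matsubara T k * xPlus r) (r.1 - r.2) *
      expSecCoeff (r.1 - r.2) (|matsubara T k * xPlus r| / Real.pi))

lemma xMinus_eq (r : ℤ × ℤ) : xMinus r = Real.pi / 2 * ((r.1 - r.2 : ℤ) : ℝ) := by
  rw [xMinus]
  push_cast
  ring

lemma xPlus_eq (r : ℤ × ℤ) : xPlus r = Real.pi / 2 * ((r.1 + r.2 : ℤ) : ℝ) := by
  rw [xPlus]
  push_cast
  ring

lemma norm_sideSign (b : ℝ) (n : ℤ) : ‖sideSign b n‖ = 1 := by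
  rw [sideSign]
  split_ifs
  · simp
  · rw [norm_zpow, norm_neg, norm_one, one_zpow]

lemma abs_sign_matsubara_le (T : ℝ) (k : ℤ) :
    |((SignType.sign (matsubara T k) : SignType) : ℝ)| ≤ 1 := by
  rcases lt_trichotomy (matsubara T k) 0 with h | h | h
  · simp [sign_neg h]
  · simp [h]
  · simp [sign_pos h]

lemma abs_matsubara {T : ℝ} (hT : 0 < T) (k : ℤ) :
    |matsubara T k| = |((2 * k + 1 : ℤ) : ℝ)| * (Real.pi * T) := by
  have := Real.pi_pos
  rw [matsubara, mul_assoc, abs_mul, abs_of_pos (by positivity : 0 < Real.pi * T)]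
  push_cast
  rfl

lemma add_div_two_le_mul {a b : ℝ} (ha : 1 ≤ a) (hb : 1 ≤ b) : (a + b) / 2 ≤ a * b := by
  nlinarith

lemma one_le_abs_intCast {j : ℤ} (hj : j ≠ 0) : (1 : ℝ) ≤ |(j : ℝ)| := by
  exact_mod_cast Int.one_le_abs hj

/-- The parameter is `(πT/2)|2k+1||m|` with both integers nonzero, and a product of numbers at least
`1` dominates half their sum. Exponential decay in the product thus splits into separate decay in
frequency and in space. -/
lemma le_matsubara_mul_xPlus {T : ℝ} (hT : 0 < T) (k : ℤ) {r : ℤ × ℤ} (hr : xPlus r ≠ 0) :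
    Real.pi * T / 4 * (|((2 * k + 1 : ℤ) : ℝ)| + |((r.1 + r.2 : ℤ) : ℝ)|) ≤
      |matsubara T k * xPlus r| / Real.pi := by
  have hπ := Real.pi_pos
  rw [xPlus_eq] at hr ⊢
  have hm : r.1 + r.2 ≠ 0 := by
    intro h
    rw [h] at hr
    simp at hr
  have h1 := one_le_abs_intCast (j := 2 * k + 1) (by omega)
  have h2 := one_le_abs_intCast hm
  have h3 := add_div_two_le_mul h1 h2
  rw [abs_mul, abs_matsubara hT, abs_mul, abs_of_pos (by positivity : 0 < Real.pi / 2),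
    le_div_iff₀ hπ]
  have h4 : 0 < Real.pi ^ 2 * T / 2 := by positivity
  nlinarith [mul_le_mul_of_nonneg_left h3 h4.le]

/-- A summable majorant of the propagator amplitudes. -/
lemma exists_norm_propAmplitude_le {η : ℝ → ℝ} {M : ℝ} (hM : ∀ k, |η k| ≤ M) {T : ℝ} (hT : 0 < T) :
    ∃ B : ℝ, 0 ≤ B ∧ ∀ s σ : ℝ, |σ| ≤ 1 → ∀ (k : ℤ) (r : ℤ × ℤ), xPlus r ≠ 0 →
      ‖propAmplitude η T s σ k r‖ ≤ B * Real.exp (-(Real.pi * T / 8) * |((2 * k + 1 : ℤ) : ℝ)|) *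
        (Real.exp (-(Real.pi * T / 8) * |((r.1 + r.2 : ℤ) : ℝ)|) *
          (1 + ((r.1 - r.2 : ℤ) : ℝ) ^ 2)⁻¹) := by
  have hπ := Real.pi_pos
  -- The smallest value that the preceding lower bound allows, both absolute values being at least
  -- `1`. The dependence of `C` on `T` is harmless, as it enters only convergence.
  obtain ⟨C, hC, hG⟩ := exists_norm_expSecCoeff_le (u₀ := Real.pi * T / 4 * 2) (by positivity)
  have hM0 : 0 ≤ M := (abs_nonneg _).trans (hM 0)
  refine ⟨T / (4 * Real.pi) * M * C, by positivity, fun s σ hσ k r hr => ?_⟩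
  have hle := le_matsubara_mul_xPlus hT k hr
  set u := |matsubara T k * xPlus r| / Real.pi with hu
  have hm : r.1 + r.2 ≠ 0 := by
    intro h
    rw [xPlus_eq, h] at hr
    simp at hr
  have h1 := one_le_abs_intCast (j := 2 * k + 1) (by omega)
  have h2 := one_le_abs_intCast hm
  have hu0 : Real.pi * T / 4 * 2 ≤ u :=
    le_trans (mul_le_mul_of_nonneg_left (by linarith) (by positivity)) hle
  have hg := hG (r.1 - r.2) u hu0
  have he : Real.exp (-(u / 2)) ≤ Real.exp (-(Real.pi * T / 8) * |((2 * k + 1 : ℤ) : ℝ)|) *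
      Real.exp (-(Real.pi * T / 8) * |((r.1 + r.2 : ℤ) : ℝ)|) := by
    rw [← Real.exp_add, Real.exp_le_exp]
    linarith
  have n1 : ‖-(Complex.I * T * σ / (4 * Real.pi))‖ ≤ T / (4 * Real.pi) := by
    rw [norm_neg, norm_div, norm_mul, norm_mul, Complex.norm_I, one_mul, Complex.norm_real,
      Complex.norm_real, Real.norm_of_nonneg hT.le, norm_mul, Complex.norm_real,
      Real.norm_of_nonneg hπ.le, Real.norm_eq_abs, Complex.norm_ofNat]
    gcongr
    exact mul_le_of_le_one_right hT.le hσ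
  have n2 : ‖((η (matsubara T k) * (SignType.sign (matsubara T k) : ℝ) : ℝ) : ℂ)‖ ≤ M := by
    rw [Complex.norm_real, Real.norm_eq_abs, abs_mul]
    exact (mul_le_of_le_one_right (abs_nonneg _) (abs_sign_matsubara_le T k)).trans (hM _)
  rw [propAmplitude, norm_mul, norm_mul, norm_mul, norm_mul, Complex.norm_exp_I_mul_ofReal,
    norm_sideSign, mul_one, mul_one]
  calc _ ≤ T / (4 * Real.pi) * (M * (C * (Real.exp (-(Real.pi * T / 8) *
        |((2 * k + 1 : ℤ) : ℝ)|) * Real.exp (-(Real.pi * T / 8) * |((r.1 + r.2 : ℤ) : ℝ)|)) *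
        (1 + ((r.1 - r.2 : ℤ) : ℝ) ^ 2)⁻¹)) := by
        gcongr
        exact hg.trans (by gcongr)
    _ = _ := by ring

lemma summable_int_pow_mul_exp (j : ℕ) {c : ℝ} (hc : 0 < c) :
    Summable fun m : ℤ => |(m : ℝ)| ^ j * Real.exp (-c * |(m : ℝ)|) := by
  have h := Real.summable_pow_mul_exp_neg_nat_mul j hc
  refine Summable.of_nat_of_neg ?_ ?_
  · simpa using h
  · simpa using h

lemma summable_exp_odd {c : ℝ} (hc : 0 < c) :
    Summable fun k : ℤ => Real.exp (-c * |((2 * k + 1 : ℤ) : ℝ)|) := by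
  have h := (summable_int_pow_mul_exp 0 hc).comp_injective (i := fun k : ℤ => 2 * k + 1)
    (fun a b hab => by simpa using hab)
  simpa [Function.comp_def] using h

lemma summable_norm_propAmplitude {η : ℝ → ℝ} {M : ℝ} (hM : ∀ k, |η k| ≤ M) {T : ℝ} (hT : 0 < T)
    (s : ℝ) {σ : ℝ} (hσ : |σ| ≤ 1) {r : ℤ × ℤ} (hr : xPlus r ≠ 0) :
    Summable fun k : ℤ => ‖propAmplitude η T s σ k r‖ := by
  obtain ⟨B, hB, h⟩ := exists_norm_propAmplitude_le hM hT
  have hπ := Real.pi_pos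
  exact Summable.of_nonneg_of_le (fun k => norm_nonneg _) (fun k => h s σ hσ k r hr)
    (((summable_exp_odd (by positivity)).mul_left B).mul_right _)

/-- The factor `16/T` is the inverse of the normalization `2πT/(32π)` in the momentum measure, so it
drops out of the propagator. -/
lemma frequencyTerm_eq_propAmplitude (η : ℝ → ℝ) {T s σ : ℝ} (hT : 0 < T)
    (hs : s ∈ ({1, -1} : Set ℝ)) (hσ : σ ∈ ({1, -1} : Set ℝ)) (k : ℤ) (x₀ : ℝ) {r : ℤ × ℤ}
    (hr : xPlus r ≠ 0) :
    (η (matsubara T k) : ℂ) * frequencyTerm T s σ k x₀ (xPlus r) (xMinus r) =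
      16 / T * (propAmplitude η T s σ k r *
        Complex.exp (Complex.I * ((matsubara T k * x₀ : ℝ) : ℂ))) := by
  have hTC : (T : ℂ) ≠ 0 := by exact_mod_cast hT.ne'
  have e : Complex.exp (Complex.I * ((matsubara T k * x₀ + s * xPlus r : ℝ) : ℂ)) =
      Complex.exp (Complex.I * ((matsubara T k * x₀ : ℝ) : ℂ)) *
      Complex.exp (Complex.I * ((s * xPlus r : ℝ) : ℂ)) := by
    rw [← Complex.exp_add]
    congr 1
    push_cast
    ring
  rw [xMinus_eq, frequencyTerm_eq hT hs hσ k x₀ hr, propAmplitude, e, Complex.ofReal_mul (η _)]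
  field_simp
  ring

theorem propagatorConverges {η : ℝ → ℝ} {M : ℝ} (hM : ∀ k, |η k| ≤ M) {T s σ : ℝ} (hT : 0 < T)
    (hs : s ∈ ({1, -1} : Set ℝ)) (hσ : σ ∈ ({1, -1} : Set ℝ)) (x₀ : ℝ) {r : ℤ × ℤ}
    (hr : xPlus r ≠ 0) : PropagatorConverges η T s σ x₀ (xPlus r) (xMinus r) := by
  have hσa : |σ| ≤ 1 := by rcases hσ with rfl | rfl <;> norm_num
  refine ⟨fun k km hkm => ⟨_, tendsto_integral_fourierIntegrand hT hs hσ k x₀ hr _ hkm⟩,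
    fun k => intervalIntegrable_improperIntegral hT hs hσ k x₀ hr _, ?_⟩
  simp_rw [frequencyTerm_eq_propAmplitude η hT hs hσ _ x₀ hr]
  refine Summable.mul_left _ (Summable.of_norm ?_)
  simp_rw [norm_mul, Complex.norm_exp_I_mul_ofReal, mul_one]
  exact summable_norm_propAmplitude hM hT s hσa hr

lemma linPropagator_eq (η : ℝ → ℝ) {T s σ : ℝ} (hT : 0 < T)
    (hs : s ∈ ({1, -1} : Set ℝ)) (hσ : σ ∈ ({1, -1} : Set ℝ)) (x₀ : ℝ) {r : ℤ × ℤ}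
    (hr : xPlus r ≠ 0) :
    linPropagator η T s σ x₀ (xPlus r) (xMinus r) = ∑' k : ℤ, propAmplitude η T s σ k r *
        Complex.exp (Complex.I * ((matsubara T k * x₀ : ℝ) : ℂ)) := by
  have hTC : (T : ℂ) ≠ 0 := by exact_mod_cast hT.ne'
  have hπ' : (Real.pi : ℂ) ≠ 0 := by exact_mod_cast Real.pi_ne_zero
  rw [linPropagator]
  simp_rw [frequencyTerm_eq_propAmplitude η hT hs hσ _ x₀ hr]
  rw [tsum_mul_left]
  generalize ∑' k : ℤ, propAmplitude η T s σ k r *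
    Complex.exp (Complex.I * ((matsubara T k * x₀ : ℝ) : ℂ)) = S
  push_cast
  field_simp
  norm_num

/-! ### The sunset integral and frequency conservation -/

/-- The Fourier coefficients in `x₀` of the sunset integrand. -/
def sunsetTerm (η : ℝ → ℝ) (T s₁ s₂ s₃ : ℝ) (K : ℤ × ℤ × ℤ) (r : ℤ × ℤ) : ℂ :=
  ((xPlus r ^ 2 : ℝ) : ℂ) * propAmplitude η T s₁ 1 K.1 r *
    propAmplitude η T s₂ (-1) K.2.1 r * propAmplitude η T s₃ (-1) K.2.2 r *
    Complex.exp (-Complex.I * ((xPlus r : ℝ) : ℂ))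

/-- Each propagator decays exponentially in its own frequency; the spatial decay of a single one
already beats the weight `x₊²`. Absolute summability justifies all later reorderings. -/
lemma summable_norm_sunsetTerm {η : ℝ → ℝ} {M : ℝ} (hM : ∀ k, |η k| ≤ M) {T : ℝ} (hT : 0 < T)
    (s₁ s₂ s₃ : ℝ) :
    Summable fun z : (ℤ × ℤ × ℤ) × (ℤ × ℤ) => ‖sunsetTerm η T s₁ s₂ s₃ z.1 z.2‖ := by
  have hπ := Real.pi_pos
  obtain ⟨B, hB, h⟩ := exists_norm_propAmplitude_le hM hT
  set c := Real.pi * T / 8 with hc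
  have hc0 : 0 < c := by positivity
  set f : ℤ → ℝ := fun k => Real.exp (-c * |((2 * k + 1 : ℤ) : ℝ)|) with hf
  have hfs : Summable f := summable_exp_odd hc0
  have hf0 : 0 ≤ f := fun k => (Real.exp_pos _).le
  set g : ℤ → ℝ := fun m => (Real.pi / 2) ^ 2 * (|(m : ℝ)| ^ 2 * Real.exp (-c * |(m : ℝ)|)) with hg
  have hgs : Summable g := (summable_int_pow_mul_exp 2 hc0).mul_left _
  have hg0 : 0 ≤ g := fun m => by positivity
  have h0 : (0 : ℤ → ℝ) ≤ fun n : ℤ => (1 + (n : ℝ) ^ 2)⁻¹ := fun n => by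
    simp only [Pi.zero_apply]
    positivity
  have hR := (hgs.mul_of_nonneg summable_inv_one_add_int_sq hg0 h0).comp_injective
    (i := fun r : ℤ × ℤ => (r.1 + r.2, r.1 - r.2)) (fun a b hab => by
      simp only [Prod.mk.injEq] at hab
      exact Prod.ext (by omega) (by omega))
  have hK2 := hfs.mul_of_nonneg hfs hf0 hf0
  have hK3 := hfs.mul_of_nonneg hK2 hf0 fun z => mul_nonneg (hf0 z.1) (hf0 z.2)
  have hall := (hK3.mul_of_nonneg hR (fun z => mul_nonneg (hf0 _) (mul_nonneg (hf0 _) (hf0 _)))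
    (fun r => mul_nonneg (hg0 _) (h0 _))).mul_left (B ^ 3)
  refine Summable.of_nonneg_of_le (fun z => norm_nonneg _) (fun z => ?_) hall
  obtain ⟨⟨k₁, k₂, k₃⟩, r⟩ := z
  simp only [Function.comp_apply]
  rcases eq_or_ne (xPlus r) 0 with hr | hr
  · rw [sunsetTerm, hr]
    simp only [ne_eq, OfNat.ofNat_ne_zero, not_false_eq_true, zero_pow, Complex.ofReal_zero,
      zero_mul, norm_zero]
    exact mul_nonneg (by positivity) (mul_nonneg (mul_nonneg (hf0 _) (mul_nonneg (hf0 _) (hf0 _)))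
      (mul_nonneg (hg0 _) (h0 _)))
  · have b1 := h s₁ 1 (by norm_num) k₁ r hr
    have b2 := h s₂ (-1) (by norm_num) k₂ r hr
    have b3 := h s₃ (-1) (by norm_num) k₃ r hr
    have e1 : ‖Complex.exp (-Complex.I * ((xPlus r : ℝ) : ℂ))‖ = 1 := by
      rw [neg_mul, ← mul_neg, ← Complex.ofReal_neg, Complex.norm_exp_I_mul_ofReal]
    rw [sunsetTerm, norm_mul, norm_mul, norm_mul, norm_mul, e1, mul_one, Complex.norm_real,
      Real.norm_of_nonneg (sq_nonneg _)]
    set E := Real.exp (-c * |((r.1 + r.2 : ℤ) : ℝ)|) with hE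
    set N := (1 + ((r.1 - r.2 : ℤ) : ℝ) ^ 2)⁻¹ with hN
    have hE0 : 0 < E := Real.exp_pos _
    have hE1 : E ≤ 1 := Real.exp_le_one_iff.mpr (by
      have := abs_nonneg ((r.1 + r.2 : ℤ) : ℝ)
      nlinarith)
    have hN0 : 0 < N := by positivity
    have hN1 : N ≤ 1 := inv_le_one_of_one_le₀ (by nlinarith [sq_nonneg ((r.1 - r.2 : ℤ) : ℝ)])
    -- Two of the three spatial decay factors, all at most `1`, are discarded.
    have hEN : (E * N) ^ 3 ≤ E * N := by
      refine pow_le_of_le_one (by positivity) ?_ (by norm_num)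
      nlinarith
    have hf1 := hf0 k₁
    have hf2 := hf0 k₂
    have hf3 := hf0 k₃
    simp only [Pi.zero_apply] at hf1 hf2 hf3
    calc _ ≤ xPlus r ^ 2 * (B * f k₁ * (E * N)) * (B * f k₂ * (E * N)) * (B * f k₃ * (E * N)) := by
          gcongr
      _ = B ^ 3 * (f k₁ * (f k₂ * f k₃)) * (xPlus r ^ 2 * (E * N) ^ 3) := by ring
      _ ≤ B ^ 3 * (f k₁ * (f k₂ * f k₃)) * (xPlus r ^ 2 * (E * N)) := by
          gcongr
      _ = _ := by
          rw [hg, xPlus_eq, mul_pow]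
          simp only [sq_abs]
          ring

/-- Three odd multiples of `πT` minus the external one make an even multiple, `2πT` times `K₁ + K₂ +
K₃ + 1`. -/
lemma sunsetIntegrand_eq {η : ℝ → ℝ} {M : ℝ} (hM : ∀ k, |η k| ≤ M) {T s₁ s₂ s₃ : ℝ} (hT : 0 < T)
    (hs₁ : s₁ ∈ ({1, -1} : Set ℝ)) (hs₂ : s₂ ∈ ({1, -1} : Set ℝ)) (hs₃ : s₃ ∈ ({1, -1} : Set ℝ))
    (x : ℝ × (ℤ × ℤ)) :
    sunsetIntegrand η T s₁ s₂ s₃ x = ∑' K : ℤ × ℤ × ℤ, sunsetTerm η T s₁ s₂ s₃ K x.2 *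
      Complex.exp (Complex.I *
        ((2 * Real.pi * T * ((K.1 + K.2.1 + K.2.2 + 1 : ℤ) : ℝ) * x.1 : ℝ) : ℂ)) := by
  obtain ⟨x₀, r⟩ := x
  rcases eq_or_ne (xPlus r) 0 with hr | hr
  · simp [sunsetIntegrand, sunsetTerm, hr]
  · have h1 : (1 : ℝ) ∈ ({1, -1} : Set ℝ) := by simp
    have h2 : (-1 : ℝ) ∈ ({1, -1} : Set ℝ) := by simp
    have S : ∀ s σ : ℝ, |σ| ≤ 1 → Summable fun k : ℤ => ‖propAmplitude η T s σ k r *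
        Complex.exp (Complex.I * ((matsubara T k * x₀ : ℝ) : ℂ))‖ := by
      intro s σ hσ
      simp_rw [norm_mul, Complex.norm_exp_I_mul_ofReal, mul_one]
      exact summable_norm_propAmplitude hM hT s hσ hr
    have S1 := S s₁ 1 (by norm_num)
    have S2 := S s₂ (-1) (by norm_num)
    have S3 := S s₃ (-1) (by norm_num)
    rw [sunsetIntegrand]
    simp only
    rw [linPropagator_eq η hT hs₁ h1 x₀ hr, linPropagator_eq η hT hs₂ h2 x₀ hr,
      linPropagator_eq η hT hs₃ h2 x₀ hr, mul_assoc _ _ (∑' k : ℤ, _),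
      tsum_mul_tsum_of_summable_norm S2 S3, mul_assoc ((xPlus r ^ 2 : ℝ) : ℂ),
      tsum_mul_tsum_of_summable_norm S1 (S2.mul_norm S3), ← tsum_mul_left, ← tsum_mul_right]
    refine tsum_congr fun K => ?_
    rw [sunsetTerm]
    have e : Complex.exp (-Complex.I * ((xPlus r : ℝ) : ℂ)) * Complex.exp (Complex.I *
        ((2 * Real.pi * T * ((K.1 + K.2.1 + K.2.2 + 1 : ℤ) : ℝ) * x₀ : ℝ) : ℂ)) =
        Complex.exp (Complex.I * ((matsubara T K.1 * x₀ : ℝ) : ℂ)) *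
        Complex.exp (Complex.I * ((matsubara T K.2.1 * x₀ : ℝ) : ℂ)) *
        Complex.exp (Complex.I * ((matsubara T K.2.2 * x₀ : ℝ) : ℂ)) *
        Complex.exp (-Complex.I * ((Real.pi * T * x₀ + xPlus r : ℝ) : ℂ)) := by
      rw [← Complex.exp_add, ← Complex.exp_add, ← Complex.exp_add, ← Complex.exp_add]
      congr 1
      simp only [matsubara]
      push_cast
      ring
    rw [mul_assoc _ (Complex.exp (-Complex.I * ((xPlus r : ℝ) : ℂ))), e]
    ring

lemma continuous_tsum_mul_cexp {κ : Type*} {a : κ → ℂ} (ha : Summable fun K => ‖a K‖) (φ : κ → ℝ) :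
    Continuous fun x₀ : ℝ => ∑' K, a K * Complex.exp (Complex.I * ((φ K * x₀ : ℝ) : ℂ)) := by
  refine continuous_tsum (u := fun K => ‖a K‖) (fun K => by fun_prop) ha fun K x₀ => ?_
  rw [norm_mul, Complex.norm_exp_I_mul_ofReal, mul_one]

lemma norm_tsum_mul_cexp_le {κ : Type*} {a : κ → ℂ} (ha : Summable fun K => ‖a K‖) (φ : κ → ℝ) (x₀ : ℝ) :
    ‖∑' K, a K * Complex.exp (Complex.I * ((φ K * x₀ : ℝ) : ℂ))‖ ≤ ∑' K, ‖a K‖ := by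
  refine (norm_tsum_le_tsum_norm ?_).trans (le_of_eq ?_)
  · simpa only [norm_mul, Complex.norm_exp_I_mul_ofReal, mul_one] using ha
  · simp only [norm_mul, Complex.norm_exp_I_mul_ofReal, mul_one]

/-- An absolutely convergent Fourier series in `x₀` with coefficients on the lattice is
integrable. -/
theorem integrable_spaceMeasure_tsum {κ : Type*} [Countable κ] {c : κ → ℤ × ℤ → ℂ}
    (hc : Summable fun z : κ × (ℤ × ℤ) => ‖c z.1 z.2‖) (φ : κ → ℝ) (T : ℝ) :
    Integrable (fun x : ℝ × (ℤ × ℤ) => ∑' K, c K x.2 *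
      Complex.exp (Complex.I * ((φ K * x.1 : ℝ) : ℂ))) (spaceMeasure T) := by
  have hc' : Summable fun z : (ℤ × ℤ) × κ => ‖c z.2 z.1‖ := hc.prod_symm
  have hr : ∀ r, Summable fun K => ‖c K r‖ := fun r => hc'.prod_factor r
  have hS : Summable fun r => ∑' K, ‖c K r‖ := hc'.prod
  have hcont := fun r => continuous_tsum_mul_cexp (hr r) φ
  have hmeas : Measurable (fun x : ℝ × (ℤ × ℤ) => ∑' K, c K x.2 *
      Complex.exp (Complex.I * ((φ K * x.1 : ℝ) : ℂ))) :=
    measurable_from_prod_countable_left fun r => (hcont r).measurable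
  have hfin : IsFiniteMeasure (volume.restrict (Set.Ico (-(1 / T)) (1 / T))) :=
    ⟨by simp⟩
  rw [spaceMeasure, integrable_prod_iff' hmeas.aestronglyMeasurable]
  refine ⟨Eventually.of_forall fun r => ?_, ?_⟩
  · exact Integrable.mono' (integrable_const (∑' K, ‖c K r‖)) (hcont r).aestronglyMeasurable
      (Eventually.of_forall fun x₀ => norm_tsum_mul_cexp_le (hr r) φ x₀)
  · rw [integrable_count_iff]
    refine Summable.of_nonneg_of_le (fun r => norm_nonneg _) (fun r => ?_)
      (hS.mul_left ((volume.restrict (Set.Ico (-(1 / T)) (1 / T))).real Set.univ))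
    have := integral_mono (μ := volume.restrict (Set.Ico (-(1 / T)) (1 / T)))
      (Integrable.mono' (integrable_const (∑' K, ‖c K r‖)) (hcont r).aestronglyMeasurable
        (Eventually.of_forall fun x₀ => norm_tsum_mul_cexp_le (hr r) φ x₀)).norm
      (integrable_const (∑' K, ‖c K r‖)) (fun x₀ => norm_tsum_mul_cexp_le (hr r) φ x₀)
    rw [integral_const, smul_eq_mul] at this
    rwa [Real.norm_of_nonneg (integral_nonneg fun _ => norm_nonneg _)]

theorem integral_spaceMeasure_tsum {κ : Type*} [Countable κ] {c : κ → ℤ × ℤ → ℂ}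
    (hc : Summable fun z : κ × (ℤ × ℤ) => ‖c z.1 z.2‖) (φ : κ → ℝ) (T : ℝ) :
    ∫ x : ℝ × (ℤ × ℤ), (∑' K, c K x.2 *
      Complex.exp (Complex.I * ((φ K * x.1 : ℝ) : ℂ))) ∂(spaceMeasure T) =
    ∑' r, ∑' K, c K r * ∫ x₀ in Set.Ico (-(1 / T)) (1 / T),
      Complex.exp (Complex.I * ((φ K * x₀ : ℝ) : ℂ)) := by
  have hint := integrable_spaceMeasure_tsum hc φ T
  have hc' : Summable fun z : (ℤ × ℤ) × κ => ‖c z.2 z.1‖ := hc.prod_symm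
  have hr : ∀ r, Summable fun K => ‖c K r‖ := fun r => hc'.prod_factor r
  have hfin : IsFiniteMeasure (volume.restrict (Set.Ico (-(1 / T)) (1 / T))) :=
    ⟨by simp⟩
  rw [spaceMeasure, integral_prod_symm _ hint, integral_countable hint.integral_prod_right]
  refine tsum_congr fun r => ?_
  simp only [measureReal_def, Measure.count_singleton, ENNReal.toReal_one, one_smul]
  have h := hasSum_integral_of_summable_integral_norm
    (μ := volume.restrict (Set.Ico (-(1 / T)) (1 / T)))
    (F := fun K x₀ => c K r * Complex.exp (Complex.I * ((φ K * x₀ : ℝ) : ℂ))) (fun K => ?_) ?_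
  · rw [← h.tsum_eq]
    simp_rw [integral_const_mul]
  · refine Integrable.mono' (integrable_const ‖c K r‖)
      (Continuous.aestronglyMeasurable (by fun_prop)) (Eventually.of_forall fun x₀ => ?_)
    rw [norm_mul, Complex.norm_exp_I_mul_ofReal, mul_one]
  · simp_rw [norm_mul, Complex.norm_exp_I_mul_ofReal, mul_one, integral_const, smul_eq_mul]
    exact (hr r).mul_left _

/-- The interval is two full periods of `e^{2πiTx₀}`, so every nonzero frequency integrates to zero.
-/
lemma integral_cexp_matsubara {T : ℝ} (hT : 0 < T) (j : ℤ) :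
    ∫ x₀ in Set.Ico (-(1 / T)) (1 / T),
      Complex.exp (Complex.I * ((2 * Real.pi * T * (j : ℝ) * x₀ : ℝ) : ℂ)) =
      if j = 0 then 2 / (T : ℂ) else 0 := by
  have hle : -(1 / T) ≤ 1 / T := by
    have : 0 < 1 / T := by positivity
    linarith
  have hTC : (T : ℂ) ≠ 0 := by exact_mod_cast hT.ne'
  rw [integral_Ico_eq_integral_Ioc, ← intervalIntegral.integral_of_le hle]
  split_ifs with h
  · subst h
    simp
    field_simp
    norm_num
  · have hπ' : (Real.pi : ℂ) ≠ 0 := by exact_mod_cast Real.pi_ne_zero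
    have hj : (j : ℂ) ≠ 0 := by exact_mod_cast h
    have hne : Complex.I * (2 * Real.pi * T * j) ≠ 0 := by
      simp [hπ', hj, hTC]
    have e : ∀ x₀ : ℝ, Complex.I * ((2 * Real.pi * T * (j : ℝ) * x₀ : ℝ) : ℂ) =
        Complex.I * (2 * Real.pi * T * j) * x₀ := by
      intro x₀
      push_cast
      ring
    simp_rw [e]
    rw [integral_exp_mul_complex hne]
    have e1 : Complex.I * (2 * Real.pi * T * j) * ((1 / T : ℝ) : ℂ) =
        j * (2 * Real.pi * Complex.I) := by
      push_cast
      field_simp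
    have e2 : Complex.I * (2 * Real.pi * T * j) * ((-(1 / T) : ℝ) : ℂ) =
        ((-j : ℤ) : ℂ) * (2 * Real.pi * Complex.I) := by
      push_cast
      field_simp
    rw [e1, e2, Complex.exp_int_mul_two_pi_mul_I, Complex.exp_int_mul_two_pi_mul_I, sub_self,
      zero_div]

/-- The frequencies allowed by conservation at external frequency `πT`. -/
def conservedTriple (k : ℤ × ℤ) : ℤ × ℤ × ℤ := (k.1, k.2, -1 - k.1 - k.2)

lemma conservedTriple_injective : Function.Injective conservedTriple := by
  intro a b h
  simp only [conservedTriple, Prod.mk.injEq] at h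
  exact Prod.ext h.1 h.2.1

theorem integral_sunsetIntegrand {η : ℝ → ℝ} {M : ℝ} (hM : ∀ k, |η k| ≤ M) {T s₁ s₂ s₃ : ℝ}
    (hT : 0 < T) (hs₁ : s₁ ∈ ({1, -1} : Set ℝ)) (hs₂ : s₂ ∈ ({1, -1} : Set ℝ))
    (hs₃ : s₃ ∈ ({1, -1} : Set ℝ)) :
    Integrable (sunsetIntegrand η T s₁ s₂ s₃) (spaceMeasure T) ∧
    ∫ x, sunsetIntegrand η T s₁ s₂ s₃ x ∂(spaceMeasure T) =
      2 / T * ∑' r, ∑' k, sunsetTerm η T s₁ s₂ s₃ (conservedTriple k) r := by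
  have hS := summable_norm_sunsetTerm hM hT s₁ s₂ s₃
  have he : sunsetIntegrand η T s₁ s₂ s₃ = fun x => ∑' K : ℤ × ℤ × ℤ,
      sunsetTerm η T s₁ s₂ s₃ K x.2 * Complex.exp (Complex.I *
        ((2 * Real.pi * T * ((K.1 + K.2.1 + K.2.2 + 1 : ℤ) : ℝ) * x.1 : ℝ) : ℂ)) :=
    funext fun x => sunsetIntegrand_eq hM hT hs₁ hs₂ hs₃ x
  rw [he]
  refine ⟨integrable_spaceMeasure_tsum hS _ T, ?_⟩
  rw [integral_spaceMeasure_tsum hS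
    (fun K => 2 * Real.pi * T * ((K.1 + K.2.1 + K.2.2 + 1 : ℤ) : ℝ)) T, ← tsum_mul_left]
  refine tsum_congr fun r => ?_
  simp_rw [integral_cexp_matsubara hT]
  rw [← tsum_mul_left, ← conservedTriple_injective.tsum_eq]
  · refine tsum_congr fun k => ?_
    have : (conservedTriple k).1 + (conservedTriple k).2.1 + (conservedTriple k).2.2 + 1 = 0 := by
      simp only [conservedTriple]
      ring
    rw [if_pos this, mul_comm]
  · intro K hK
    rw [Function.mem_support] at hK
    by_cases h : K.1 + K.2.1 + K.2.2 + 1 = 0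
    · refine ⟨(K.1, K.2.1), ?_⟩
      refine Prod.ext rfl (Prod.ext rfl ?_)
      simp only [conservedTriple]
      omega
    · simp [h] at hK

/-! ### Signs, and cancellation of the odd sites -/

/-- The signed cutoff weight of a Matsubara frequency. -/
def freqWeight (η : ℝ → ℝ) (T : ℝ) (k : ℤ) : ℝ :=
  η (matsubara T k) * (SignType.sign (matsubara T k) : ℝ)

lemma sideSign_neg {b : ℝ} (hb : b ≠ 0) {n : ℤ} (hn : Odd n) : sideSign (-b) n = -sideSign b n := by
  rcases lt_or_gt_of_ne hb with h | h
  · rw [sideSign, sideSign, if_neg (by linarith), if_pos h, hn.neg_one_zpow]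
  · rw [sideSign, sideSign, if_pos (by linarith), if_neg (by linarith), hn.neg_one_zpow, neg_neg]

lemma sideSign_of_even (b : ℝ) {n : ℤ} (hn : Even n) : sideSign b n = 1 := by
  rw [sideSign, hn.neg_one_zpow, ite_self]

/-- The reflection of the lattice that reverses `x₊` and fixes `x₋`. -/
def plusReflection : (ℤ × ℤ) ≃ (ℤ × ℤ) where
  toFun r := (-r.2, -r.1)
  invFun r := (-r.2, -r.1)
  left_inv r := by simp
  right_inv r := by simp

lemma xPlus_plusReflection (r : ℤ × ℤ) : xPlus (plusReflection r) = -xPlus r := by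
  simp only [xPlus, plusReflection, Equiv.coe_fn_mk]
  push_cast
  ring

/-- The phases combine to `e^{-2ix₊} = (-1)^{r₁+r₂}`, since the three sides sum to `-1` and the
external momentum contributes another `-1`. The prefactors multiply to `(-i)³ = i`, the two signs `σ
= -1` cancelling. -/
lemma sunsetTerm_eq (η : ℝ → ℝ) {T s₁ s₂ s₃ : ℝ} (hs : s₁ + s₂ + s₃ = -1) (K : ℤ × ℤ × ℤ)
    (r : ℤ × ℤ) :
    sunsetTerm η T s₁ s₂ s₃ K r = Complex.I * T ^ 3 / (64 * Real.pi ^ 3) * (-1) ^ (r.1 + r.2) *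
      ((xPlus r ^ 2 * (freqWeight η T K.1 * freqWeight η T K.2.1 * freqWeight η T K.2.2) : ℝ) *
      (sideSign (s₁ * 1 * matsubara T K.1 * xPlus r) (r.1 - r.2) *
        sideSign (s₂ * (-1) * matsubara T K.2.1 * xPlus r) (r.1 - r.2) *
        sideSign (s₃ * (-1) * matsubara T K.2.2 * xPlus r) (r.1 - r.2)) *
      (expSecCoeff (r.1 - r.2) (|matsubara T K.1 * xPlus r| / Real.pi) *
        expSecCoeff (r.1 - r.2) (|matsubara T K.2.1 * xPlus r| / Real.pi) *
        expSecCoeff (r.1 - r.2) (|matsubara T K.2.2 * xPlus r| / Real.pi))) := by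
  have hπ' : (Real.pi : ℂ) ≠ 0 := by exact_mod_cast Real.pi_ne_zero
  have e : Complex.exp (Complex.I * ((s₁ * xPlus r : ℝ) : ℂ)) *
      Complex.exp (Complex.I * ((s₂ * xPlus r : ℝ) : ℂ)) *
      Complex.exp (Complex.I * ((s₃ * xPlus r : ℝ) : ℂ)) *
      Complex.exp (-Complex.I * ((xPlus r : ℝ) : ℂ)) = (-1) ^ (r.1 + r.2) := by
    rw [← inv_inj, ← inv_zpow, inv_neg_one, ← cexp_int_mul_pi, ← Complex.exp_add,
      ← Complex.exp_add, ← Complex.exp_add, ← Complex.exp_neg]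
    congr 1
    have h2 : (r.1 + r.2 : ℤ) * Real.pi = -((s₁ + s₂ + s₃ - 1) * xPlus r) := by
      rw [hs, xPlus_eq]
      ring
    rw [h2]
    push_cast
    ring
  rw [← e]
  have fw : ∀ k, η (matsubara T k) * (SignType.sign (matsubara T k) : ℝ) = freqWeight η T k :=
    fun _ => rfl
  simp only [sunsetTerm, propAmplitude, fw]
  generalize Complex.exp (Complex.I * ((s₁ * xPlus r : ℝ) : ℂ)) = A₁
  generalize Complex.exp (Complex.I * ((s₂ * xPlus r : ℝ) : ℂ)) = A₂
  generalize Complex.exp (Complex.I * ((s₃ * xPlus r : ℝ) : ℂ)) = A₃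
  generalize Complex.exp (-Complex.I * ((xPlus r : ℝ) : ℂ)) = A₄
  generalize expSecCoeff (r.1 - r.2) (|matsubara T K.1 * xPlus r| / Real.pi) = G₁
  generalize expSecCoeff (r.1 - r.2) (|matsubara T K.2.1 * xPlus r| / Real.pi) = G₂
  generalize expSecCoeff (r.1 - r.2) (|matsubara T K.2.2 * xPlus r| / Real.pi) = G₃
  generalize sideSign _ _ = S₁
  generalize sideSign _ _ = S₂
  generalize sideSign _ _ = S₃
  generalize freqWeight η T K.1 = w₁
  generalize freqWeight η T K.2.1 = w₂
  generalize freqWeight η T K.2.2 = w₃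
  generalize xPlus r = y
  push_cast
  linear_combination (-(Complex.I * T ^ 3 / (64 * Real.pi ^ 3)) * (A₁ * A₂ * A₃ * A₄) *
    (y ^ 2 * (w₁ * w₂ * w₃) * (S₁ * S₂ * S₃) * (G₁ * G₂ * G₃))) * Complex.I_sq

/-- On an odd site, reversing `x₊` flips all three side signs, an odd number, while the remaining
factors are even in `x₊`. -/
lemma sunsetTerm_plusReflection (η : ℝ → ℝ) {T s₁ s₂ s₃ : ℝ} (hT : 0 < T)
    (hs₁ : s₁ ∈ ({1, -1} : Set ℝ)) (hs₂ : s₂ ∈ ({1, -1} : Set ℝ)) (hs₃ : s₃ ∈ ({1, -1} : Set ℝ))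
    (hs : s₁ + s₂ + s₃ = -1) (K : ℤ × ℤ × ℤ) {r : ℤ × ℤ} (hr : Odd (r.1 - r.2)) :
    sunsetTerm η T s₁ s₂ s₃ K (plusReflection r) = -sunsetTerm η T s₁ s₂ s₃ K r := by
  have ne : ∀ {s : ℝ}, s ∈ ({1, -1} : Set ℝ) → s ≠ 0 := by
    rintro s (rfl | rfl) <;> norm_num
  rcases eq_or_ne (xPlus r) 0 with h0 | h0
  · rw [sunsetTerm, sunsetTerm, xPlus_plusReflection, h0]
    simp
  · have hb : ∀ {s σ : ℝ}, s ∈ ({1, -1} : Set ℝ) → σ ≠ 0 → ∀ k : ℤ,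
        sideSign (s * σ * matsubara T k * -xPlus r) (r.1 - r.2) =
          -sideSign (s * σ * matsubara T k * xPlus r) (r.1 - r.2) := by
      intro s σ h1 h2 k
      rw [mul_neg, sideSign_neg (mul_ne_zero (mul_ne_zero (mul_ne_zero (ne h1) h2)
        (matsubara_ne_zero hT k)) h0) hr]
    have e1 : (plusReflection r).1 - (plusReflection r).2 = r.1 - r.2 := by
      simp only [plusReflection, Equiv.coe_fn_mk]
      ring
    have e2 : (-1 : ℂ) ^ ((plusReflection r).1 + (plusReflection r).2) = (-1) ^ (r.1 + r.2) := by
      have : (plusReflection r).1 + (plusReflection r).2 = -(r.1 + r.2) := by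
        simp only [plusReflection, Equiv.coe_fn_mk]
        ring
      rw [this, zpow_neg, ← inv_zpow, inv_neg_one]
    rw [sunsetTerm_eq η hs, sunsetTerm_eq η hs, e1, e2, xPlus_plusReflection, hb hs₁ one_ne_zero,
      hb hs₂ (by norm_num), hb hs₃ (by norm_num), neg_sq]
    simp only [mul_neg, neg_mul, abs_neg, neg_neg]

/-- The lattice sites with even light-cone coordinates. -/
def evenSite (z : ℤ × ℤ) : ℤ × ℤ := (z.1 + z.2, z.1 - z.2)

lemma evenSite_injective : Function.Injective evenSite := by
  intro a b h
  simp only [evenSite, Prod.mk.injEq] at h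
  exact Prod.ext (by omega) (by omega)

lemma sunsetTerm_evenSite (η : ℝ → ℝ) {T s₁ s₂ s₃ : ℝ} (hs : s₁ + s₂ + s₃ = -1) (K : ℤ × ℤ × ℤ)
    (z : ℤ × ℤ) :
    sunsetTerm η T s₁ s₂ s₃ K (evenSite z) = Complex.I * T ^ 3 / (64 * Real.pi) *
      (((z.1 : ℝ) ^ 2 * (freqWeight η T K.1 * freqWeight η T K.2.1 * freqWeight η T K.2.2) : ℝ) *
      (expSecCoeff (2 * z.2) (|matsubara T K.1| * |(z.1 : ℝ)|) *
        expSecCoeff (2 * z.2) (|matsubara T K.2.1| * |(z.1 : ℝ)|) *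
        expSecCoeff (2 * z.2) (|matsubara T K.2.2| * |(z.1 : ℝ)|))) := by
  have hπ := Real.pi_pos
  have hπ' : (Real.pi : ℂ) ≠ 0 := by exact_mod_cast Real.pi_ne_zero
  have e1 : (evenSite z).1 - (evenSite z).2 = 2 * z.2 := by
    simp only [evenSite]
    ring
  have e2 : (evenSite z).1 + (evenSite z).2 = 2 * z.1 := by
    simp only [evenSite]
    ring
  have e3 : xPlus (evenSite z) = Real.pi * z.1 := by
    rw [xPlus_eq, e2]
    push_cast
    ring
  have e4 : ∀ k : ℤ, |matsubara T k * (Real.pi * z.1)| / Real.pi =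
      |matsubara T k| * |(z.1 : ℝ)| := by
    intro k
    rw [abs_mul, abs_mul, abs_of_pos hπ]
    field_simp
  have ev : ∀ j : ℤ, Even (2 * j) := fun j => even_two_mul j
  rw [sunsetTerm_eq η hs, e1, e2, e3, e4, e4, e4, (ev z.1).neg_one_zpow,
    sideSign_of_even _ (ev z.2), sideSign_of_even _ (ev z.2), sideSign_of_even _ (ev z.2)]
  push_cast
  field_simp

/-- Only the sites with even light-cone coordinates contribute. -/
lemma tsum_sunsetTerm {η : ℝ → ℝ} {M : ℝ} (hM : ∀ k, |η k| ≤ M) {T s₁ s₂ s₃ : ℝ} (hT : 0 < T)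
    (hs₁ : s₁ ∈ ({1, -1} : Set ℝ)) (hs₂ : s₂ ∈ ({1, -1} : Set ℝ)) (hs₃ : s₃ ∈ ({1, -1} : Set ℝ))
    (hs : s₁ + s₂ + s₃ = -1) :
    ∑' r, ∑' k, sunsetTerm η T s₁ s₂ s₃ (conservedTriple k) r =
      ∑' z, ∑' k, sunsetTerm η T s₁ s₂ s₃ (conservedTriple k) (evenSite z) := by
  set f : ℤ × ℤ → ℂ := fun r => ∑' k, sunsetTerm η T s₁ s₂ s₃ (conservedTriple k) r with hf
  have hS := (summable_norm_sunsetTerm hM hT s₁ s₂ s₃).comp_injective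
    (i := fun z : (ℤ × ℤ) × (ℤ × ℤ) => (conservedTriple z.2, z.1)) (fun a b h => by
      simp only [Prod.mk.injEq] at h
      exact Prod.ext h.2 (conservedTriple_injective h.1))
  have hfs : Summable f := Summable.prod (f := fun z : (ℤ × ℤ) × (ℤ × ℤ) =>
    sunsetTerm η T s₁ s₂ s₃ (conservedTriple z.2) z.1) hS.of_norm
  set S : Set (ℤ × ℤ) := {r | Even (r.1 - r.2)} with hSdef
  -- The reflection permutes the odd sites and reverses the sign of each term, so the sum equals its
  -- own negative.
  have hodd : ∑' r, Sᶜ.indicator f r = 0 := by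
    have h1 := plusReflection.tsum_eq (Sᶜ.indicator f)
    have h2 : ∀ r, Sᶜ.indicator f (plusReflection r) = -Sᶜ.indicator f r := by
      intro r
      have e1 : (plusReflection r).1 - (plusReflection r).2 = r.1 - r.2 := by
        simp only [plusReflection, Equiv.coe_fn_mk]
        ring
      by_cases h : r ∈ Sᶜ
      · have h' : plusReflection r ∈ Sᶜ := by
          simpa only [hSdef, Set.mem_compl_iff, Set.mem_ofPred_eq, e1] using h
        rw [Set.indicator_of_mem h, Set.indicator_of_mem h', hf]
        simp only
        rw [← tsum_neg]
        refine tsum_congr fun k => sunsetTerm_plusReflection η hT hs₁ hs₂ hs₃ hs _ ?_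
        simpa only [hSdef, Set.mem_compl_iff, Set.mem_ofPred_eq, Int.not_even_iff_odd] using h
      · have h' : plusReflection r ∉ Sᶜ := by
          simpa only [hSdef, Set.mem_compl_iff, Set.mem_ofPred_eq, e1] using h
        rw [Set.indicator_of_notMem h, Set.indicator_of_notMem h', neg_zero]
    simp_rw [h2] at h1
    rw [tsum_neg] at h1
    exact self_eq_neg.mp h1.symm
  have hsplit : ∑' r, f r = ∑' r, S.indicator f r := by
    rw [← add_zero (∑' r, S.indicator f r), ← hodd,
      ← (hfs.indicator S).tsum_add (hfs.indicator Sᶜ)]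
    refine tsum_congr fun r => ?_
    rw [Set.indicator_self_add_compl_apply]
  rw [hsplit, ← evenSite_injective.tsum_eq]
  · refine tsum_congr fun z => ?_
    rw [Set.indicator_of_mem]
    simp only [hSdef, Set.mem_ofPred_eq, evenSite]
    exact ⟨z.2, by ring⟩
  · intro r hr
    have hr' : r ∈ S := by
      by_contra h
      exact hr (Set.indicator_of_notMem h f)
    obtain ⟨p, hp⟩ := hr'
    refine ⟨(r.2 + p, p), ?_⟩
    simp only [evenSite]
    exact Prod.ext (by simp only; omega) (by simp only; omega)

/-! ### Summation over `x₋` and the real form of the amplitude -/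

/-- The contribution of the transversal site `l` and the frequencies `k` to the amplitude, the sum
over the momentum `k₋` being done. -/
def sunsetWeight (η : ℝ → ℝ) (T : ℝ) (l : ℤ) (k : ℤ × ℤ) : ℝ :=
  (l : ℝ) ^ 2 *
    (freqWeight η T k.1 * freqWeight η T k.2 * freqWeight η T (-1 - k.1 - k.2)) *
    expSecTriple (|matsubara T k.1| * |(l : ℝ)|) (|matsubara T k.2| * |(l : ℝ)|)
      (|matsubara T (-1 - k.1 - k.2)| * |(l : ℝ)|)

lemma hasSum_sunsetTerm_evenSite (η : ℝ → ℝ) {T s₁ s₂ s₃ : ℝ} (hT : 0 < T)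
    (hs : s₁ + s₂ + s₃ = -1) (l : ℤ) (k : ℤ × ℤ) :
    HasSum (fun p : ℤ => sunsetTerm η T s₁ s₂ s₃ (conservedTriple k) (evenSite (l, p)))
      (Complex.I * T ^ 3 / 64 * sunsetWeight η T l k) := by
  have hπ' : (Real.pi : ℂ) ≠ 0 := by exact_mod_cast Real.pi_ne_zero
  simp_rw [sunsetTerm_evenSite η hs]
  rcases eq_or_ne l 0 with rfl | hl
  · simp [sunsetWeight, hasSum_zero]
  · have hl' : 0 < |(l : ℝ)| := by
      have : (l : ℝ) ≠ 0 := by exact_mod_cast hl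
      positivity
    have hu : ∀ k : ℤ, 0 < |matsubara T k| * |(l : ℝ)| := fun k =>
      mul_pos (abs_pos.mpr (matsubara_ne_zero hT k)) hl'
    have h := ((hasSum_expSecCoeff_mul_mul (hu k.1) (hu k.2) (hu (-1 - k.1 - k.2))).mul_left
      (((l : ℝ) ^ 2 * (freqWeight η T k.1 * freqWeight η T k.2 *
        freqWeight η T (-1 - k.1 - k.2)) : ℝ) : ℂ)).mul_left
      (Complex.I * T ^ 3 / (64 * Real.pi))
    convert! h using 1
    rw [sunsetWeight]
    push_cast
    field_simp

/-- Absolute convergence lets the sum over `x₋` be taken first, at fixed `x₊` and frequencies. The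
resulting value no longer depends on the individual sides. -/
lemma tsum_sunsetTerm_evenSite {η : ℝ → ℝ} {M : ℝ} (hM : ∀ k, |η k| ≤ M) {T s₁ s₂ s₃ : ℝ}
    (hT : 0 < T) (hs : s₁ + s₂ + s₃ = -1) :
    Summable (fun y : ℤ × (ℤ × ℤ) => sunsetWeight η T y.1 y.2) ∧
    ∑' z, ∑' k, sunsetTerm η T s₁ s₂ s₃ (conservedTriple k) (evenSite z) =
      Complex.I * T ^ 3 / 64 * ((∑' y : ℤ × (ℤ × ℤ), sunsetWeight η T y.1 y.2 : ℝ) : ℂ) := by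
  have hS := ((summable_norm_sunsetTerm hM hT s₁ s₂ s₃).comp_injective
    (i := fun z : (ℤ × ℤ) × (ℤ × ℤ) => (conservedTriple z.2, evenSite z.1)) (fun a b h => by
      simp only [Prod.mk.injEq] at h
      exact Prod.ext (evenSite_injective h.2) (conservedTriple_injective h.1))).of_norm
  set F : (ℤ × ℤ) × (ℤ × ℤ) → ℂ := fun z =>
    sunsetTerm η T s₁ s₂ s₃ (conservedTriple z.2) (evenSite z.1) with hF
  have hFs : Summable F := hS
  let e : (ℤ × (ℤ × ℤ)) × ℤ ≃ (ℤ × ℤ) × (ℤ × ℤ) :=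
    { toFun := fun y => ((y.1.1, y.2), y.1.2)
      invFun := fun z => ((z.1.1, z.2), z.1.2)
      left_inv := fun _ => rfl
      right_inv := fun _ => rfl }
  have hFe : Summable (F ∘ e) := e.summable_iff.mpr hFs
  have hsum : ∀ y : ℤ × (ℤ × ℤ), ∑' p, (F ∘ e) (y, p) =
      Complex.I * T ^ 3 / 64 * sunsetWeight η T y.1 y.2 := fun y =>
    (hasSum_sunsetTerm_evenSite η hT hs y.1 y.2).tsum_eq
  have hTC : (T : ℂ) ≠ 0 := by exact_mod_cast hT.ne'
  have hc : Complex.I * (T : ℂ) ^ 3 / 64 ≠ 0 := by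
    simp [hTC]
  have hprod := hFe.prod
  simp_rw [hsum] at hprod
  constructor
  · have := (summable_mul_left_iff hc).mp hprod
    exact_mod_cast this
  · have h1 : ∑' z, ∑' k, F (z, k) = ∑' z, F z := hFs.tsum_prod.symm
    calc _ = ∑' z, F z := h1
      _ = ∑' y, (F ∘ e) y := (e.tsum_eq F).symm
      _ = ∑' y : ℤ × (ℤ × ℤ), ∑' p, (F ∘ e) (y, p) := hFe.tsum_prod
      _ = _ := by
        simp_rw [hsum]
        rw [tsum_mul_left, Complex.ofReal_tsum]

/-- Both integrals take the same value, so they enter `1 + 2 = 3` times; the factor is `3 · (2/T) ·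
T³/64`. -/
theorem approxSecondDeriv_eq {η : ℝ → ℝ} {M : ℝ} (hM : ∀ k, |η k| ≤ M) {T : ℝ} (hT : 0 < T) :
    approxSecondDeriv η T = Complex.I * ((3 * T ^ 2 / 32 *
      ∑' y : ℤ × (ℤ × ℤ), sunsetWeight η T y.1 y.2 : ℝ) : ℂ) := by
  have h1 : (1 : ℝ) ∈ ({1, -1} : Set ℝ) := by simp
  have h2 : (-1 : ℝ) ∈ ({1, -1} : Set ℝ) := by simp
  have hTC : (T : ℂ) ≠ 0 := by exact_mod_cast hT.ne'
  have e1 : (1 : ℝ) + -1 + -1 = -1 := by norm_num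
  have e2 : (-1 : ℝ) + 1 + -1 = -1 := by norm_num
  rw [approxSecondDeriv, (integral_sunsetIntegrand hM hT h1 h2 h2).2,
    (integral_sunsetIntegrand hM hT h2 h1 h2).2, tsum_sunsetTerm hM hT h1 h2 h2 e1,
    tsum_sunsetTerm hM hT h2 h1 h2 e2, (tsum_sunsetTerm_evenSite hM hT e1).2,
    (tsum_sunsetTerm_evenSite hM hT e2).2, Complex.ofReal_mul]
  generalize ((∑' y : ℤ × (ℤ × ℤ), sunsetWeight η T y.1 y.2 : ℝ) : ℂ) = S
  push_cast
  field_simp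
  ring

/-! ### Sectors of conserved frequencies and their pairing -/

/-- The product of Fourier coefficients is symmetric, which the double integral does not show at
sight. -/
lemma expSecTriple_swap_left {u v w : ℝ} (hu : 0 < u) (hv : 0 < v) (hw : 0 < w) :
    expSecTriple u v w = expSecTriple v u w := by
  have h1 := hasSum_expSecCoeff_mul_mul hu hv hw
  have h2 := hasSum_expSecCoeff_mul_mul hv hu hw
  simp_rw [fun p : ℤ => mul_comm (expSecCoeff (2 * p) v) (expSecCoeff (2 * p) u)] at h2
  exact mul_left_cancel₀ Real.pi_ne_zero (Complex.ofReal_injective (h1.unique h2))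

lemma expSecTriple_swap_right {u v w : ℝ} (hu : 0 < u) (hv : 0 < v) (hw : 0 < w) :
    expSecTriple u v w = expSecTriple u w v := by
  have h1 := hasSum_expSecCoeff_mul_mul hu hv hw
  have h2 := hasSum_expSecCoeff_mul_mul hu hw hv
  simp_rw [fun p : ℤ => mul_right_comm (expSecCoeff (2 * p) u) (expSecCoeff (2 * p) w)
    (expSecCoeff (2 * p) v)] at h2
  exact mul_left_cancel₀ Real.pi_ne_zero (Complex.ofReal_injective (h1.unique h2))

/-- Parametrization of the conserved frequencies by the position of the exceptional sign and by
whether one (`false`) or two (`true`) of the three frequencies are negative. -/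
def frequencySector : Fin 3 × Bool → ℕ × ℕ → ℤ × ℤ
  | (0, false), (a, b) => (a, b)
  | (1, false), (a, b) => (a, -(a + b : ℤ) - 1)
  | (2, false), (a, b) => (-(a + b : ℤ) - 1, a)
  | (0, true), (a, b) => (-(a : ℤ) - 1, -(b : ℤ) - 1)
  | (1, true), (a, b) => (-(a : ℤ) - 1, a + b + 1)
  | (2, true), (a, b) => (a + b + 1, -(a : ℤ) - 1)

/-- Three odd integers with sum `1` cannot all have the same sign. Exactly one member therefore has
a sign opposite to the other two; its position and sign give six sectors, and the other two members
are free. -/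
lemma frequencySector_bijective :
    Function.Bijective fun z : (Fin 3 × Bool) × (ℕ × ℕ) => frequencySector z.1 z.2 := by
  constructor
  · rintro ⟨⟨j, s⟩, a, b⟩ ⟨⟨j', s'⟩, a', b'⟩ h
    fin_cases j <;> fin_cases j' <;> cases s <;> cases s' <;>
      simp only [frequencySector, Prod.mk.injEq] at h <;>
      first
      | (exfalso; omega)
      | (have h1 : a = a' := by omega
         have h2 : b = b' := by omega
         rw [h1, h2])
  · rintro ⟨x, y⟩
    rcases le_or_gt 0 x with hx | hx <;> rcases le_or_gt 0 y with hy | hy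
    · exact ⟨((0, false), (x.toNat, y.toNat)), Prod.ext (by simp only [frequencySector]; omega)
        (by simp only [frequencySector]; omega)⟩
    · rcases le_or_gt 0 (-1 - x - y) with hz | hz
      · exact ⟨((1, false), (x.toNat, (-1 - x - y).toNat)),
          Prod.ext (by simp only [frequencySector]; omega)
          (by simp only [frequencySector]; omega)⟩
      · exact ⟨((2, true), ((-y - 1).toNat, (x + y).toNat)),
          Prod.ext (by simp only [frequencySector]; omega)
          (by simp only [frequencySector]; omega)⟩
    · rcases le_or_gt 0 (-1 - x - y) with hz | hz
      · exact ⟨((2, false), (y.toNat, (-1 - x - y).toNat)),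
          Prod.ext (by simp only [frequencySector]; omega)
          (by simp only [frequencySector]; omega)⟩
      · exact ⟨((1, true), ((-x - 1).toNat, (x + y).toNat)),
          Prod.ext (by simp only [frequencySector]; omega)
          (by simp only [frequencySector]; omega)⟩
    · exact ⟨((0, true), ((-x - 1).toNat, (-y - 1).toNat)),
        Prod.ext (by simp only [frequencySector]; omega)
        (by simp only [frequencySector]; omega)⟩

/-- The three-profile overlap at the absolute frequencies `(2a+1)πT`, `(2b+1)πT`, `(2c+1)πT`. -/
def oddTriple (x : ℝ) (a b c : ℕ) : ℝ :=
  expSecTriple ((2 * a + 1) * x) ((2 * b + 1) * x) ((2 * c + 1) * x)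

/-- The numbers `eᵢ` are the signs of the frequencies and `h` is the product of the three cutoffs,
equal to `1` when all frequencies lie below `δ`. -/
lemma exists_sunsetWeight_eq {η : ℝ → ℝ} {M δ : ℝ} (hM : ∀ k, |η k| ≤ M)
    (hδ : ∀ k, |k| < δ → η k = 1) {T : ℝ} (hT : 0 < T) (l : ℤ) (k : ℤ × ℤ) (a b c : ℕ)
    {e₁ e₂ e₃ : ℝ} (h₁ : |e₁| = 1) (h₂ : |e₂| = 1) (h₃ : |e₃| = 1)
    (hk₁ : matsubara T k.1 = e₁ * ((2 * a + 1) * (Real.pi * T)))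
    (hk₂ : matsubara T k.2 = e₂ * ((2 * b + 1) * (Real.pi * T)))
    (hk₃ : matsubara T (-1 - k.1 - k.2) = e₃ * ((2 * c + 1) * (Real.pi * T))) :
    ∃ h : ℝ, |h| ≤ M ^ 3 ∧
      ((2 * a + 1) * (Real.pi * T) < δ → (2 * b + 1) * (Real.pi * T) < δ →
        (2 * c + 1) * (Real.pi * T) < δ → h = 1) ∧
      sunsetWeight η T l k = e₁ * e₂ * e₃ * (h * ((l : ℝ) ^ 2 *
        oddTriple (Real.pi * T * |(l : ℝ)|) a b c)) := by
  have hπ := Real.pi_pos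
  have key : ∀ (j : ℤ) (n : ℕ) (e : ℝ), |e| = 1 →
      matsubara T j = e * ((2 * n + 1) * (Real.pi * T)) →
      |matsubara T j| = (2 * n + 1) * (Real.pi * T) ∧
      freqWeight η T j = e * η (matsubara T j) := by
    intro j n e he hj
    have hp : 0 < (2 * (n : ℝ) + 1) * (Real.pi * T) := by positivity
    refine ⟨by rw [hj, abs_mul, he, one_mul, abs_of_pos hp], ?_⟩
    rw [freqWeight, hj]
    rcases eq_or_eq_neg_of_abs_eq he with rfl | rfl
    · rw [one_mul, sign_pos hp]
      simp
    · rw [neg_one_mul, Left.sign_neg, sign_pos hp]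
      simp
  obtain ⟨a₁, w₁⟩ := key _ _ _ h₁ hk₁
  obtain ⟨a₂, w₂⟩ := key _ _ _ h₂ hk₂
  obtain ⟨a₃, w₃⟩ := key _ _ _ h₃ hk₃
  refine ⟨η (matsubara T k.1) * η (matsubara T k.2) * η (matsubara T (-1 - k.1 - k.2)), ?_, ?_, ?_⟩
  · have hM0 : 0 ≤ M := (abs_nonneg _).trans (hM 0)
    rw [abs_mul, abs_mul, pow_succ, pow_two]
    gcongr <;> exact hM _
  · intro b₁ b₂ b₃
    rw [hδ _ (a₁ ▸ b₁), hδ _ (a₂ ▸ b₂), hδ _ (a₃ ▸ b₃)]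
    norm_num
  · rw [sunsetWeight, w₁, w₂, w₃, a₁, a₂, a₃, oddTriple]
    simp only [mul_assoc]
    ring_nf

lemma matsubara_natCast (T : ℝ) (a : ℕ) : matsubara T a = 1 * ((2 * a + 1) * (Real.pi * T)) := by
  rw [matsubara]
  push_cast
  ring

lemma matsubara_neg_natCast (T : ℝ) (a : ℕ) :
    matsubara T (-(a : ℤ) - 1) = -1 * ((2 * a + 1) * (Real.pi * T)) := by
  rw [matsubara]
  push_cast
  ring

/-- In a sector with one (two) negative frequencies the weight is minus (plus) the overlap times a
product of cutoffs. -/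
lemma exists_sunsetWeight_frequencySector {η : ℝ → ℝ} {M δ : ℝ} (hM : ∀ k, |η k| ≤ M)
    (hδ : ∀ k, |k| < δ → η k = 1) {T : ℝ} (hT : 0 < T) {l : ℤ} (hl : l ≠ 0) (j : Fin 3)
    (s : Bool) (a b : ℕ) :
    ∃ h : ℝ, |h| ≤ M ^ 3 ∧ ((2 * (a + b : ℝ) + 3) * (Real.pi * T) < δ → h = 1) ∧
      sunsetWeight η T l (frequencySector (j, s) (a, b)) =
        (if s then 1 else -1) * (h * ((l : ℝ) ^ 2 *
          oddTriple (Real.pi * T * |(l : ℝ)|) a b (if s then a + b + 1 else a + b))) := by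
  have hπ := Real.pi_pos
  have hl' : 0 < |(l : ℝ)| := abs_pos.mpr (by exact_mod_cast hl)
  have hx : 0 < Real.pi * T * |(l : ℝ)| := by positivity
  set x := Real.pi * T * |(l : ℝ)| with hxdef
  have hpos : ∀ n : ℕ, 0 < (2 * (n : ℝ) + 1) * x := fun n => by positivity
  have sw1 : ∀ a b c : ℕ, oddTriple x a c b = oddTriple x a b c := fun a b c =>
    expSecTriple_swap_right (hpos _) (hpos _) (hpos _)
  have sw2 : ∀ a b c : ℕ, oddTriple x c a b = oddTriple x a b c := fun a b c => by
    rw [← sw1 a b c]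
    exact expSecTriple_swap_left (hpos _) (hpos _) (hpos _)
  -- Over all six sectors the largest index is `a + b + 1`, with frequency `(2(a+b)+3)πT`; one
  -- condition thus controls every cutoff.
  have low : ∀ n : ℕ, n ≤ a + b + 1 → (2 * (a + b : ℝ) + 3) * (Real.pi * T) < δ →
      (2 * (n : ℝ) + 1) * (Real.pi * T) < δ := by
    intro n hn h
    refine lt_of_le_of_lt ?_ h
    have : (n : ℝ) ≤ a + b + 1 := by exact_mod_cast hn
    exact mul_le_mul_of_nonneg_right (by linarith) (by positivity)
  have o1 : |(1 : ℝ)| = 1 := abs_one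
  have o2 : |(-1 : ℝ)| = 1 := by norm_num
  have P := fun n : ℕ => matsubara_natCast T n
  have N := fun n : ℕ => matsubara_neg_natCast T n
  have la := low a (by omega)
  have lb := low b (by omega)
  have lc := low (a + b) (by omega)
  have lc' := low (a + b + 1) (by omega)
  cases s
  · simp only [Bool.false_eq_true, if_false]
    fin_cases j
    · obtain ⟨h, h1, h2, h3⟩ := exists_sunsetWeight_eq hM hδ hT l
        (frequencySector (0, false) (a, b)) a b (a + b) o1 o1 o2 (P a) (P b)
        ((congrArg _ (by simp only [frequencySector]; push_cast; ring)).trans (N (a + b)))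
      exact ⟨h, h1, fun t => h2 (la t) (lb t) (lc t), h3.trans (by ring)⟩
    · obtain ⟨h, h1, h2, h3⟩ := exists_sunsetWeight_eq hM hδ hT l
        (frequencySector (1, false) (a, b)) a (a + b) b o1 o2 o1 (P a)
        ((congrArg _ (by simp only [frequencySector]; push_cast; ring)).trans (N (a + b)))
        ((congrArg _ (by simp only [frequencySector]; ring)).trans (P b))
      rw [← hxdef, sw1] at h3
      exact ⟨h, h1, fun t => h2 (la t) (lc t) (lb t), h3.trans (by ring)⟩
    · obtain ⟨h, h1, h2, h3⟩ := exists_sunsetWeight_eq hM hδ hT l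
        (frequencySector (2, false) (a, b)) (a + b) a b o2 o1 o1
        ((congrArg _ (by simp only [frequencySector]; push_cast; ring)).trans (N (a + b)))
        (P a)
        ((congrArg _ (by simp only [frequencySector]; ring)).trans (P b))
      rw [← hxdef, sw2] at h3
      exact ⟨h, h1, fun t => h2 (lc t) (la t) (lb t), h3.trans (by ring)⟩
  · simp only [if_true]
    fin_cases j
    · obtain ⟨h, h1, h2, h3⟩ := exists_sunsetWeight_eq hM hδ hT l
        (frequencySector (0, true) (a, b)) a b (a + b + 1) o2 o2 o1 (N a) (N b)
        ((congrArg _ (by simp only [frequencySector]; push_cast; ring)).trans (P (a + b + 1)))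
      exact ⟨h, h1, fun t => h2 (la t) (lb t) (lc' t), h3.trans (by ring)⟩
    · obtain ⟨h, h1, h2, h3⟩ := exists_sunsetWeight_eq hM hδ hT l
        (frequencySector (1, true) (a, b)) a (a + b + 1) b o2 o1 o2 (N a)
        ((congrArg _ (by simp only [frequencySector]; push_cast; ring)).trans (P (a + b + 1)))
        ((congrArg _ (by simp only [frequencySector]; ring)).trans (N b))
      rw [← hxdef, sw1] at h3
      exact ⟨h, h1, fun t => h2 (la t) (lc' t) (lb t), h3.trans (by ring)⟩
    · obtain ⟨h, h1, h2, h3⟩ := exists_sunsetWeight_eq hM hδ hT l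
        (frequencySector (2, true) (a, b)) (a + b + 1) a b o1 o2 o2
        ((congrArg _ (by simp only [frequencySector]; push_cast; ring)).trans (P (a + b + 1)))
        (N a)
        ((congrArg _ (by simp only [frequencySector]; ring)).trans (N b))
      rw [← hxdef, sw2] at h3
      exact ⟨h, h1, fun t => h2 (lc' t) (la t) (lb t), h3.trans (by ring)⟩

/-- The six sectors at given `a`, `b` together. -/
def sectorSum (η : ℝ → ℝ) (T : ℝ) (y : ℤ × (ℕ × ℕ)) : ℝ :=
  ∑ i : Fin 3 × Bool, sunsetWeight η T y.1 (frequencySector i y.2)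

lemma summable_sectorSum {η : ℝ → ℝ} {T : ℝ}
    (hs : Summable fun y : ℤ × (ℤ × ℤ) => sunsetWeight η T y.1 y.2) :
    Summable (sectorSum η T) ∧
      ∑' y : ℤ × (ℤ × ℤ), sunsetWeight η T y.1 y.2 = ∑' y, sectorSum η T y := by
  let e : (ℤ × (ℕ × ℕ)) × (Fin 3 × Bool) ≃ ℤ × (ℤ × ℤ) :=
    (Equiv.prodAssoc _ _ _).trans ((Equiv.refl ℤ).prodCongr ((Equiv.prodComm _ _).trans
      (Equiv.ofBijective _ frequencySector_bijective)))
  set F : ℤ × (ℤ × ℤ) → ℝ := fun y => sunsetWeight η T y.1 y.2 with hF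
  have hFe : Summable (F ∘ e) := e.summable_iff.mpr hs
  have h : ∀ y, ∑' i, (F ∘ e) (y, i) = sectorSum η T y := fun y => by
    rw [tsum_fintype]
    rfl
  have h1 := hFe.prod
  simp_rw [h] at h1
  refine ⟨h1, ?_⟩
  rw [← e.tsum_eq F]
  change ∑' z, (F ∘ e) z = _
  rw [hFe.tsum_prod]
  simp_rw [h]

lemma oddTriple_nonneg (x : ℝ) (a b c : ℕ) : 0 ≤ oddTriple x a b c := expSecTriple_nonneg _ _ _

lemma oddTriple_anti {x : ℝ} (hx : 0 < x) (a b c : ℕ) :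
    oddTriple x a b (c + 1) ≤ oddTriple x a b c := by
  refine expSecTriple_anti (by positivity) (by positivity) (by positivity) ?_
  push_cast
  nlinarith

/-- With all cutoffs equal to `1`, the three positions of the exceptional frequency give equal
terms, and the two sign patterns leave a difference of overlaps. -/
lemma sectorSum_le_of_low {η : ℝ → ℝ} {M δ : ℝ} (hM : ∀ k, |η k| ≤ M)
    (hδ : ∀ k, |k| < δ → η k = 1) {T : ℝ} (hT : 0 < T) {l : ℤ} (hl : l ≠ 0) {a b : ℕ}
    (hlow : (2 * (a + b : ℝ) + 3) * (Real.pi * T) < δ) :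
    sectorSum η T (l, (a, b)) = -(3 * ((l : ℝ) ^ 2 *
      (oddTriple (Real.pi * T * |(l : ℝ)|) a b (a + b) -
        oddTriple (Real.pi * T * |(l : ℝ)|) a b (a + b + 1)))) := by
  have hF : ∀ j, sunsetWeight η T l (frequencySector (j, false) (a, b)) =
      -((l : ℝ) ^ 2 * oddTriple (Real.pi * T * |(l : ℝ)|) a b (a + b)) := by
    intro j
    obtain ⟨h, -, h2, h3⟩ := exists_sunsetWeight_frequencySector hM hδ hT hl j false a b
    rw [h3, h2 hlow]
    simp
  have hTr : ∀ j, sunsetWeight η T l (frequencySector (j, true) (a, b)) =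
      (l : ℝ) ^ 2 * oddTriple (Real.pi * T * |(l : ℝ)|) a b (a + b + 1) := by
    intro j
    obtain ⟨h, -, h2, h3⟩ := exists_sunsetWeight_frequencySector hM hδ hT hl j true a b
    rw [h3, h2 hlow]
    simp
  rw [sectorSum, Fintype.sum_prod_type]
  simp only [Fintype.sum_bool, hF, hTr, Finset.sum_const, Finset.card_univ, Fintype.card_fin]
  rw [nsmul_eq_mul]
  push_cast
  ring

lemma sectorSum_le {η : ℝ → ℝ} {M δ : ℝ} (hM : ∀ k, |η k| ≤ M)
    (hδ : ∀ k, |k| < δ → η k = 1) {T : ℝ} (hT : 0 < T) {l : ℤ} (hl : l ≠ 0) (a b : ℕ) :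
    sectorSum η T (l, (a, b)) ≤ 6 * M ^ 3 * ((l : ℝ) ^ 2 *
      oddTriple (Real.pi * T * |(l : ℝ)|) a b (a + b)) := by
  have hπ := Real.pi_pos
  have hl' : 0 < |(l : ℝ)| := abs_pos.mpr (by exact_mod_cast hl)
  have hM0 : 0 ≤ M := (abs_nonneg _).trans (hM 0)
  set x := Real.pi * T * |(l : ℝ)| with hx
  have hx0 : 0 < x := by positivity
  have hall : ∀ j s, sunsetWeight η T l (frequencySector (j, s) (a, b)) ≤
      M ^ 3 * ((l : ℝ) ^ 2 * oddTriple x a b (a + b)) := by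
    intro j s
    obtain ⟨h, h1, -, h3⟩ := exists_sunsetWeight_frequencySector hM hδ hT hl j s a b
    rw [h3, ← hx]
    refine (le_abs_self _).trans ?_
    have hs : |(if s then (1 : ℝ) else -1)| = 1 := by cases s <;> simp
    have hV : oddTriple x a b (if s then a + b + 1 else a + b) ≤ oddTriple x a b (a + b) := by
      cases s
      · simp
      · simpa using oddTriple_anti hx0 a b (a + b)
    have h0 := oddTriple_nonneg x a b (if s then a + b + 1 else a + b)
    rw [abs_mul, hs, one_mul, abs_mul,
      abs_of_nonneg (mul_nonneg (sq_nonneg _) h0)]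
    gcongr
  rw [sectorSum]
  refine (Finset.sum_le_card_nsmul _ _ _ fun i _ => hall i.1 i.2).trans (le_of_eq ?_)
  simp only [Finset.card_univ, Fintype.card_prod, Fintype.card_fin, Fintype.card_bool]
  rw [nsmul_eq_mul]
  push_cast
  ring

/-! ### Bounds on the frequencies that feel the cutoff -/

/-- The identity `1/(pq) = (1/p + 1/q)/(p + q)` for `p = 2a+1`, `q = 2b+1` extracts a second inverse
power of `a + b`. -/
lemma oddTriple_le {x : ℝ} (hx : 0 < x) (a b : ℕ) :
    oddTriple x a b (a + b) ≤ 8 * Real.pi ^ 2 / x ^ 3 *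
      (((2 * (a : ℝ) + 1)⁻¹ + (2 * (b : ℝ) + 1)⁻¹) *
        ((2 * (a + b : ℝ) + 2)⁻¹ * (2 * (a + b : ℝ) + 1)⁻¹)) *
      Real.exp (-((2 * (a + b : ℝ) + 1) * x / 2)) := by
  have h := expSecTriple_le (u := (2 * (a : ℝ) + 1) * x) (v := (2 * (b : ℝ) + 1) * x)
    (w := (2 * ((a + b : ℕ) : ℝ) + 1) * x) (by positivity) (by positivity) (by positivity)
  rw [oddTriple]
  push_cast at h ⊢
  refine h.trans (le_of_eq ?_)
  congr 1
  field_simp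
  ring

/-- At high frequency the two inverse powers of `a + b` are each `O(T/δ)`, reducing `T^{-3}` to
`T^{-1}`. Half of the exponent yields decay in `l`, the other half decay in `a` and `b`. -/
lemma sq_mul_oddTriple_le {T δ : ℝ} (hT : 0 < T) (hδ : 0 < δ) {l : ℤ} (hl : l ≠ 0) {a b : ℕ}
    (hhigh : δ ≤ (2 * (a + b : ℝ) + 3) * (Real.pi * T)) :
    (l : ℝ) ^ 2 * oddTriple (Real.pi * T * |(l : ℝ)|) a b (a + b) ≤
      72 * Real.pi / (δ ^ 2 * T) * (Real.exp (-(δ / 12) * |(l : ℝ)|) *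
        (((2 * (a : ℝ) + 1)⁻¹ + (2 * (b : ℝ) + 1)⁻¹) *
          (Real.exp (-(T * a)) * Real.exp (-(T * b))))) := by
  have hπ := Real.pi_pos
  have hπ3 := Real.pi_gt_three
  have hl1 : 1 ≤ |(l : ℝ)| := one_le_abs_intCast hl
  set L := |(l : ℝ)| with hL
  have hL2 : (l : ℝ) ^ 2 = L ^ 2 := (sq_abs _).symm
  set c : ℝ := a + b with hc
  have hc0 : 0 ≤ c := by positivity
  have h := oddTriple_le (x := Real.pi * T * L) (by positivity) a b
  rw [← hc] at h
  have hπT : 0 < Real.pi * T := by positivity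
  have e1 : (2 * c + 1)⁻¹ ≤ 3 * (Real.pi * T) / δ := by
    rw [inv_le_comm₀ (by positivity) (by positivity), inv_div, div_le_iff₀ (by positivity)]
    nlinarith
  have e2 : (2 * c + 2)⁻¹ ≤ 3 * (Real.pi * T) / δ := by
    refine le_trans ?_ e1
    gcongr
    norm_num
  have e3 : Real.exp (-((2 * c + 1) * (Real.pi * T * L) / 2)) ≤
      Real.exp (-(δ / 12) * L) * (Real.exp (-(T * a)) * Real.exp (-(T * b))) := by
    rw [← Real.exp_add, ← Real.exp_add, Real.exp_le_exp]
    -- Uses `2c + 3 ≤ 3(2c + 1)`.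
    have i1 : δ / 3 ≤ (2 * c + 1) * (Real.pi * T) := by nlinarith
    have i2 : T * c ≤ (2 * c + 1) * (Real.pi * T) / 4 := by nlinarith [mul_nonneg hT.le hc0]
    have i3 : (2 * c + 1) * (Real.pi * T) / 4 ≤ (2 * c + 1) * (Real.pi * T) / 4 * L :=
      le_mul_of_one_le_right (by positivity) hl1
    have i4 : δ / 3 * (L / 4) ≤ (2 * c + 1) * (Real.pi * T) * (L / 4) := by gcongr
    have i5 : T * c = T * a + T * b := by rw [hc]; ring
    nlinarith
  set S := (2 * (a : ℝ) + 1)⁻¹ + (2 * (b : ℝ) + 1)⁻¹ with hS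
  have hS0 : 0 < S := by positivity
  rw [hL2]
  calc _ ≤ L ^ 2 * (8 * Real.pi ^ 2 / (Real.pi * T * L) ^ 3 *
        (S * ((2 * c + 2)⁻¹ * (2 * c + 1)⁻¹)) *
        Real.exp (-((2 * c + 1) * (Real.pi * T * L) / 2))) := by gcongr
    _ ≤ L ^ 2 * (8 * Real.pi ^ 2 / (Real.pi * T * L) ^ 3 *
        (S * ((3 * (Real.pi * T) / δ) * (3 * (Real.pi * T) / δ))) *
        (Real.exp (-(δ / 12) * L) * (Real.exp (-(T * a)) * Real.exp (-(T * b))))) := by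
        gcongr
    _ = L⁻¹ * (72 * Real.pi / (δ ^ 2 * T) * (Real.exp (-(δ / 12) * L) *
        (S * (Real.exp (-(T * a)) * Real.exp (-(T * b)))))) := by
        field_simp
        ring
    _ ≤ _ := mul_le_of_le_one_left (by positivity) (inv_le_one_of_one_le₀ hl1)

lemma half_le_one_sub_exp_neg {t : ℝ} (h0 : 0 < t) (h1 : t ≤ 1) : t / 2 ≤ 1 - Real.exp (-t) := by
  have h := Real.add_one_le_exp t
  have h2 : Real.exp (-t) ≤ (1 + t)⁻¹ := by
    rw [Real.exp_neg]
    gcongr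
    linarith
  have h3 : (1 + t)⁻¹ ≤ 1 - t / 2 := by
    rw [inv_le_iff_one_le_mul₀ (by positivity)]
    nlinarith
  linarith

lemma hasSum_exp_neg_mul_nat {t : ℝ} (ht : 0 < t) :
    HasSum (fun a : ℕ => Real.exp (-(t * a))) (1 - Real.exp (-t))⁻¹ := by
  have h := hasSum_geometric_of_lt_one (Real.exp_pos (-t)).le (Real.exp_lt_one_iff.2 (by linarith))
  refine h.congr_fun fun a => ?_
  rw [← Real.exp_nat_mul]
  congr 1
  ring

lemma tsum_exp_neg_mul_nat_le {t : ℝ} (h0 : 0 < t) (h1 : t ≤ 1) :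
    ∑' a : ℕ, Real.exp (-(t * a)) ≤ 2 / t := by
  rw [(hasSum_exp_neg_mul_nat h0).tsum_eq, ← inv_div]
  have := half_le_one_sub_exp_neg h0 h1
  gcongr

lemma summable_inv_odd_sq : Summable fun a : ℕ => ((2 * (a : ℝ) + 1)⁻¹) ^ 2 := by
  have h := (summable_nat_add_iff 1).mpr (Real.summable_one_div_nat_pow.mpr one_lt_two)
  refine Summable.of_nonneg_of_le (fun a => by positivity) (fun a => ?_) h
  rw [inv_pow, one_div]
  push_cast
  gcongr
  linarith [(Nat.cast_nonneg a : (0 : ℝ) ≤ a)]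

/-- The sum `∑ e^{-ta} / (2a+1)`, which diverges only logarithmically at `t = 0`, is bounded by a
multiple of `t^{-1/2}`. -/
lemma tsum_exp_div_odd_le {t : ℝ} (h0 : 0 < t) (h1 : t ≤ 1) :
    Summable (fun a : ℕ => (2 * (a : ℝ) + 1)⁻¹ * Real.exp (-(t * a))) ∧
    ∑' a : ℕ, (2 * (a : ℝ) + 1)⁻¹ * Real.exp (-(t * a)) ≤
      (∑' a : ℕ, ((2 * (a : ℝ) + 1)⁻¹) ^ 2 + 2) / √t := by
  have hs := Real.sqrt_pos.mpr h0
  have hss := Real.sq_sqrt h0.le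
  -- The bound `xy ≤ x²/√t + √t·y` for `0 < y ≤ 1`, by comparing `x` with `√t`: the first part sums
  -- to `O(1/√t)` because `x²` is summable, the second because `∑ y ≤ 2/t`.
  have hle : ∀ a : ℕ, (2 * (a : ℝ) + 1)⁻¹ * Real.exp (-(t * a)) ≤
      (√t)⁻¹ * ((2 * (a : ℝ) + 1)⁻¹) ^ 2 + √t * Real.exp (-(t * a)) := by
    intro a
    set x := (2 * (a : ℝ) + 1)⁻¹ with hx
    set y := Real.exp (-(t * a)) with hy
    have hx0 : 0 < x := by positivity
    have hy0 : 0 < y := Real.exp_pos _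
    have hy1 : y ≤ 1 := Real.exp_le_one_iff.mpr (by
      have : 0 ≤ t * a := by positivity
      linarith)
    rcases le_total x √t with h | h
    · have i1 : x * y ≤ √t * y := by gcongr
      have i2 : 0 ≤ (√t)⁻¹ * x ^ 2 := by positivity
      linarith
    · have i1 : x * y ≤ x := mul_le_of_le_one_right hx0.le hy1
      have i2 : x ≤ (√t)⁻¹ * x ^ 2 := by
        rw [← div_eq_inv_mul, le_div_iff₀ hs]
        nlinarith
      have i3 : 0 ≤ √t * y := by positivity
      linarith
  have hg := (summable_inv_odd_sq.mul_left (√t)⁻¹).add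
    ((hasSum_exp_neg_mul_nat h0).summable.mul_left √t)
  have hf := Summable.of_nonneg_of_le (fun a : ℕ => by positivity) hle hg
  refine ⟨hf, (hf.tsum_le_tsum hle hg).trans ?_⟩
  rw [(summable_inv_odd_sq.mul_left (√t)⁻¹).tsum_add
    ((hasSum_exp_neg_mul_nat h0).summable.mul_left √t), tsum_mul_left, tsum_mul_left]
  have h2 := mul_le_mul_of_nonneg_left (tsum_exp_neg_mul_nat_le h0 h1) hs.le
  have h3 : √t * (2 / t) = 2 / √t := by
    rw [mul_div_assoc', div_eq_div_iff h0.ne' hs.ne']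
    linear_combination 2 * hss
  rw [h3] at h2
  rw [add_div, div_eq_inv_mul]
  linarith

/-- The majorant of the contribution of the frequencies that feel the cutoff. -/
def highMajorant (δ T : ℝ) (y : ℤ × (ℕ × ℕ)) : ℝ :=
  72 * Real.pi / (δ ^ 2 * T) * (Real.exp (-(δ / 12) * |(y.1 : ℝ)|) *
    (((2 * (y.2.1 : ℝ) + 1)⁻¹ + (2 * (y.2.2 : ℝ) + 1)⁻¹) *
      (Real.exp (-(T * y.2.1)) * Real.exp (-(T * y.2.2)))))

lemma highMajorant_nonneg {δ T : ℝ} (hT : 0 < T) (y : ℤ × (ℕ × ℕ)) : 0 ≤ highMajorant δ T y := by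
  have := Real.pi_pos
  rw [highMajorant]
  positivity

/-- The majorant factorizes: `1/T` from the prefactor, `1/√T` from the index carrying `1/(2a+1)`,
`1/T` from the other, and a sum over `l` independent of `T`. -/
lemma exists_tsum_highMajorant_le {δ : ℝ} (hδ : 0 < δ) :
    ∃ C : ℝ, 0 < C ∧ ∀ T : ℝ, 0 < T → T ≤ 1 →
      Summable (highMajorant δ T) ∧ ∑' y, highMajorant δ T y ≤ C / (T ^ 2 * √T) := by
  have hπ := Real.pi_pos
  set L := ∑' l : ℤ, Real.exp (-(δ / 12) * |(l : ℝ)|) with hL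
  have hLs : Summable fun l : ℤ => Real.exp (-(δ / 12) * |(l : ℝ)|) := by
    simpa using summable_int_pow_mul_exp 0 (c := δ / 12) (by positivity)
  have hL0 : 0 ≤ L := tsum_nonneg fun l => (Real.exp_pos _).le
  set Z := ∑' a : ℕ, ((2 * (a : ℝ) + 1)⁻¹) ^ 2 with hZ
  have hZ0 : 0 ≤ Z := tsum_nonneg fun a => by positivity
  refine ⟨72 * Real.pi / δ ^ 2 * ((L + 1) * (2 * ((Z + 2) * 2))), by positivity,
    fun T hT hT1 => ?_⟩
  obtain ⟨hq, hq'⟩ := tsum_exp_div_odd_le hT hT1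
  have hp := (hasSum_exp_neg_mul_nat hT).summable
  have hp' := tsum_exp_neg_mul_nat_le hT hT1
  set q : ℕ → ℝ := fun a => (2 * (a : ℝ) + 1)⁻¹ * Real.exp (-(T * a)) with hqdef
  set p : ℕ → ℝ := fun a => Real.exp (-(T * a)) with hpdef
  have hq0 : 0 ≤ q := fun a => by simp only [hqdef, Pi.zero_apply]; positivity
  have hp0 : 0 ≤ p := fun a => (Real.exp_pos _).le
  have hqp := hq.mul_of_nonneg hp hq0 hp0
  have hpq := hp.mul_of_nonneg hq hp0 hq0
  have hab := hqp.add hpq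
  have hall := hLs.mul_of_nonneg hab (fun l => (Real.exp_pos _).le)
    (fun z => add_nonneg (mul_nonneg (hq0 _) (hp0 _)) (mul_nonneg (hp0 _) (hq0 _)))
  have heq : highMajorant δ T = fun y => 72 * Real.pi / (δ ^ 2 * T) *
      (Real.exp (-(δ / 12) * |(y.1 : ℝ)|) * (q y.2.1 * p y.2.2 + p y.2.1 * q y.2.2)) := by
    funext y
    simp only [highMajorant, hqdef, hpdef]
    ring
  rw [heq]
  refine ⟨hall.mul_left _, ?_⟩
  rw [tsum_mul_left, ← hLs.tsum_mul_tsum hab hall, hqp.tsum_add hpq, ← hq.tsum_mul_tsum hp hqp,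
    ← hp.tsum_mul_tsum hq hpq]
  have hQ0 : 0 ≤ ∑' a, q a := tsum_nonneg hq0
  have hP0 : 0 ≤ ∑' a, p a := tsum_nonneg hp0
  have hs := Real.sqrt_pos.mpr hT
  have hQP : (∑' a, q a) * (∑' a, p a) ≤ (Z + 2) / √T * (2 / T) := by gcongr
  calc _ = 72 * Real.pi / (δ ^ 2 * T) * (L * (2 * ((∑' a, q a) * (∑' a, p a)))) := by ring
    _ ≤ 72 * Real.pi / (δ ^ 2 * T) * ((L + 1) * (2 * ((Z + 2) / √T * (2 / T)))) := by
        gcongr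
        linarith
    _ = _ := by
        field_simp

/-! ### The gain from the lowest frequencies, and the conclusion -/

/-- The positive lower bound for the gain of the lowest frequencies. -/
def gainConst : ℝ :=
  (Real.pi / 3) ^ 2 * (Real.exp (-(8 * Real.pi)) ^ 3 * (1 - Real.exp (-(2 * Real.pi))))

lemma gainConst_pos : 0 < gainConst := by
  have hπ := Real.pi_pos
  have : Real.exp (-(2 * Real.pi)) < 1 := Real.exp_lt_one_iff.2 (by linarith)
  have h2 : 0 < 1 - Real.exp (-(2 * Real.pi)) := by linarith
  rw [gainConst]
  positivity

/-- Each factor of the lower bound for the decrease is replaced by its worst value on the interval: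
the cube at `4π`, the bracket at `π`. -/
lemma gainConst_le {x : ℝ} (h1 : Real.pi ≤ x) (h2 : x ≤ 4 * Real.pi) :
    gainConst ≤ oddTriple x 0 0 0 - oddTriple x 0 0 1 := by
  have hπ := Real.pi_pos
  have h := le_expSecTriple_sub (u := x) (by linarith)
  rw [oddTriple, oddTriple]
  norm_num at h ⊢
  refine le_trans ?_ h
  rw [gainConst]
  have e1 : Real.exp (-(2 * x)) ≤ Real.exp (-(2 * Real.pi)) := by
    rw [Real.exp_le_exp]
    linarith
  have e2 : Real.exp (-(8 * Real.pi)) ≤ Real.exp (-(2 * x)) := by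
    rw [Real.exp_le_exp]
    linarith
  have e3 : Real.exp (-(2 * Real.pi)) < 1 := Real.exp_lt_one_iff.2 (by linarith)
  have e4 : 0 ≤ 1 - Real.exp (-(2 * Real.pi)) := by linarith
  gcongr

/-- The sites and frequencies that are kept in the lower bound. -/
def gainSet (T : ℝ) : Finset (ℤ × (ℕ × ℕ)) :=
  (Finset.Icc (⌈1 / T⌉₊ : ℤ) (2 * ⌈1 / T⌉₊)) ×ˢ {(0, 0)}

/-- Low pairs are nonpositive and are dropped unless they belong to `gainSet`; high pairs go into
the majorant. The condition `3πT < δ` makes `a = b = 0` low. -/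
lemma sectorSum_le_sub {η : ℝ → ℝ} {M δ : ℝ} (hM : ∀ k, |η k| ≤ M) (hδ0 : 0 < δ)
    (hδ : ∀ k, |k| < δ → η k = 1) {T : ℝ} (hT : 0 < T) (hT1 : T ≤ 1)
    (hTδ : 3 * (Real.pi * T) < δ) (y : ℤ × (ℕ × ℕ)) :
    sectorSum η T y ≤ 6 * M ^ 3 * highMajorant δ T y -
      (gainSet T : Set (ℤ × (ℕ × ℕ))).indicator (fun _ => 3 * gainConst / T ^ 2) y := by
  have hπ := Real.pi_pos
  have hM0 : 0 ≤ M := (abs_nonneg _).trans (hM 0)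
  have hE : 0 ≤ 6 * M ^ 3 * highMajorant δ T y :=
    mul_nonneg (by positivity) (highMajorant_nonneg hT y)
  obtain ⟨l, a, b⟩ := y
  have hN : 1 / T ≤ (⌈1 / T⌉₊ : ℝ) := Nat.le_ceil _
  have hN0 : 0 < (⌈1 / T⌉₊ : ℝ) := lt_of_lt_of_le (by positivity) hN
  have hN1 : (⌈1 / T⌉₊ : ℝ) < 1 / T + 1 := Nat.ceil_lt_add_one (by positivity)
  rcases eq_or_ne l 0 with rfl | hl
  · have h0 : ((0 : ℤ), (a, b)) ∉ (gainSet T : Set (ℤ × (ℕ × ℕ))) := by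
      intro h
      simp only [gainSet, Finset.mem_coe, Finset.mem_product, Finset.mem_Icc] at h
      have : (⌈1 / T⌉₊ : ℝ) ≤ 0 := by exact_mod_cast h.1.1
      linarith
    rw [Set.indicator_of_notMem h0, sub_zero]
    refine le_trans (le_of_eq ?_) hE
    simp [sectorSum, sunsetWeight]
  · have hl1 : 1 ≤ |(l : ℝ)| := one_le_abs_intCast hl
    have hx : 0 < Real.pi * T * |(l : ℝ)| := by positivity
    by_cases hlow : (2 * (a + b : ℝ) + 3) * (Real.pi * T) < δ
    · rw [sectorSum_le_of_low hM hδ hT hl hlow]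
      have hanti := oddTriple_anti hx a b (a + b)
      by_cases hmem : (l, (a, b)) ∈ (gainSet T : Set (ℤ × (ℕ × ℕ)))
      · rw [Set.indicator_of_mem hmem]
        simp only [gainSet, Finset.mem_coe, Finset.mem_product, Finset.mem_Icc,
          Finset.mem_singleton, Prod.mk.injEq] at hmem
        obtain ⟨⟨h1, h2⟩, rfl, rfl⟩ := hmem
        have h1' : (⌈1 / T⌉₊ : ℝ) ≤ l := by exact_mod_cast h1
        have h2' : (l : ℝ) ≤ 2 * ⌈1 / T⌉₊ := by exact_mod_cast h2
        have hlp : 1 / T ≤ (l : ℝ) := hN.trans h1'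
        have hla : |(l : ℝ)| = l := abs_of_pos (lt_of_lt_of_le (by positivity) hlp)
        have hTl : 1 ≤ T * l := by
          rw [div_le_iff₀ hT] at hlp
          linarith
        -- The ceiling is below `1/T + 1`, so `Tl ≤ 2 + 2T ≤ 4`.
        have hTl2 : T * l ≤ 4 := by
          have i1 : T * l ≤ T * (2 * (1 / T + 1)) := by gcongr; linarith
          have i2 : T * (2 * (1 / T + 1)) = 2 + 2 * T := by field_simp
          linarith
        have hg := gainConst_le (x := Real.pi * T * |(l : ℝ)|)
          (by rw [hla, mul_assoc]; nlinarith) (by rw [hla, mul_assoc]; nlinarith)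
        have hsq : gainConst / T ^ 2 ≤ (l : ℝ) ^ 2 *
            (oddTriple (Real.pi * T * |(l : ℝ)|) 0 0 (0 + 0) -
              oddTriple (Real.pi * T * |(l : ℝ)|) 0 0 (0 + 0 + 1)) := by
          have i1 : (1 / T) ^ 2 ≤ (l : ℝ) ^ 2 := by gcongr
          have i2 : gainConst / T ^ 2 = (1 / T) ^ 2 * gainConst := by ring
          rw [i2]
          have := gainConst_pos
          gcongr
        have : 3 * gainConst / T ^ 2 = 3 * (gainConst / T ^ 2) := by ring
        linarith
      · rw [Set.indicator_of_notMem hmem, sub_zero]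
        refine le_trans ?_ hE
        have : 0 ≤ (l : ℝ) ^ 2 * (oddTriple (Real.pi * T * |(l : ℝ)|) a b (a + b) -
            oddTriple (Real.pi * T * |(l : ℝ)|) a b (a + b + 1)) :=
          mul_nonneg (sq_nonneg _) (by linarith)
        linarith
    · have hmem : (l, (a, b)) ∉ (gainSet T : Set (ℤ × (ℕ × ℕ))) := by
        intro h
        simp only [gainSet, Finset.mem_coe, Finset.mem_product, Finset.mem_singleton,
          Prod.mk.injEq] at h
        obtain ⟨-, rfl, rfl⟩ := h
        norm_num at hlow
        linarith
      rw [Set.indicator_of_notMem hmem, sub_zero]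
      refine (sectorSum_le hM hδ hT hl a b).trans ?_
      exact mul_le_mul_of_nonneg_left (sq_mul_oddTriple_le hT hδ0 hl (not_lt.mp hlow))
        (by positivity)

/-- At least `1/T` sites each gain `3g/T²`, where `g` is `gainConst`; this beats the cutoff error by
a factor `√T`. -/
theorem exists_tsum_sectorSum_le {η : ℝ → ℝ} {M δ : ℝ} (hM : ∀ k, |η k| ≤ M) (hδ0 : 0 < δ)
    (hδ : ∀ k, |k| < δ → η k = 1) :
    ∃ C : ℝ, 0 < C ∧ ∀ T : ℝ, 0 < T → T ≤ 1 → 3 * (Real.pi * T) < δ →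
      Summable (sectorSum η T) →
      ∑' y, sectorSum η T y ≤ C / (T ^ 2 * √T) - 3 * gainConst / T ^ 3 := by
  obtain ⟨C, hC, h⟩ := exists_tsum_highMajorant_le hδ0
  have hM0 : 0 ≤ M := (abs_nonneg _).trans (hM 0)
  -- The `+ 1` makes the constant positive from `M ≥ 0` alone.
  refine ⟨(6 * M ^ 3 + 1) * C, by positivity, fun T hT hT1 hTδ hs => ?_⟩
  obtain ⟨hh, hh'⟩ := h T hT hT1
  have hind : HasSum ((gainSet T : Set (ℤ × (ℕ × ℕ))).indicator fun _ => 3 * gainConst / T ^ 2)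
      ((gainSet T).card • (3 * gainConst / T ^ 2)) := by
    rw [← Finset.sum_const]
    have := hasSum_sum_of_ne_finset_zero (s := gainSet T)
      (f := (gainSet T : Set (ℤ × (ℕ × ℕ))).indicator fun _ => 3 * gainConst / T ^ 2)
      (L := SummationFilter.unconditional _)
      (fun y hy => Set.indicator_of_notMem (by simpa using hy) _)
    have e : ∀ y ∈ gainSet T, (gainSet T : Set (ℤ × (ℕ × ℕ))).indicator
        (fun _ => 3 * gainConst / T ^ 2) y = 3 * gainConst / T ^ 2 :=
      fun y hy => Set.indicator_of_mem (Finset.mem_coe.mpr hy) _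
    rwa [Finset.sum_congr rfl e] at this
  have hle := hs.tsum_le_tsum (sectorSum_le_sub hM hδ0 hδ hT hT1 hTδ)
    ((hh.mul_left _).sub hind.summable)
  rw [(hh.mul_left _).tsum_sub hind.summable, tsum_mul_left, hind.tsum_eq] at hle
  refine hle.trans ?_
  have hN : 1 / T ≤ (⌈1 / T⌉₊ : ℝ) := Nat.le_ceil _
  have hcard : 1 / T ≤ ((gainSet T).card : ℝ) := by
    refine hN.trans ?_
    rw [gainSet, Finset.card_product, Int.card_Icc, Finset.card_singleton, mul_one]
    have : ⌈1 / T⌉₊ ≤ (2 * (⌈1 / T⌉₊ : ℤ) + 1 - ⌈1 / T⌉₊).toNat := by omega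
    exact_mod_cast this
  have hg := gainConst_pos
  have h1 : 3 * gainConst / T ^ 3 ≤ (gainSet T).card • (3 * gainConst / T ^ 2) := by
    rw [nsmul_eq_mul]
    calc 3 * gainConst / T ^ 3 = 1 / T * (3 * gainConst / T ^ 2) := by field_simp
      _ ≤ _ := by gcongr
  have h2 : 6 * M ^ 3 * ∑' y, highMajorant δ T y ≤ (6 * M ^ 3 + 1) * C / (T ^ 2 * √T) := by
    rw [mul_div_assoc]
    have : 0 ≤ C / (T ^ 2 * √T) := by positivity
    exact (mul_le_mul_of_nonneg_left hh' (by positivity)).trans (by nlinarith)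
  linarith

end HubbardSunset

theorem mainTheorem2 (η : ℝ → ℝ) (hη_one : ∀ᶠ k in 𝓝 (0 : ℝ), η k = 1)
    (hη_bdd : ∃ M : ℝ, ∀ k, |η k| ≤ M) :
    ∃ K₅ : ℝ, 0 < K₅ ∧ ∃ T₀ : ℝ, 0 < T₀ ∧ ∀ T : ℝ, 0 < T → T < T₀ →
      (∀ s ∈ ({1, -1} : Set ℝ), ∀ σ ∈ ({1, -1} : Set ℝ), ∀ (x₀ : ℝ) (r : ℤ × ℤ),
        HubbardSunset.xPlus r ≠ 0 →
          HubbardSunset.PropagatorConverges η T s σ x₀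
            (HubbardSunset.xPlus r) (HubbardSunset.xMinus r)) ∧
      Integrable (HubbardSunset.sunsetIntegrand η T 1 (-1) (-1)) (HubbardSunset.spaceMeasure T) ∧
      Integrable (HubbardSunset.sunsetIntegrand η T (-1) 1 (-1)) (HubbardSunset.spaceMeasure T) ∧
      K₅ / T ≤ ‖HubbardSunset.approxSecondDeriv η T‖ := by
  obtain ⟨M, hM⟩ := hη_bdd
  obtain ⟨δ, hδ0, hδ'⟩ := Metric.eventually_nhds_iff.mp hη_one
  have hδ : ∀ k, |k| < δ → η k = 1 := fun k hk => hδ' (by simpa using hk)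
  obtain ⟨C, hC, hU⟩ := HubbardSunset.exists_tsum_sectorSum_le hM hδ0 hδ
  have hg := HubbardSunset.gainConst_pos
  have hπ := Real.pi_pos
  set g := HubbardSunset.gainConst with hgdef
  -- The bounds on `T` put the lowest pair below the cutoff and make the error at most half of the
  -- gain `3g/T³`. The remaining half, times `3T²/32`, is `(9g/64)/T`.
  refine ⟨9 * g / 64, by positivity, min 1 (min (δ / (3 * Real.pi)) ((3 * g / (2 * C)) ^ 2)),
    by positivity, fun T hT hTlt => ?_⟩
  have hT1 : T ≤ 1 := hTlt.le.trans (min_le_left _ _)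
  have hTδ : 3 * (Real.pi * T) < δ := by
    have := hTlt.trans_le ((min_le_right _ _).trans (min_le_left _ _))
    rw [lt_div_iff₀ (by positivity)] at this
    linarith
  have hTs : √T ≤ 3 * g / (2 * C) := by
    rw [Real.sqrt_le_left (by positivity)]
    exact hTlt.le.trans ((min_le_right _ _).trans (min_le_right _ _))
  have h1 : (1 : ℝ) ∈ ({1, -1} : Set ℝ) := by simp
  have h2 : (-1 : ℝ) ∈ ({1, -1} : Set ℝ) := by simp
  refine ⟨fun s hs σ hσ x₀ r hr => HubbardSunset.propagatorConverges hM hT hs hσ x₀ hr,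
    (HubbardSunset.integral_sunsetIntegrand hM hT h1 h2 h2).1,
    (HubbardSunset.integral_sunsetIntegrand hM hT h2 h1 h2).1, ?_⟩
  have hw := (HubbardSunset.tsum_sunsetTerm_evenSite hM hT
    (by norm_num : (1 : ℝ) + -1 + -1 = -1)).1
  obtain ⟨hss, heq⟩ := HubbardSunset.summable_sectorSum hw
  have hle := hU T hT hT1 hTδ hss
  rw [HubbardSunset.approxSecondDeriv_eq hM hT, heq, norm_mul, Complex.norm_I, one_mul,
    Complex.norm_real, Real.norm_eq_abs]
  -- The real sum is negative, so its opposite is what must be bounded below.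
  refine le_trans ?_ (neg_le_abs _)
  have hs := Real.sqrt_pos.mpr hT
  have hsq := Real.mul_self_sqrt hT.le
  have hCs : C / (T ^ 2 * √T) ≤ 3 * g / (2 * T ^ 3) := by
    rw [le_div_iff₀ (by positivity)] at hTs
    rw [div_le_div_iff₀ (by positivity) (by positivity)]
    have e : C * (2 * T ^ 3) = (√T * (2 * C)) * (T ^ 2 * √T) := by
      linear_combination (-2 * C * T ^ 2) * hsq
    rw [e]
    gcongr
  have hfin : ∑' y, HubbardSunset.sectorSum η T y ≤ -(3 * g / (2 * T ^ 3)) := by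
    have : 3 * g / T ^ 3 = 3 * g / (2 * T ^ 3) + 3 * g / (2 * T ^ 3) := by
      field_simp
      norm_num
    linarith
  calc 9 * g / 64 / T = 3 * T ^ 2 / 32 * (3 * g / (2 * T ^ 3)) := by
        field_simp
        norm_num
    _ ≤ 3 * T ^ 2 / 32 * -(∑' y, HubbardSunset.sectorSum η T y) := by
        gcongr
        linarith
    _ = _ := by ring

end
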